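/- Let $k$ be a field, $\otimes=\otimes_k$, and let $V$ be a finite-dimensional $k$-vector space. Let $H$ be a Hopf algebra over $k$ whose antipode is bijective, with comultiplication $\Delta(h)=\sum h_1\otimes h_2$ and counit $\varepsilon$. Let $I\subseteq V\otimes V$ be a subspace and suppose that $B=T_k(V)/(I)$, graded with $V$ in degree $1$, is a Koszul algebra, i.e. that the trivial $B$-module $k$ has a linear (minimal) graded free resolution. Let $B$ be a left $H$-module algebra such that the action of $H$ preserves the grading and the subspace $I$ of $V\otimes V$ (so $V$ is an $H$-module). Let $A=B\# H$ be the smash product, $(b\# h)(b'\# h')=\sum b\,(h_1\cdot b')\# h_2h'$, and write $A^e=A\otimes A^{op}$. For $i\ge 0$ let $C_i=H^{\otimes(i+2)}$ be the terms of the bar resolution $\cdots\to C_1\to C_0\to H\to 0$ of $H$, with differentials $h^0\otimes\cdots\otimes h^{n+1}\mapsto\sum_{l=0}^{n}(-1)^l h^0\otimes\cdots\otimes h^lh^{l+1}\otimes\cdots\otimes h^{n+1}$. Let $C_i'=H^{\otimes i}$ ($C_0'=k$), and let $H$ coact on $C_i$ by $$\rho(h^0\otimes\cdots\otimes h^{i+1})=\sum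 h^0_1\cdots h^{i+1}_1\otimes\left(h^0_2\otimes\cdots\otimes h^{i+1}_2\right),\qquad \rho(x)=\sum x_{-1}\otimes x_0 .$$ Let $D_0'=k$, $D_1'=V$ and $D_j'=\bigcap_{l=0}^{j-2}V^{\otimes l}\otimes I\otimes V^{\otimes(j-2-l)}$ for $j\ge 2$, and let $\cdots\to D_1\to D_0\to B\to 0$ be the Koszul resolution of $B$: $D_j=B\otimes D_j'\otimes B\subseteq B^{\otimes(j+2)}$, with the differentials and the augmentation restricted from the bar resolution of $B$, and with the diagonal action of $H$. Then $A\otimes_H C_i$ is an $A$-bimodule: $A$ acts on the left by left multiplication, $H$ acts on the right through $C_i$, and $(a\otimes_H x)\cdot b=\sum a\,(x_{-1}\cdot b)\otimes_H x_0$ for $b\in B$. Likewise $D_j\otimes_B A$ is an $A$-bimodule: $A$ acts on the right by right multiplication, $B$ acts on the left through $D_j$, and $h\cdot(y\otimes_B a)=\sum (h_1\cdot y)\otimes_B h_2a$ for $h\in H$. Put $$X_{i,j}=(A\otimes_H C_i)\otimes_A(D_j\otimes_B A),\qquad d^h_{i,j}=d^{C}_i\otimes\mathrm{id},\qquad d^v_{i,j}=(-1)^i\,\mathrm{id}\otimes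 d^{D}_j ,$$ and let $X_\bullet$ be the total complex, $X_n=\bigoplus_{i+j=n}X_{i,j}$ with differential $d^h+d^v$, augmented to $A$ by the map $X_0=X_{0,0}\to A$ that is the product of the maps $A\otimes_H C_0\to A\otimes_H H\cong A$ and $D_0\otimes_B A\to B\otimes_B A\cong A$ induced by the augmentations of the two resolutions. (a) For all $i,j\ge 0$, the $A^e$-module $X_{i,j}$ is isomorphic to $A\otimes C_i'\otimes D_j'\otimes A$, on which $A^e$ acts by multiplication in the two outer factors. (b) The complex $\cdots\to X_2\to X_1\to X_0\to A\to 0$ is a free resolution of the $A^e$-module $A$: every $X_n$ is a free $A^e$-module and the sequence is exact. -/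

import Mathlib

open scoped TensorProduct DirectSum Coalgebra
open MulOpposite (op unop)

noncomputable section

namespace SmashResolution

set_option linter.unusedSectionVars false

section Sweedler

variable {k H M N : Type*} [CommRing k] [Ring H] [HopfAlgebra k H]
  [AddCommGroup M] [Module k M] [AddCommGroup N] [Module k N]

/-- The orbit map `h ↦ h • m`. -/
def orb (k H : Type*) {M : Type*} [CommRing k] [Ring H] [Algebra k H] [AddCommGroup M] [Module k M]
    [Module H M] [IsScalarTower k H M] (m : M) : H →ₗ[k] M :=
  (Algebra.lsmul k k M : H →ₐ[k] Module.End k M).toLinearMap.flip m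

@[simp] lemma orb_apply [Module H M] [IsScalarTower k H M] (m : M) (h : H) : orb k H m h = h • m := rfl

lemma sum_repr {Z : Type*} [AddCommGroup Z] [Module k Z] (F : H ⊗[k] H →ₗ[k] Z) (h : H) :
    ∑ i ∈ (ℛ k h).index, F ((ℛ k h).left i ⊗ₜ (ℛ k h).right i) = F (Coalgebra.comul h) := by
  rw [← map_sum, (ℛ k h).eq]

lemma sum_coassoc {Z : Type*} [AddCommGroup Z] [Module k Z] (F : H ⊗[k] (H ⊗[k] H) →ₗ[k] Z)
    (h : H) :
    ∑ i ∈ (ℛ k h).index, ∑ j ∈ (ℛ k ((ℛ k h).left i)).index,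
        F ((ℛ k ((ℛ k h).left i)).left j ⊗ₜ
          ((ℛ k ((ℛ k h).left i)).right j ⊗ₜ (ℛ k h).right i)) =
      ∑ i ∈ (ℛ k h).index, ∑ j ∈ (ℛ k ((ℛ k h).right i)).index,
        F ((ℛ k h).left i ⊗ₜ
          ((ℛ k ((ℛ k h).right i)).left j ⊗ₜ (ℛ k ((ℛ k h).right i)).right j)) := by
  simpa only [map_sum] using congrArg F (Coalgebra.sum_tmul_tmul_eq (ℛ k h)
    (fun i => ℛ k ((ℛ k h).left i)) (fun i => ℛ k ((ℛ k h).right i)))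

lemma sum_comul_mul {Z : Type*} [AddCommGroup Z] [Module k Z] (F : H ⊗[k] H →ₗ[k] Z) (h g : H) :
    ∑ i ∈ (ℛ k (h * g)).index, F ((ℛ k (h * g)).left i ⊗ₜ (ℛ k (h * g)).right i) =
      ∑ i ∈ (ℛ k h).index, ∑ j ∈ (ℛ k g).index,
        F (((ℛ k h).left i * (ℛ k g).left j) ⊗ₜ ((ℛ k h).right i * (ℛ k g).right j)) := by
  rw [sum_repr, Bialgebra.comul_mul]
  conv_lhs => rw [← (ℛ k h).eq, ← (ℛ k g).eq]
  simp [Finset.sum_mul_sum, map_sum]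

/-- The diagonal action of `H` on `M ⊗ N` through its comultiplication:
`h (m ⊗ n) = ∑ h₁ m ⊗ h₂ n`, for two given actions of `H`. -/
def diag (α : H →ₐ[k] Module.End k M) (β : H →ₐ[k] Module.End k N) :
    H →ₐ[k] Module.End k (M ⊗[k] N) :=
  (Module.endTensorEndAlgHom (R := k) (S := k) (A := k)).comp
    ((Algebra.TensorProduct.map α β).comp (Bialgebra.comulAlgHom k H))

lemma diag_apply (α : H →ₐ[k] Module.End k M) (β : H →ₐ[k] Module.End k N) (h : H) (m : M) (n : N) :
    diag α β h (m ⊗ₜ n) =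
      ∑ i ∈ (ℛ k h).index, α ((ℛ k h).left i) m ⊗ₜ[k] β ((ℛ k h).right i) n := by
  have : Bialgebra.comulAlgHom k H h = _ := (ℛ k h).eq.symm
  simp [diag, this, map_sum, LinearMap.sum_apply, Module.endTensorEndAlgHom_apply]

end Sweedler

/-! ### Module algebras and smash products -/

/-- `H` acts on the algebra `B` (from the left, as a Hopf algebra): `B` is a left `H`-module with
`h • (ab) = ∑ (h₁ • a)(h₂ • b)` and `h • 1 = ε(h) 1`. -/
class IsModuleAlgebra (k H B : Type*) [CommRing k] [Ring H] [HopfAlgebra k H] [Ring B] [Algebra k B]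
    [Module H B] : Prop where
  smul_mul' : ∀ (h : H) (a b : B), h • (a * b) =
    ∑ i ∈ (ℛ k h).index, ((ℛ k h).left i • a) * ((ℛ k h).right i • b)
  smul_one' : ∀ h : H, h • (1 : B) = algebraMap k B (Coalgebra.counit h)

section Leibniz

variable {k H B M : Type*} [CommRing k] [Ring H] [HopfAlgebra k H] [Ring B] [Algebra k B]
  [Module H B] [IsScalarTower k H B] [IsModuleAlgebra k H B]
  [AddCommGroup M] [Module k M]

/-- Left multiplication by `b` on the first factor of `B ⊗ M`. -/
def lam (k : Type*) {B : Type*} (M : Type*) [CommRing k] [Ring B] [Algebra k B] [AddCommGroup M]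
    [Module k M] : B →ₐ[k] Module.End k (B ⊗[k] M) :=
  (Module.End.rTensorAlgHom k B M).comp (Algebra.lmul k B)

@[simp] lemma lam_apply (b c : B) (m : M) : lam k M b (c ⊗ₜ m) = (b * c) ⊗ₜ m := rfl

lemma diag_lam (β : H →ₐ[k] Module.End k M) (h : H) (b : B) (t : B ⊗[k] M) :
    diag (Algebra.lsmul k k B) β h (lam k M b t) =
      ∑ i ∈ (ℛ k h).index, lam k M ((ℛ k h).left i • b)
        (diag (Algebra.lsmul k k B) β ((ℛ k h).right i) t) := by
  induction t with
  | zero => simp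
  | add x y hx hy => simp only [map_add, hx, hy, Finset.sum_add_distrib]
  | tmul c m =>
    simp only [lam_apply, diag_apply, map_sum, Algebra.lsmul_coe,
      IsModuleAlgebra.smul_mul' (k := k), TensorProduct.sum_tmul]
    have := sum_coassoc (((LinearMap.mul' k B).rTensor M) ∘ₗ
      (TensorProduct.assoc k B B M).symm.toLinearMap ∘ₗ
      (TensorProduct.map (orb k H b) (TensorProduct.map (orb k H c) (β.toLinearMap.flip m)))) h
    simpa using this

end Leibniz

/-- The smash product `B # H`, whose underlying vector space is `B ⊗ H`. -/
def Smash (k B H : Type*) [CommRing k] [Ring B] [Algebra k B] [Ring H] [Algebra k H] : Type _ :=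
  B ⊗[k] H

namespace Smash

section Product

variable {k B H : Type*} [CommRing k] [Ring B] [Algebra k B] [Ring H] [HopfAlgebra k H]

lemma sum_counit_tmul (b : B) (h : H) : ∑ i ∈ (ℛ k h).index,
    (b * algebraMap k B (Coalgebra.counit ((ℛ k h).left i))) ⊗ₜ[k] (ℛ k h).right i =
      b ⊗ₜ[k] h := by
  have h2 := sum_repr ((TensorProduct.mk k B H b) ∘ₗ
    (TensorProduct.lid k H).toLinearMap ∘ₗ Coalgebra.counit.rTensor H) h
  simp only [LinearMap.comp_apply, Coalgebra.rTensor_counit_comul] at h2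
  simp only [LinearMap.rTensor_tmul, LinearEquiv.coe_coe, TensorProduct.lid_tmul,
    TensorProduct.mk_apply, one_smul] at h2
  refine Eq.trans (Finset.sum_congr rfl fun i _ => ?_) h2
  rw [TensorProduct.tmul_smul, TensorProduct.smul_tmul', ← Algebra.commutes,
    Algebra.smul_def]

variable [Module H B] [IsScalarTower k H B]

/-- Left multiplication by `b # h` on `B ⊗ H`: the diagonal action of `h` followed by left
multiplication by `b`, that is `b' ⊗ h' ↦ ∑ b (h₁ • b') ⊗ h₂ h'`. -/
def mulLeft : B ⊗[k] H →ₗ[k] Module.End k (B ⊗[k] H) :=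
  TensorProduct.lift
    ((LinearMap.mul k (Module.End k (B ⊗[k] H))).compl₁₂ (lam k H).toLinearMap
      (diag (Algebra.lsmul k k B) (Algebra.lmul k H)).toLinearMap)

lemma mulLeft_tmul (b : B) (h : H) : mulLeft (b ⊗ₜ[k] h) =
    lam k H b * diag (Algebra.lsmul k k B) (Algebra.lmul k H) h := rfl

lemma mulLeft_tmul_tmul (b b' : B) (h h' : H) : mulLeft (b ⊗ₜ[k] h) (b' ⊗ₜ h') =
    ∑ i ∈ (ℛ k h).index, (b * ((ℛ k h).left i • b')) ⊗ₜ[k] ((ℛ k h).right i * h') := by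
  simp [mulLeft_tmul, diag_apply]

lemma mulLeft_one : mulLeft ((1 : B) ⊗ₜ[k] (1 : H)) = 1 := by
  simp [mulLeft_tmul]

lemma mulLeft_tmul_one (b : B) : mulLeft (b ⊗ₜ[k] (1 : H)) = lam k H b := by
  simp [mulLeft_tmul]

variable [IsModuleAlgebra k H B]

lemma mulLeft_mul (x y : B ⊗[k] H) : mulLeft (mulLeft x y) = mulLeft x * mulLeft y := by
  induction x with
  | zero => simp
  | add x y hx hy => simp only [map_add, LinearMap.add_apply, hx, hy, add_mul]
  | tmul b h =>
  induction y with
  | zero => simp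
  | add x y hx hy => simp only [map_add, hx, hy, mul_add]
  | tmul b' h' =>
  rw [mulLeft_tmul_tmul, map_sum]
  refine LinearMap.ext fun t => ?_
  rw [LinearMap.sum_apply]
  simp only [mulLeft_tmul, Module.End.mul_apply, map_mul]
  rw [diag_lam, map_sum]

lemma mulLeft_apply_one (x : B ⊗[k] H) : mulLeft x (1 ⊗ₜ 1) = x := by
  induction x with
  | zero => simp
  | add x y hx hy => simp only [map_add, LinearMap.add_apply, hx, hy]
  | tmul b h =>
    rw [mulLeft_tmul_tmul]
    simp only [IsModuleAlgebra.smul_one' (k := k), mul_one, sum_counit_tmul]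

lemma mulLeft_one_tmul (h h' : H) : mulLeft ((1 : B) ⊗ₜ[k] h) (1 ⊗ₜ h') = 1 ⊗ₜ (h * h') := by
  rw [mulLeft_tmul_tmul]
  have := congrArg ((LinearMap.mulRight k h').lTensor B) (sum_counit_tmul (k := k) (1 : B) h)
  simpa [map_sum, IsModuleAlgebra.smul_one' (k := k)] using this

end Product

variable (k B H : Type*) [CommRing k] [Ring B] [Algebra k B] [Ring H] [HopfAlgebra k H]

instance : AddCommGroup (Smash k B H) := inferInstanceAs (AddCommGroup (B ⊗[k] H))
instance : Module k (Smash k B H) := inferInstanceAs (Module k (B ⊗[k] H))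

instance : AddCommMonoid (Smash k B H) := inferInstance
instance : AddMonoid (Smash k B H) := inferInstance
instance : AddZeroClass (Smash k B H) := inferInstance
instance : Zero (Smash k B H) := inferInstance

/-- The identification of the vector space `B # H` with `B ⊗ H`. -/
def equiv : Smash k B H ≃ₗ[k] B ⊗[k] H := LinearEquiv.refl k (B ⊗[k] H)

variable {B H} in
/-- The element `b # h`. -/
def mk (b : B) (h : H) : Smash k B H := (equiv k B H).symm (b ⊗ₜ h)

variable {B H}

lemma equiv_mk (b : B) (h : H) : equiv k B H (mk k b h) = b ⊗ₜ h := by simp [mk]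

instance : One (Smash k B H) := ⟨mk k 1 1⟩

lemma equiv_one : equiv k B H 1 = 1 ⊗ₜ 1 := equiv_mk k 1 1

@[elab_as_elim]
lemma induction {p : Smash k B H → Prop} (x : Smash k B H) (h0 : p 0)
    (hm : ∀ b h, p (mk k b h)) (ha : ∀ x y, p x → p y → p (x + y)) : p x := by
  obtain ⟨t, rfl⟩ := (equiv k B H).symm.surjective x
  induction t with
  | zero => simpa using h0
  | add x y hx hy => simpa using ha _ _ hx hy
  | tmul b h => exact hm b h

variable [Module H B] [IsScalarTower k H B]

instance : Mul (Smash k B H) :=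
  ⟨fun x y => (equiv k B H).symm (mulLeft (equiv k B H x) (equiv k B H y))⟩

lemma mul_def (x y : Smash k B H) :
    x * y = (equiv k B H).symm (mulLeft (equiv k B H x) (equiv k B H y)) := rfl

lemma equiv_mul (x y : Smash k B H) :
    equiv k B H (x * y) = mulLeft (equiv k B H x) (equiv k B H y) := by simp [mul_def]

/-- The defining formula `(b # h)(b' # h') = ∑ b (h₁ • b') # h₂ h'` of the smash product. -/
lemma mk_mul_mk (b b' : B) (h h' : H) : mk k b h * mk k b' h' =
    ∑ i ∈ (ℛ k h).index, mk k (b * ((ℛ k h).left i • b')) ((ℛ k h).right i * h') := by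
  apply (equiv k B H).injective
  rw [equiv_mul, equiv_mk, equiv_mk, mulLeft_tmul_tmul, map_sum]
  simp only [equiv_mk]

variable [IsModuleAlgebra k H B]

instance : Ring (Smash k B H) where
  mul_assoc x y z := by
    apply (equiv k B H).injective
    simp only [equiv_mul, mulLeft_mul, Module.End.mul_apply]
  one_mul x := by
    apply (equiv k B H).injective
    simp only [equiv_mul, equiv_one, mulLeft_one, Module.End.one_apply]
  mul_one x := by
    apply (equiv k B H).injective
    simp only [equiv_mul, equiv_one, mulLeft_apply_one]
  left_distrib x y z := by simp only [mul_def, map_add]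
  right_distrib x y z := by simp only [mul_def, map_add, LinearMap.add_apply]
  zero_mul x := by simp only [mul_def, map_zero, LinearMap.zero_apply]
  mul_zero x := by simp only [mul_def, map_zero]
  zsmul := (· • ·)
  zsmul_zero' := SubNegMonoid.zsmul_zero'
  zsmul_succ' := SubNegMonoid.zsmul_succ'
  zsmul_neg' := SubNegMonoid.zsmul_neg'
  neg_add_cancel := neg_add_cancel

instance : Algebra k (Smash k B H) :=
  Algebra.ofModule (fun r x y => by simp only [mul_def, map_smul, LinearMap.smul_apply])
    (fun r x y => by simp only [mul_def, map_smul])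

instance : Semiring (Smash k B H) := inferInstance
instance : NonUnitalNonAssocSemiring (Smash k B H) := inferInstance

variable (B H) in
/-- The embedding `b ↦ b # 1`. -/
def inl : B →ₐ[k] Smash k B H :=
  AlgHom.ofLinearMap ((equiv k B H).symm.toLinearMap ∘ₗ (TensorProduct.mk k B H).flip 1) rfl
    fun x y => by
      apply (equiv k B H).injective
      rw [equiv_mul]
      simp [mulLeft_tmul_one]

variable (B H) in
/-- The embedding `h ↦ 1 # h`. -/
def inr : H →ₐ[k] Smash k B H :=
  AlgHom.ofLinearMap ((equiv k B H).symm.toLinearMap ∘ₗ TensorProduct.mk k B H 1) rfl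
    fun x y => by
      apply (equiv k B H).injective
      rw [equiv_mul]
      simp [mulLeft_one_tmul]

lemma inl_apply (b : B) : inl k B H b = mk k b 1 := rfl
lemma inr_apply (h : H) : inr k B H h = mk k 1 h := rfl

lemma inl_mul_inr (b : B) (h : H) : inl k B H b * inr k B H h = mk k b h := by
  apply (equiv k B H).injective
  rw [equiv_mul]
  simp [mulLeft_tmul_one, inl_apply, inr_apply, equiv_mk]

lemma inr_mul_inl (h : H) (b : B) : inr k B H h * inl k B H b =
    ∑ i ∈ (ℛ k h).index, inl k B H ((ℛ k h).left i • b) * inr k B H ((ℛ k h).right i) := by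
  simp only [inl_mul_inr]
  rw [inl_apply, inr_apply, mk_mul_mk]
  simp

/-- The linear map underlying `lift`. -/
def liftAux {E : Type*} [Ring E] [Algebra k E] (f : B →ₐ[k] E) (g : H →ₐ[k] E) :
    Smash k B H →ₗ[k] E :=
  (TensorProduct.lift ((LinearMap.mul k E).compl₁₂ f.toLinearMap g.toLinearMap)) ∘ₗ
    (equiv k B H).toLinearMap

lemma liftAux_mk {E : Type*} [Ring E] [Algebra k E] (f : B →ₐ[k] E) (g : H →ₐ[k] E) (b : B)
    (h : H) : liftAux k f g (mk k b h) = f b * g h := by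
  simp [liftAux, equiv_mk]

/-- The universal property of the smash product. -/
def lift {E : Type*} [Ring E] [Algebra k E] (f : B →ₐ[k] E) (g : H →ₐ[k] E)
    (hfg : ∀ h b, g h * f b = ∑ i ∈ (ℛ k h).index, f ((ℛ k h).left i • b) * g ((ℛ k h).right i)) :
    Smash k B H →ₐ[k] E :=
  AlgHom.ofLinearMap (liftAux k f g)
    (by rw [show (1 : Smash k B H) = mk k 1 1 from rfl, liftAux_mk]; simp)
    (fun x y => by
      induction x using Smash.induction with
      | h0 => simp
      | ha x y hx hy => simp only [map_add, add_mul, hx, hy]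
      | hm b h =>
      induction y using Smash.induction with
      | h0 => simp
      | ha x y hx hy => simp only [map_add, mul_add, hx, hy]
      | hm b' h' =>
      rw [mk_mul_mk, map_sum]
      simp only [liftAux_mk, map_mul]
      rw [mul_assoc (f b), ← mul_assoc (g h), hfg, Finset.sum_mul, Finset.mul_sum]
      simp only [mul_assoc])

lemma lift_inl {E : Type*} [Ring E] [Algebra k E] (f : B →ₐ[k] E) (g : H →ₐ[k] E) (hfg) (b : B) :
    lift k f g hfg (inl k B H b) = f b := by
  exact (liftAux_mk k f g b 1).trans (by simp)

lemma lift_inr {E : Type*} [Ring E] [Algebra k E] (f : B →ₐ[k] E) (g : H →ₐ[k] E) (hfg) (h : H) :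
    lift k f g hfg (inr k B H h) = g h := by
  exact (liftAux_mk k f g 1 h).trans (by simp)

/-- `B # H` is a left `B`-module by left multiplication. -/
instance : Module B (Smash k B H) := Module.compHom _ (inl k B H).toRingHom

/-- `B # H` is a right `H`-module by right multiplication. -/
instance : Module Hᵐᵒᵖ (Smash k B H) := Module.compHom _ (RingHom.op (inr k B H).toRingHom)

lemma smul_left_def (b : B) (a : Smash k B H) : b • a = inl k B H b * a := rfl
lemma smul_right_def (h : H) (a : Smash k B H) : op h • a = a * inr k B H h := rfl

end Smash

/-! ### Tensor products over a noncommutative ring -/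

section BTensor

variable (k R M N : Type*) [CommRing k] [Ring R] [AddCommGroup M] [Module k M] [Module Rᵐᵒᵖ M]
  [AddCommGroup N] [Module k N] [Module R N]

/-- The `k`-span of the elements `m r ⊗ n - m ⊗ r n` in `M ⊗ N`. -/
def balancing : Submodule k (M ⊗[k] N) :=
  Submodule.span k {t | ∃ (m : M) (r : R) (n : N), t = (op r • m) ⊗ₜ n - m ⊗ₜ (r • n)}

/-- The tensor product `M ⊗_R N` of a right `R`-module `M` and a left `R`-module `N` over a
(noncommutative) `k`-algebra `R`, as a quotient of `M ⊗_k N`. -/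
def BTensor : Type _ := (M ⊗[k] N) ⧸ balancing k R M N

instance : AddCommGroup (BTensor k R M N) :=
  inferInstanceAs (AddCommGroup ((M ⊗[k] N) ⧸ balancing k R M N))
instance : Module k (BTensor k R M N) :=
  inferInstanceAs (Module k ((M ⊗[k] N) ⧸ balancing k R M N))

instance : AddCommMonoid (BTensor k R M N) := inferInstance
instance : AddMonoid (BTensor k R M N) := inferInstance
instance : AddZeroClass (BTensor k R M N) := inferInstance
instance : Zero (BTensor k R M N) := inferInstance

namespace BTensor

/-- The projection `M ⊗_k N → M ⊗_R N`. -/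
def proj : M ⊗[k] N →ₗ[k] BTensor k R M N := (balancing k R M N).mkQ

variable {M N}

/-- The class `m ⊗_R n`. -/
def tmul (m : M) (n : N) : BTensor k R M N := proj k R M N (m ⊗ₜ n)

lemma proj_tmul (m : M) (n : N) : proj k R M N (m ⊗ₜ n) = tmul k R m n := rfl

lemma op_smul_tmul (r : R) (m : M) (n : N) : tmul k R (op r • m) n = tmul k R m (r • n) := by
  refine (Submodule.Quotient.eq _).2 (Submodule.subset_span ⟨m, r, n, rfl⟩)

lemma add_tmul (m m' : M) (n : N) : tmul k R (m + m') n = tmul k R m n + tmul k R m' n := by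
  simp [tmul, TensorProduct.add_tmul]

lemma tmul_add (m : M) (n n' : N) : tmul k R m (n + n') = tmul k R m n + tmul k R m n' := by
  simp [tmul, TensorProduct.tmul_add]

lemma smul_tmul (c : k) (m : M) (n : N) : tmul k R (c • m) n = c • tmul k R m n := by
  rw [tmul, ← TensorProduct.smul_tmul', map_smul, tmul]

lemma tmul_smul (c : k) (m : M) (n : N) : tmul k R m (c • n) = c • tmul k R m n := by
  rw [tmul, TensorProduct.tmul_smul, map_smul, tmul]

lemma sum_tmul {ι : Type*} (s : Finset ι) (m : ι → M) (n : N) :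
    tmul k R (∑ i ∈ s, m i) n = ∑ i ∈ s, tmul k R (m i) n := by
  simp [tmul, TensorProduct.sum_tmul]

lemma tmul_sum {ι : Type*} (s : Finset ι) (m : M) (n : ι → N) :
    tmul k R m (∑ i ∈ s, n i) = ∑ i ∈ s, tmul k R m (n i) := by
  simp [tmul, TensorProduct.tmul_sum]

lemma proj_surjective : Function.Surjective (proj k R M N) := Submodule.mkQ_surjective _

variable {k R} in
@[elab_as_elim]
lemma induction {p : BTensor k R M N → Prop} (x : BTensor k R M N) (h0 : p 0)
    (hm : ∀ m n, p (tmul k R m n)) (ha : ∀ x y, p x → p y → p (x + y)) : p x := by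
  obtain ⟨t, rfl⟩ := proj_surjective k R x
  induction t with
  | zero => simpa using h0
  | add x y hx hy => simpa using ha _ _ hx hy
  | tmul m n => exact hm m n

variable {k R} in
lemma hom_ext {Z : Type*} [AddCommGroup Z] [Module k Z] {f g : BTensor k R M N →ₗ[k] Z}
    (h : ∀ m n, f (tmul k R m n) = g (tmul k R m n)) : f = g :=
  LinearMap.ext fun x => by
    induction x using BTensor.induction with
    | h0 => simp
    | hm m n => exact h m n
    | ha x y hx hy => simp [hx, hy]

/-- The universal property of `M ⊗_R N`. -/
def lift {Z : Type*} [AddCommGroup Z] [Module k Z] (f : M ⊗[k] N →ₗ[k] Z)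
    (hf : ∀ (m : M) (r : R) (n : N), f ((op r • m) ⊗ₜ n) = f (m ⊗ₜ (r • n))) : BTensor k R M N →ₗ[k] Z :=
  (balancing k R M N).liftQ f <| by
    rw [balancing, Submodule.span_le]
    rintro _ ⟨m, r, n, rfl⟩
    simp [hf]

lemma lift_proj {Z : Type*} [AddCommGroup Z] [Module k Z] (f : M ⊗[k] N →ₗ[k] Z) (hf)
    (t : M ⊗[k] N) : lift k R f hf (proj k R M N t) = f t := rfl

lemma lift_tmul {Z : Type*} [AddCommGroup Z] [Module k Z] (f : M ⊗[k] N →ₗ[k] Z) (hf) (m : M)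
    (n : N) : lift k R f hf (tmul k R m n) = f (m ⊗ₜ n) := rfl

/-- The map `f ⊗ g` for `R`-linear maps `f`, `g`. -/
def map {M' N' : Type*} [AddCommGroup M'] [Module k M'] [Module Rᵐᵒᵖ M'] [AddCommGroup N']
    [Module k N'] [Module R N'] (f : M →ₗ[k] M') (g : N →ₗ[k] N')
    (hf : ∀ (r : R) m, f (op r • m) = op r • f m) (hg : ∀ (r : R) n, g (r • n) = r • g n) :
    BTensor k R M N →ₗ[k] BTensor k R M' N' :=
  lift k R (proj k R M' N' ∘ₗ TensorProduct.map f g) fun m r n => by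
    simp only [LinearMap.comp_apply, TensorProduct.map_tmul, hf, hg, proj_tmul, op_smul_tmul]

lemma map_tmul {M' N' : Type*} [AddCommGroup M'] [Module k M'] [Module Rᵐᵒᵖ M'] [AddCommGroup N']
    [Module k N'] [Module R N'] (f : M →ₗ[k] M') (g : N →ₗ[k] N') (hf hg) (m : M) (n : N) :
    map k R f g hf hg (tmul k R m n) = tmul k R (f m) (g n) := rfl

variable (M N) in
/-- A left action on `M` commuting with `R` acts on `M ⊗_R N`. -/
def leftEnd (S : Type*) [Ring S] [Algebra k S] [Module S M] [IsScalarTower k S M]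
    [SMulCommClass S Rᵐᵒᵖ M] : S →ₐ[k] Module.End k (BTensor k R M N) :=
  AlgHom.ofLinearMap
    { toFun := fun s => map k R (Algebra.lsmul k k M s) LinearMap.id
        (fun r m => smul_comm s (op r) m) (fun _ _ => rfl)
      map_add' := fun s t => hom_ext fun m n => by
        change tmul k R ((s + t) • m) n = tmul k R (s • m) n + tmul k R (t • m) n
        rw [add_smul, add_tmul]
      map_smul' := fun c s => hom_ext fun m n => by
        change tmul k R ((c • s) • m) n = c • tmul k R (s • m) n
        rw [smul_assoc, smul_tmul] }
    (hom_ext fun m n => by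
      change tmul k R ((1 : S) • m) n = tmul k R m n
      rw [one_smul])
    (fun s t => hom_ext fun m n => by
      change tmul k R ((s * t) • m) n = tmul k R (s • t • m) n
      rw [mul_smul])

lemma leftEnd_tmul (S : Type*) [Ring S] [Algebra k S] [Module S M] [IsScalarTower k S M]
    [SMulCommClass S Rᵐᵒᵖ M] (s : S) (m : M) (n : N) :
    leftEnd k R M N S s (tmul k R m n) = tmul k R (s • m) n := rfl

variable (M N) in
/-- An action on `N` commuting with `R` acts on `M ⊗_R N`. -/
def rightEnd (S : Type*) [Ring S] [Algebra k S] [Module S N] [IsScalarTower k S N]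
    [SMulCommClass S R N] : S →ₐ[k] Module.End k (BTensor k R M N) :=
  AlgHom.ofLinearMap
    { toFun := fun s => map k R LinearMap.id (Algebra.lsmul k k N s)
        (fun _ _ => rfl) (fun r n => smul_comm s r n)
      map_add' := fun s t => hom_ext fun m n => by
        change tmul k R m ((s + t) • n) = tmul k R m (s • n) + tmul k R m (t • n)
        rw [add_smul, tmul_add]
      map_smul' := fun c s => hom_ext fun m n => by
        change tmul k R m ((c • s) • n) = c • tmul k R m (s • n)
        rw [smul_assoc, tmul_smul] }
    (hom_ext fun m n => by
      change tmul k R m ((1 : S) • n) = tmul k R m n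
      rw [one_smul])
    (fun s t => hom_ext fun m n => by
      change tmul k R m ((s * t) • n) = tmul k R m (s • t • n)
      rw [mul_smul])

lemma rightEnd_tmul (S : Type*) [Ring S] [Algebra k S] [Module S N] [IsScalarTower k S N]
    [SMulCommClass S R N] (s : S) (m : M) (n : N) :
    rightEnd k R M N S s (tmul k R m n) = tmul k R m (s • n) := rfl

end BTensor

end BTensor

/-! ### Bimodules as modules over the enveloping algebra -/

/-- The enveloping algebra `A^e = A ⊗ A^op`. -/
abbrev Env (k A : Type*) [CommRing k] [Ring A] [Algebra k A] : Type _ := A ⊗[k] Aᵐᵒᵖ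

section Bimodule

variable {k A M N : Type*} [CommRing k] [Ring A] [Algebra k A]
  [AddCommGroup M] [Module k M] [Module A M] [Module Aᵐᵒᵖ M] [IsScalarTower k A M]
  [IsScalarTower k Aᵐᵒᵖ M] [SMulCommClass A Aᵐᵒᵖ M]
  [AddCommGroup N] [Module k N] [Module A N] [Module Aᵐᵒᵖ N] [IsScalarTower k A N]
  [IsScalarTower k Aᵐᵒᵖ N] [SMulCommClass A Aᵐᵒᵖ N]

attribute [local instance] TensorProduct.Algebra.module

/-- A map which is linear for the left and for the right action of `A` is `A^e`-linear. -/
def bimodHom (f : M →ₗ[k] N) (hl : ∀ (a : A) m, f (a • m) = a • f m)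
    (hr : ∀ (a : A) m, f (op a • m) = op a • f m) : M →ₗ[Env k A] N where
  toFun := f
  map_add' := map_add f
  map_smul' e m := by
    induction e using TensorProduct.induction_on with
    | zero =>
      exact (congrArg f (zero_smul (Env k A) m)).trans
        ((map_zero f).trans (zero_smul (Env k A) (f m)).symm)
    | add x y hx hy => simp only [add_smul, map_add, hx, hy, RingHom.id_apply]
    | tmul a b =>
      simp only [TensorProduct.Algebra.smul_def, RingHom.id_apply, hl]
      exact congrArg (a • ·) (hr b.unop m)

end Bimodule

/-! ### Extending an `H`-bimodule with coaction to an `A`-bimodule -/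

/-- An `H`-bimodule `C` with a left `H`-coaction `ρ : C → H ⊗ C`, `ρ(x) = ∑ x₋₁ ⊗ x₀`, which is
compatible with both actions: `ρ(h x) = ∑ h₁ x₋₁ ⊗ h₂ x₀` and `ρ(x h) = ∑ x₋₁ h₁ ⊗ x₀ h₂`. -/
class HopfBimodule (k H C : Type*) [CommRing k] [Ring H] [HopfAlgebra k H] [AddCommGroup C]
    [Module k C] [Module H C] [Module Hᵐᵒᵖ C] [IsScalarTower k H C] [IsScalarTower k Hᵐᵒᵖ C] where
  coact : C →ₗ[k] H ⊗[k] C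
  coassoc : ∀ x, TensorProduct.assoc k H H C (Coalgebra.comul.rTensor C (coact x)) =
    coact.lTensor H (coact x)
  counit_coact : ∀ x, TensorProduct.lid k C (Coalgebra.counit.rTensor C (coact x)) = x
  coact_smul : ∀ (h : H) x, coact (h • x) = ∑ i ∈ (ℛ k h).index,
    TensorProduct.map (LinearMap.mulLeft k ((ℛ k h).left i))
      (Algebra.lsmul k k C ((ℛ k h).right i)) (coact x)
  coact_op_smul : ∀ (h : H) x, coact (op h • x) = ∑ i ∈ (ℛ k h).index,
    TensorProduct.map (LinearMap.mulRight k ((ℛ k h).left i))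
      (Algebra.lsmul k k C (op ((ℛ k h).right i))) (coact x)

section IndLeft

variable (k B H C : Type*) [CommRing k] [Ring B] [Algebra k B] [Ring H] [HopfAlgebra k H]
  [Module H B] [IsScalarTower k H B] [IsModuleAlgebra k H B]
  [AddCommGroup C] [Module k C] [Module H C]

/-- `A ⊗_H C` for `A = B # H`. -/
abbrev IndLeft : Type _ := BTensor k H (Smash k B H) C

instance : SMulCommClass (Smash k B H) Hᵐᵒᵖ (Smash k B H) :=
  ⟨fun a h x => (mul_assoc a x (Smash.inr k B H h.unop)).symm⟩

namespace IndLeft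

/-- The left action of `A` on `A ⊗_H C` by left multiplication. -/
instance : Module (Smash k B H) (IndLeft k B H C) :=
  Module.compHom _ (BTensor.leftEnd k H (Smash k B H) C (Smash k B H)).toRingHom

variable {k B H C}

lemma smul_tmul (a a' : Smash k B H) (x : C) :
    a • (BTensor.tmul k H a' x) = BTensor.tmul k H (a * a') x := rfl

/-- The map `H ⊗ C → A ⊗_H C`, `h ⊗ x ↦ a (h • b) ⊗_H x`. -/
def twist (a : Smash k B H) (b : B) : H ⊗[k] C →ₗ[k] IndLeft k B H C :=
  BTensor.proj k H (Smash k B H) C ∘ₗ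
    (LinearMap.mulLeft k a ∘ₗ (Smash.inl k B H).toLinearMap ∘ₗ orb k H b).rTensor C

lemma twist_tmul (a : Smash k B H) (b : B) (h : H) (x : C) :
    twist a b (h ⊗ₜ x) = BTensor.tmul k H (a * Smash.inl k B H (h • b)) x := rfl

lemma twist_smul (a : Smash k B H) (b : B) (h : H) [IsScalarTower k H C] (t : H ⊗[k] C) :
    ∑ i ∈ (ℛ k h).index, twist a b (TensorProduct.map (LinearMap.mulLeft k ((ℛ k h).left i))
      (Algebra.lsmul k k C ((ℛ k h).right i)) t) = twist (op h • a) b t := by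
  induction t with
  | zero => simp
  | add x y hx hy => simp only [map_add, Finset.sum_add_distrib, hx, hy]
  | tmul g x =>
    simp only [TensorProduct.map_tmul, twist_tmul, LinearMap.mulLeft_apply, Algebra.lsmul_coe]
    simp only [← BTensor.op_smul_tmul, ← BTensor.sum_tmul]
    congr 1
    simp only [Smash.smul_right_def, mul_assoc, ← Finset.mul_sum]
    rw [Smash.inr_mul_inl]
    simp only [mul_smul]

lemma smul_twist (a a' : Smash k B H) (b : B) (t : H ⊗[k] C) :
    a • twist a' b t = twist (a * a') b t := by
  induction t with
  | zero => rw [map_zero, map_zero, smul_zero]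
  | add x y hx hy => rw [map_add, map_add, smul_add, hx, hy]
  | tmul g x => rw [twist_tmul, twist_tmul, smul_tmul, mul_assoc]

section Map

variable {C' : Type*} [AddCommGroup C'] [Module k C'] [Module H C']

variable (B) in
/-- The map `id ⊗ f : A ⊗_H C → A ⊗_H C'`. -/
def map (f : C →ₗ[k] C') (hl : ∀ (h : H) x, f (h • x) = h • f x) :
    IndLeft k B H C →ₗ[k] IndLeft k B H C' :=
  BTensor.map k H LinearMap.id f (fun _ _ => rfl) hl

lemma map_smul' (f : C →ₗ[k] C') (hl : ∀ (h : H) x, f (h • x) = h • f x) (a : Smash k B H)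
    (x : IndLeft k B H C) : map B f hl (a • x) = a • map B f hl x := by
  induction x using BTensor.induction with
  | h0 => simp only [smul_zero, map_zero]
  | ha x y hx hy => simp only [smul_add, map_add, hx, hy]
  | hm c x => rfl

end Map

section Right

variable [Module Hᵐᵒᵖ C] [IsScalarTower k Hᵐᵒᵖ C]

lemma twist_op_smul (a : Smash k B H) (b : B) (h : H) (t : H ⊗[k] C) :
    ∑ i ∈ (ℛ k h).index, twist a b (TensorProduct.map (LinearMap.mulRight k ((ℛ k h).left i))
      (Algebra.lsmul k k C (op ((ℛ k h).right i))) t) =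
    ∑ i ∈ (ℛ k h).index, twist a ((ℛ k h).left i • b)
      ((Algebra.lsmul k k C (op ((ℛ k h).right i))).lTensor H t) := by
  induction t with
  | zero => simp
  | add x y hx hy => simp only [map_add, Finset.sum_add_distrib, hx, hy]
  | tmul g x =>
    simp only [TensorProduct.map_tmul, twist_tmul, LinearMap.mulRight_apply,
      LinearMap.lTensor_tmul, mul_smul]

variable [SMulCommClass H Hᵐᵒᵖ C]

variable (k B H C) in
/-- The right action of `H` as a homomorphism of algebras. -/
def rightHHom : H →ₐ[k] (Module.End k (IndLeft k B H C))ᵐᵒᵖ :=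
  haveI : SMulCommClass Hᵐᵒᵖ H C := SMulCommClass.symm _ _ _
  AlgHom.opComm.symm (BTensor.rightEnd k H (Smash k B H) C Hᵐᵒᵖ)

lemma rightHHom_tmul (h : H) (a : Smash k B H) (x : C) :
    (rightHHom k B H C h).unop (BTensor.tmul k H a x) = BTensor.tmul k H a (op h • x) := rfl

lemma rightB_twist (h : H) (a : Smash k B H) (b : B) (t : H ⊗[k] C) :
    (rightHHom k B H C h).unop (twist a b t) =
      twist a b ((Algebra.lsmul k k C (op h)).lTensor H t) := by
  induction t with
  | zero => simp
  | add x y hx hy => simp only [map_add, hx, hy]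
  | tmul g x => rfl

end Right

variable [Module Hᵐᵒᵖ C] [IsScalarTower k H C] [IsScalarTower k Hᵐᵒᵖ C] [HopfBimodule k H C]

open HopfBimodule

/-- The right action of `b ∈ B` on `A ⊗_H C`: `(a ⊗_H x) b = ∑ a (x₋₁ • b) ⊗_H x₀`. -/
def rightB (b : B) : Module.End k (IndLeft k B H C) :=
  BTensor.lift k H
    (TensorProduct.lift (LinearMap.mk₂ k (fun a x => twist a b (coact x))
      (fun a a' x => by
        generalize coact (k := k) (H := H) x = t
        induction t with
        | zero => simp
        | add x y hx hy => simp only [map_add, hx, hy]; abel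
        | tmul g y => simp only [twist_tmul, add_mul, BTensor.add_tmul])
      (fun c a x => by
        generalize coact (k := k) (H := H) x = t
        induction t with
        | zero => simp
        | add x y hx hy => simp only [map_add, hx, hy, smul_add]
        | tmul g y => simp only [twist_tmul, smul_mul_assoc, BTensor.smul_tmul])
      (fun a x y => by simp only [map_add])
      (fun c a x => by simp only [map_smul])))
    (fun a h x => by
      simp only [TensorProduct.lift.tmul, LinearMap.mk₂_apply]
      rw [coact_smul, map_sum, twist_smul])

lemma rightB_tmul (b : B) (a : Smash k B H) (x : C) :
    rightB b (BTensor.tmul k H a x) = twist a b (coact x) := rfl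

lemma twist_twist (a : Smash k B H) (b b' : B) (x : C) :
    rightB b' (twist a b (coact x)) = twist a (b * b') (coact x) := by
  set Ψ : H ⊗[k] (H ⊗[k] C) →ₗ[k] IndLeft k B H C :=
    BTensor.proj k H (Smash k B H) C ∘ₗ
      (LinearMap.mulLeft k a ∘ₗ (Smash.inl k B H).toLinearMap ∘ₗ LinearMap.mul' k B).rTensor C ∘ₗ
      (TensorProduct.assoc k B B C).symm.toLinearMap ∘ₗ
      TensorProduct.map (orb k H b) ((orb k H b').rTensor C) with hΨ
  have h1 : ∀ t : H ⊗[k] C, rightB b' (twist a b t) = Ψ (coact.lTensor H t) := by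
    intro t
    induction t with
    | zero => simp
    | add x y hx hy => simp only [map_add, hx, hy]
    | tmul g y =>
      rw [twist_tmul, rightB_tmul, LinearMap.lTensor_tmul]
      generalize coact (k := k) (H := H) y = s
      induction s with
      | zero => simp
      | add x y hx hy => simp only [map_add, hx, hy, TensorProduct.tmul_add]
      | tmul g' z => simp [hΨ, twist_tmul, BTensor.proj_tmul, mul_assoc]
  have h2 : ∀ t : H ⊗[k] C, Ψ (TensorProduct.assoc k H H C (Coalgebra.comul.rTensor C t)) =
      twist a (b * b') t := by
    intro t
    induction t with
    | zero => simp
    | add x y hx hy => simp only [map_add, hx, hy]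
    | tmul g y =>
      rw [twist_tmul, LinearMap.rTensor_tmul, IsModuleAlgebra.smul_mul' (k := k)]
      conv_lhs => rw [← (ℛ k g).eq]
      simp only [TensorProduct.sum_tmul, map_sum, Finset.mul_sum, BTensor.sum_tmul]
      simp [hΨ, BTensor.proj_tmul]
  rw [h1, ← coassoc, h2]

lemma twist_one (a : Smash k B H) (x : C) :
    twist a (1 : B) (coact x) = BTensor.tmul k H a x := by
  have : ∀ t : H ⊗[k] C, twist a (1 : B) t =
      BTensor.tmul k H a (TensorProduct.lid k C (Coalgebra.counit.rTensor C t)) := by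
    intro t
    induction t with
    | zero => simp [BTensor.tmul]
    | add x y hx hy => simp only [map_add, hx, hy, BTensor.tmul_add]
    | tmul g y =>
      rw [twist_tmul, IsModuleAlgebra.smul_one' (k := k), AlgHom.commutes, ← Algebra.commutes,
        ← Algebra.smul_def]
      simp [BTensor.smul_tmul, BTensor.tmul_smul]
  rw [this, counit_coact]

variable (k B H C) in
/-- The right action of `B` as a homomorphism of algebras. -/
def rightBHom : B →ₐ[k] (Module.End k (IndLeft k B H C))ᵐᵒᵖ :=
  AlgHom.ofLinearMap
    { toFun := fun b => op (rightB b)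
      map_add' := fun b b' => congrArg op <| BTensor.hom_ext fun a x => by
        change twist a (b + b') (coact x) = twist a b (coact x) + twist a b' (coact x)
        generalize coact (k := k) (H := H) x = t
        induction t with
        | zero => simp
        | add x y hx hy => simp only [map_add, hx, hy]; abel
        | tmul g y => simp only [twist_tmul, smul_add, map_add, mul_add, BTensor.add_tmul]
      map_smul' := fun c b => congrArg op <| BTensor.hom_ext fun a x => by
        change twist a (c • b) (coact x) = c • twist a b (coact x)
        generalize coact (k := k) (H := H) x = t
        induction t with
        | zero => simp
        | add x y hx hy => simp only [map_add, hx, hy, smul_add]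
        | tmul g y =>
          have : g • c • b = c • g • b := map_smul (Algebra.lsmul k k B g) c b
          simp only [twist_tmul, this, map_smul, mul_smul_comm, BTensor.smul_tmul] }
    (congrArg op <| BTensor.hom_ext fun a x => by rw [rightB_tmul, twist_one]; rfl)
    (fun b b' => congrArg op <| BTensor.hom_ext fun a x => by
      change twist a (b * b') (coact x) = rightB b' (twist a b (coact x))
      rw [twist_twist])

lemma rightBHom_apply (b : B) : rightBHom k B H C b = op (rightB b) := rfl

variable [SMulCommClass H Hᵐᵒᵖ C]

lemma right_compat (h : H) (b : B) : rightHHom k B H C h * rightBHom k B H C b =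
    ∑ i ∈ (ℛ k h).index,
      rightBHom k B H C ((ℛ k h).left i • b) * rightHHom k B H C ((ℛ k h).right i) := by
  apply MulOpposite.unop_injective
  refine BTensor.hom_ext fun a x => ?_
  rw [MulOpposite.unop_mul, Finset.unop_sum, LinearMap.sum_apply, Module.End.mul_apply,
    rightHHom_tmul, rightBHom_apply, MulOpposite.unop_op, rightB_tmul, coact_op_smul, map_sum,
    twist_op_smul]
  refine Finset.sum_congr rfl fun i _ => ?_
  rw [MulOpposite.unop_mul, Module.End.mul_apply, rightBHom_apply, MulOpposite.unop_op,
    rightB_tmul, rightB_twist]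

variable (k B H C) in
/-- The right action of `A = B # H` on `A ⊗_H C` which is given by the right action of `H` on `C`
and by `(a ⊗_H x) b = ∑ a (x₋₁ • b) ⊗_H x₀` for `b ∈ B`. -/
def rightHom : Smash k B H →ₐ[k] (Module.End k (IndLeft k B H C))ᵐᵒᵖ :=
  Smash.lift k (rightBHom k B H C) (rightHHom k B H C) right_compat

/-- The right action of `A` on `A ⊗_H C`. -/
instance : Module (Smash k B H)ᵐᵒᵖ (IndLeft k B H C) :=
  Module.compHom _ (AlgHom.opComm (rightHom k B H C)).toRingHom

lemma op_inl_smul (b : B) (a : Smash k B H) (x : C) :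
    op (Smash.inl k B H b) • (BTensor.tmul k H a x : IndLeft k B H C) = twist a b (coact x) :=
  congrArg (fun f : (Module.End k (IndLeft k B H C))ᵐᵒᵖ => f.unop (BTensor.tmul k H a x))
    (Smash.lift_inl k (rightBHom k B H C) (rightHHom k B H C) right_compat b)

lemma op_inr_smul (h : H) (a : Smash k B H) (x : C) :
    op (Smash.inr k B H h) • (BTensor.tmul k H a x : IndLeft k B H C) =
      BTensor.tmul k H a (op h • x) :=
  congrArg (fun f : (Module.End k (IndLeft k B H C))ᵐᵒᵖ => f.unop (BTensor.tmul k H a x))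
    (Smash.lift_inr k (rightBHom k B H C) (rightHHom k B H C) right_compat h)

instance : IsScalarTower k (Smash k B H) (IndLeft k B H C) where
  smul_assoc c a x := by
    change BTensor.leftEnd k H (Smash k B H) C (Smash k B H) (c • a) x =
      c • BTensor.leftEnd k H (Smash k B H) C (Smash k B H) a x
    rw [map_smul, LinearMap.smul_apply]

instance : IsScalarTower k (Smash k B H)ᵐᵒᵖ (IndLeft k B H C) where
  smul_assoc c a x := by
    change AlgHom.opComm (rightHom k B H C) (c • a) x = c • AlgHom.opComm (rightHom k B H C) a x
    rw [map_smul, LinearMap.smul_apply]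

lemma op_mk_smul (b : B) (h : H) (x : IndLeft k B H C) :
    op (Smash.mk k b h) • x = op (Smash.inr k B H h) • op (Smash.inl k B H b) • x := by
  rw [← Smash.inl_mul_inr, MulOpposite.op_mul, mul_smul]

instance : SMulCommClass (Smash k B H) (Smash k B H)ᵐᵒᵖ (IndLeft k B H C) where
  smul_comm a a' x := by
    obtain ⟨a', rfl⟩ := MulOpposite.op_surjective a'
    have h1 : ∀ (h : H) (x : IndLeft k B H C), a • op (Smash.inr k B H h) • x =
        op (Smash.inr k B H h) • a • x := by
      intro h x
      induction x using BTensor.induction with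
      | h0 => simp only [smul_zero]
      | ha x y hx hy => simp only [smul_add, hx, hy]
      | hm c x => rw [op_inr_smul, smul_tmul, smul_tmul, op_inr_smul]
    have h2 : ∀ (b : B) (x : IndLeft k B H C), a • op (Smash.inl k B H b) • x =
        op (Smash.inl k B H b) • a • x := by
      intro b x
      induction x using BTensor.induction with
      | h0 => simp only [smul_zero]
      | ha x y hx hy => simp only [smul_add, hx, hy]
      | hm c x => rw [op_inl_smul, smul_tmul, op_inl_smul, smul_twist]
    induction a' using Smash.induction with
    | h0 => simp only [MulOpposite.op_zero, zero_smul, smul_zero]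
    | ha x y hx hy => simp only [MulOpposite.op_add, add_smul, smul_add, hx, hy]
    | hm b h => rw [op_mk_smul, op_mk_smul, h1, h2]

section Map

variable {C' : Type*} [AddCommGroup C'] [Module k C'] [Module H C'] [Module Hᵐᵒᵖ C']
  [IsScalarTower k H C'] [IsScalarTower k Hᵐᵒᵖ C'] [HopfBimodule k H C'] [SMulCommClass H Hᵐᵒᵖ C']

lemma map_op_smul (f : C →ₗ[k] C') (hl : ∀ (h : H) x, f (h • x) = h • f x)
    (hr : ∀ (h : H) x, f (op h • x) = op h • f x)
    (hc : ∀ x, coact (f x) = f.lTensor H (coact x)) (a : Smash k B H)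
    (x : IndLeft k B H C) : map B f hl (op a • x) = op a • map B f hl x := by
  have h1 : ∀ (h : H) (x : IndLeft k B H C), map B f hl (op (Smash.inr k B H h) • x) =
      op (Smash.inr k B H h) • map B f hl x := by
    intro h x
    induction x using BTensor.induction with
    | h0 => simp only [smul_zero, map_zero]
    | ha x y hx hy => simp only [smul_add, map_add, hx, hy]
    | hm c x =>
      rw [op_inr_smul, map, BTensor.map_tmul, BTensor.map_tmul, op_inr_smul, hr]
  have h2 : ∀ (b : B) (x : IndLeft k B H C), map B f hl (op (Smash.inl k B H b) • x) =
      op (Smash.inl k B H b) • map B f hl x := by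
    intro b x
    induction x using BTensor.induction with
    | h0 => simp only [smul_zero, map_zero]
    | ha x y hx hy => simp only [smul_add, map_add, hx, hy]
    | hm c x =>
      rw [op_inl_smul, map, BTensor.map_tmul, op_inl_smul, hc]
      generalize coact (k := k) (H := H) x = t
      induction t with
      | zero => simp only [map_zero]
      | add x y hx hy => simp only [map_add, hx, hy]
      | tmul g x => rfl
  induction a using Smash.induction with
  | h0 => simp only [MulOpposite.op_zero, zero_smul, map_zero]
  | ha x y hx hy => simp only [MulOpposite.op_add, add_smul, map_add, hx, hy]
  | hm b h => rw [op_mk_smul, op_mk_smul, h1, h2]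

end Map

end IndLeft

end IndLeft

/-- A `B`-bimodule `D` with an action of `H` compatible with both actions of `B`:
`h (b y) = ∑ (h₁ b)(h₂ y)` and `h (y b) = ∑ (h₁ y)(h₂ b)`. -/
class EquivariantBimodule (k H B D : Type*) [CommRing k] [Ring H] [HopfAlgebra k H] [Ring B]
    [Algebra k B] [Module H B] [AddCommGroup D] [Module H D] [Module B D] [Module Bᵐᵒᵖ D] :
    Prop where
  smul_smul' : ∀ (h : H) (b : B) (y : D), h • b • y =
    ∑ i ∈ (ℛ k h).index, ((ℛ k h).left i • b) • (ℛ k h).right i • y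
  smul_op_smul' : ∀ (h : H) (b : B) (y : D), h • op b • y =
    ∑ i ∈ (ℛ k h).index, op ((ℛ k h).right i • b) • (ℛ k h).left i • y

section IndRight

variable (k B H D : Type*) [CommRing k] [Ring B] [Algebra k B] [Ring H] [HopfAlgebra k H]
  [Module H B] [IsScalarTower k H B] [IsModuleAlgebra k H B]
  [AddCommGroup D] [Module k D] [Module Bᵐᵒᵖ D]

/-- `D ⊗_B A` for `A = B # H`. -/
abbrev IndRight : Type _ := BTensor k B D (Smash k B H)

instance : SMulCommClass (Smash k B H)ᵐᵒᵖ B (Smash k B H) :=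
  ⟨fun a b x => mul_assoc (Smash.inl k B H b) x a.unop⟩

namespace IndRight

/-- The right action of `A` on `D ⊗_B A` by right multiplication. -/
instance : Module (Smash k B H)ᵐᵒᵖ (IndRight k B H D) :=
  Module.compHom _ (BTensor.rightEnd k B D (Smash k B H) (Smash k B H)ᵐᵒᵖ).toRingHom

variable {k B H D}

lemma op_smul_tmul (a a' : Smash k B H) (y : D) :
    op a • (BTensor.tmul k B y a' : IndRight k B H D) = BTensor.tmul k B y (a' * a) := rfl

section Map

variable {D' : Type*} [AddCommGroup D'] [Module k D'] [Module Bᵐᵒᵖ D']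

variable (H) in
/-- The map `f ⊗ id : D ⊗_B A → D' ⊗_B A`. -/
def map (f : D →ₗ[k] D') (hr : ∀ (b : B) y, f (op b • y) = op b • f y) :
    IndRight k B H D →ₗ[k] IndRight k B H D' :=
  BTensor.map k B f LinearMap.id hr (fun _ _ => rfl)

lemma map_op_smul (f : D →ₗ[k] D') (hr : ∀ (b : B) y, f (op b • y) = op b • f y)
    (a : Smash k B H) (x : IndRight k B H D) : map H f hr (op a • x) = op a • map H f hr x := by
  induction x using BTensor.induction with
  | h0 => simp only [smul_zero, map_zero]
  | ha x y hx hy => simp only [smul_add, map_add, hx, hy]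
  | hm c x => rfl

end Map

variable [Module H D] [IsScalarTower k H D] [Module B D] [IsScalarTower k B D]
  [SMulCommClass B Bᵐᵒᵖ D] [EquivariantBimodule k H B D]

variable (k B H D) in
/-- The diagonal action `h (y ⊗ a) = ∑ h₁ y ⊗ h₂ a` of `H` on `D ⊗_k A`. -/
def diagHom : H →ₐ[k] Module.End k (D ⊗[k] Smash k B H) :=
  diag (Algebra.lsmul k k D) ((Algebra.lmul k (Smash k B H)).comp (Smash.inr k B H))

lemma diagHom_tmul (h : H) (y : D) (a : Smash k B H) : diagHom k B H D h (y ⊗ₜ a) =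
    ∑ i ∈ (ℛ k h).index, ((ℛ k h).left i • y) ⊗ₜ (Smash.inr k B H ((ℛ k h).right i) * a) := by
  rw [diagHom, diag_apply]
  rfl

lemma diagHom_balanced (h : H) (y : D) (b : B) (a : Smash k B H) :
    BTensor.proj k B D (Smash k B H) (diagHom k B H D h ((op b • y) ⊗ₜ a)) =
      BTensor.proj k B D (Smash k B H) (diagHom k B H D h (y ⊗ₜ (b • a))) := by
  simp only [diagHom_tmul, map_sum, BTensor.proj_tmul,
    EquivariantBimodule.smul_op_smul' (k := k) (H := H) (B := B), BTensor.sum_tmul,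
    BTensor.op_smul_tmul, Smash.smul_left_def]
  simp only [← mul_assoc, Smash.inr_mul_inl, Finset.sum_mul, BTensor.tmul_sum]
  have := sum_coassoc (BTensor.proj k B D (Smash k B H) ∘ₗ TensorProduct.map (orb k H y)
    (LinearMap.mulRight k a ∘ₗ LinearMap.mul' k (Smash k B H) ∘ₗ
      TensorProduct.map ((Smash.inl k B H).toLinearMap ∘ₗ orb k H b)
        (Smash.inr k B H).toLinearMap)) h
  simpa [BTensor.proj_tmul] using this

/-- The action of `h ∈ H` on `D ⊗_B A`: `h (y ⊗_B a) = ∑ h₁ y ⊗_B h₂ a`. -/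
def leftH (h : H) : Module.End k (IndRight k B H D) :=
  BTensor.lift k B (BTensor.proj k B D (Smash k B H) ∘ₗ diagHom k B H D h)
    fun y b a => diagHom_balanced h y b a

lemma leftH_proj (h : H) (t : D ⊗[k] Smash k B H) :
    leftH h (BTensor.proj k B D (Smash k B H) t) =
      BTensor.proj k B D (Smash k B H) (diagHom k B H D h t) := rfl

lemma leftH_tmul (h : H) (y : D) (a : Smash k B H) : leftH h (BTensor.tmul k B y a) =
    ∑ i ∈ (ℛ k h).index,
      BTensor.tmul k B ((ℛ k h).left i • y) (Smash.inr k B H ((ℛ k h).right i) * a) := by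
  rw [BTensor.tmul, leftH_proj, diagHom_tmul, map_sum]
  rfl

variable (k B H D) in
/-- The left action of `H` as a homomorphism of algebras. -/
def leftHHom : H →ₐ[k] Module.End k (IndRight k B H D) :=
  AlgHom.ofLinearMap
    { toFun := leftH
      map_add' := fun h h' => LinearMap.ext fun x => by
        obtain ⟨t, rfl⟩ := BTensor.proj_surjective k B x
        simp only [LinearMap.add_apply, leftH_proj, map_add]
      map_smul' := fun c h => LinearMap.ext fun x => by
        obtain ⟨t, rfl⟩ := BTensor.proj_surjective k B x
        simp only [LinearMap.smul_apply, leftH_proj, map_smul, RingHom.id_apply] }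
    (LinearMap.ext fun x => by
      obtain ⟨t, rfl⟩ := BTensor.proj_surjective k B x
      change BTensor.proj k B D (Smash k B H) (diagHom k B H D 1 t) = _
      rw [map_one]; rfl)
    (fun h h' => LinearMap.ext fun x => by
      obtain ⟨t, rfl⟩ := BTensor.proj_surjective k B x
      change BTensor.proj k B D (Smash k B H) (diagHom k B H D (h * h') t) = _
      rw [map_mul]; rfl)

variable (k B H D) in
/-- The left action of `B` as a homomorphism of algebras. -/
def leftBHom : B →ₐ[k] Module.End k (IndRight k B H D) :=
  BTensor.leftEnd k B D (Smash k B H) B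

lemma left_compat (h : H) (b : B) : leftHHom k B H D h * leftBHom k B H D b =
    ∑ i ∈ (ℛ k h).index,
      leftBHom k B H D ((ℛ k h).left i • b) * leftHHom k B H D ((ℛ k h).right i) := by
  refine BTensor.hom_ext fun y a => ?_
  rw [LinearMap.sum_apply]
  change leftH h (BTensor.tmul k B (b • y) a) = ∑ i ∈ (ℛ k h).index,
    leftBHom k B H D ((ℛ k h).left i • b) (leftH ((ℛ k h).right i) (BTensor.tmul k B y a))
  have key : ∀ (c : B) (y : D) (a : Smash k B H),
    leftBHom k B H D c (BTensor.tmul k B y a) = BTensor.tmul k B (c • y) a := fun _ _ _ => rfl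
  simp only [leftH_tmul, map_sum, key,
    EquivariantBimodule.smul_smul' (k := k) (H := H) (B := B), BTensor.sum_tmul]
  have := sum_coassoc (BTensor.proj k B D (Smash k B H) ∘ₗ
    (TensorProduct.lift (Algebra.lsmul k k D : B →ₐ[k] _).toLinearMap).rTensor (Smash k B H) ∘ₗ
    (TensorProduct.assoc k B D (Smash k B H)).symm.toLinearMap ∘ₗ
    TensorProduct.map (orb k H b) (TensorProduct.map (orb k H y)
      (LinearMap.mulRight k a ∘ₗ (Smash.inr k B H).toLinearMap))) h
  simpa [BTensor.proj_tmul] using this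

variable (k B H D) in
/-- The left action of `A = B # H` on `D ⊗_B A` which is given by the left action of `B` on `D`
and by `h (y ⊗_B a) = ∑ h₁ y ⊗_B h₂ a` for `h ∈ H`. -/
def leftHom : Smash k B H →ₐ[k] Module.End k (IndRight k B H D) :=
  Smash.lift k (leftBHom k B H D) (leftHHom k B H D) left_compat

/-- The left action of `A` on `D ⊗_B A`. -/
instance : Module (Smash k B H) (IndRight k B H D) :=
  Module.compHom _ (leftHom k B H D).toRingHom

lemma inl_smul (b : B) (y : D) (a : Smash k B H) :
    Smash.inl k B H b • (BTensor.tmul k B y a : IndRight k B H D) = BTensor.tmul k B (b • y) a :=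
  LinearMap.congr_fun (Smash.lift_inl k (leftBHom k B H D) (leftHHom k B H D) left_compat b) _

lemma inr_smul (h : H) (y : D) (a : Smash k B H) :
    Smash.inr k B H h • (BTensor.tmul k B y a : IndRight k B H D) = ∑ i ∈ (ℛ k h).index,
      BTensor.tmul k B ((ℛ k h).left i • y) (Smash.inr k B H ((ℛ k h).right i) * a) :=
  (LinearMap.congr_fun
    (Smash.lift_inr k (leftBHom k B H D) (leftHHom k B H D) left_compat h) _).trans
    (leftH_tmul h y a)

instance : IsScalarTower k (Smash k B H) (IndRight k B H D) where
  smul_assoc c a x := by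
    change leftHom k B H D (c • a) x = c • leftHom k B H D a x
    rw [map_smul, LinearMap.smul_apply]

instance : IsScalarTower k (Smash k B H)ᵐᵒᵖ (IndRight k B H D) where
  smul_assoc c a x := by
    change BTensor.rightEnd k B D (Smash k B H) (Smash k B H)ᵐᵒᵖ (c • a) x =
      c • BTensor.rightEnd k B D (Smash k B H) (Smash k B H)ᵐᵒᵖ a x
    rw [map_smul, LinearMap.smul_apply]

lemma mk_smul (b : B) (h : H) (x : IndRight k B H D) :
    Smash.mk k b h • x = Smash.inl k B H b • Smash.inr k B H h • x := by
  rw [← Smash.inl_mul_inr, mul_smul]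

instance : SMulCommClass (Smash k B H) (Smash k B H)ᵐᵒᵖ (IndRight k B H D) where
  smul_comm a a' x := by
    obtain ⟨a', rfl⟩ := MulOpposite.op_surjective a'
    have h1 : ∀ (h : H) (x : IndRight k B H D), Smash.inr k B H h • op a' • x =
        op a' • Smash.inr k B H h • x := by
      intro h x
      induction x using BTensor.induction with
      | h0 => simp only [smul_zero]
      | ha x y hx hy => simp only [smul_add, hx, hy]
      | hm y a =>
        simp only [op_smul_tmul, inr_smul, Finset.smul_sum, mul_assoc]
    have h2 : ∀ (b : B) (x : IndRight k B H D), Smash.inl k B H b • op a' • x =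
        op a' • Smash.inl k B H b • x := by
      intro b x
      induction x using BTensor.induction with
      | h0 => simp only [smul_zero]
      | ha x y hx hy => simp only [smul_add, hx, hy]
      | hm y a => simp only [op_smul_tmul, inl_smul]
    induction a using Smash.induction with
    | h0 => simp only [zero_smul, smul_zero]
    | ha x y hx hy => simp only [add_smul, smul_add, hx, hy]
    | hm b h => rw [mk_smul, mk_smul, h1, h2]

lemma map_smul' {D' : Type*} [AddCommGroup D'] [Module k D'] [Module Bᵐᵒᵖ D']
    [Module H D'] [IsScalarTower k H D'] [Module B D'] [IsScalarTower k B D']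
    [SMulCommClass B Bᵐᵒᵖ D'] [EquivariantBimodule k H B D']
    (f : D →ₗ[k] D') (hr : ∀ (b : B) y, f (op b • y) = op b • f y)
    (hl : ∀ (b : B) y, f (b • y) = b • f y) (hh : ∀ (h : H) y, f (h • y) = h • f y)
    (a : Smash k B H) (x : IndRight k B H D) : map H f hr (a • x) = a • map H f hr x := by
  have h1 : ∀ (h : H) (x : IndRight k B H D), map H f hr (Smash.inr k B H h • x) =
      Smash.inr k B H h • map H f hr x := by
    intro h x
    induction x using BTensor.induction with
    | h0 => simp only [smul_zero, map_zero]
    | ha x y hx hy => simp only [smul_add, map_add, hx, hy]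
    | hm y a =>
      rw [inr_smul, map_sum, map, BTensor.map_tmul, inr_smul]
      simp only [BTensor.map_tmul, hh, LinearMap.id_apply]
  have h2 : ∀ (b : B) (x : IndRight k B H D), map H f hr (Smash.inl k B H b • x) =
      Smash.inl k B H b • map H f hr x := by
    intro b x
    induction x using BTensor.induction with
    | h0 => simp only [smul_zero, map_zero]
    | ha x y hx hy => simp only [smul_add, map_add, hx, hy]
    | hm y a => rw [inl_smul, map, BTensor.map_tmul, BTensor.map_tmul, inl_smul, hl]
  induction a using Smash.induction with
  | h0 => simp only [zero_smul, map_zero]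
  | ha x y hx hy => simp only [add_smul, map_add, hx, hy]
  | hm b h => rw [mk_smul, mk_smul, h2, h1]

end IndRight

end IndRight

/-! ### The tensor product of two `A`-bimodules -/

section BimodTensor

variable (k A P Q : Type*) [CommRing k] [Ring A] [Algebra k A]
  [AddCommGroup P] [Module k P] [Module A P] [Module Aᵐᵒᵖ P] [IsScalarTower k A P]
  [IsScalarTower k Aᵐᵒᵖ P] [SMulCommClass A Aᵐᵒᵖ P]
  [AddCommGroup Q] [Module k Q] [Module A Q] [Module Aᵐᵒᵖ Q] [IsScalarTower k A Q]
  [IsScalarTower k Aᵐᵒᵖ Q] [SMulCommClass A Aᵐᵒᵖ Q]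

/-- The tensor product `P ⊗_A Q` of two `A`-bimodules, with the left action of `A` on `P` and the
right action of `A` on `Q`. -/
def BimodTensor : Type _ := BTensor k A P Q

namespace BimodTensor

instance : AddCommGroup (BimodTensor k A P Q) := inferInstanceAs (AddCommGroup (BTensor k A P Q))
instance : Module k (BimodTensor k A P Q) := inferInstanceAs (Module k (BTensor k A P Q))

instance : AddCommMonoid (BimodTensor k A P Q) := inferInstance
instance : AddMonoid (BimodTensor k A P Q) := inferInstance
instance : AddZeroClass (BimodTensor k A P Q) := inferInstance
instance : Zero (BimodTensor k A P Q) := inferInstance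

variable {P Q} in
/-- The class `p ⊗_A q`. -/
def tmul (p : P) (q : Q) : BimodTensor k A P Q := BTensor.tmul k A p q

/-- The left action. -/
def leftHom : A →ₐ[k] Module.End k (BimodTensor k A P Q) := BTensor.leftEnd k A P Q A

/-- The right action. -/
def rightHom : Aᵐᵒᵖ →ₐ[k] Module.End k (BimodTensor k A P Q) :=
  haveI : SMulCommClass Aᵐᵒᵖ A Q := SMulCommClass.symm _ _ _
  BTensor.rightEnd k A P Q Aᵐᵒᵖ

instance : Module A (BimodTensor k A P Q) := Module.compHom _ (leftHom k A P Q).toRingHom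
instance : Module Aᵐᵒᵖ (BimodTensor k A P Q) := Module.compHom _ (rightHom k A P Q).toRingHom

variable {k A P Q}

@[elab_as_elim]
lemma induction {p : BimodTensor k A P Q → Prop} (x : BimodTensor k A P Q) (h0 : p 0)
    (hm : ∀ m n, p (tmul k A m n)) (ha : ∀ x y, p x → p y → p (x + y)) : p x :=
  BTensor.induction (p := p) x h0 hm ha

lemma smul_tmul (a : A) (p : P) (q : Q) : a • tmul k A p q = tmul k A (a • p) q := rfl
lemma op_smul_tmul (a : A) (p : P) (q : Q) : op a • tmul k A p q = tmul k A p (op a • q) := rfl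

instance : IsScalarTower k A (BimodTensor k A P Q) where
  smul_assoc c a x := by
    change leftHom k A P Q (c • a) x = c • leftHom k A P Q a x
    rw [map_smul, LinearMap.smul_apply]

instance : IsScalarTower k Aᵐᵒᵖ (BimodTensor k A P Q) where
  smul_assoc c a x := by
    change rightHom k A P Q (c • a) x = c • rightHom k A P Q a x
    rw [map_smul, LinearMap.smul_apply]

instance : SMulCommClass A Aᵐᵒᵖ (BimodTensor k A P Q) where
  smul_comm a a' x := by
    induction x using BimodTensor.induction with
    | h0 => simp only [smul_zero]
    | ha x y hx hy => simp only [smul_add, hx, hy]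
    | hm p q => rfl

/-- `P ⊗_A Q` as a module over `A^e = A ⊗ A^op`: `(a ⊗ a') x = a x a'`. -/
instance : Module (Env k A) (BimodTensor k A P Q) := TensorProduct.Algebra.module

variable {P' Q' : Type*}
  [AddCommGroup P'] [Module k P'] [Module A P'] [Module Aᵐᵒᵖ P'] [IsScalarTower k A P']
  [IsScalarTower k Aᵐᵒᵖ P'] [SMulCommClass A Aᵐᵒᵖ P']
  [AddCommGroup Q'] [Module k Q'] [Module A Q'] [Module Aᵐᵒᵖ Q'] [IsScalarTower k A Q']
  [IsScalarTower k Aᵐᵒᵖ Q'] [SMulCommClass A Aᵐᵒᵖ Q']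

/-- The `k`-linear map out of `P ⊗_A Q` given by an `A`-balanced bilinear map. -/
def lift {Z : Type*} [AddCommGroup Z] [Module k Z] (f : P →ₗ[k] Q →ₗ[k] Z)
    (hf : ∀ (p : P) (a : A) (q : Q), f (op a • p) q = f p (a • q)) :
    BimodTensor k A P Q →ₗ[k] Z :=
  BTensor.lift k A (TensorProduct.lift f) fun p a q => hf p a q

lemma lift_tmul {Z : Type*} [AddCommGroup Z] [Module k Z] (f : P →ₗ[k] Q →ₗ[k] Z) (hf) (p : P)
    (q : Q) : lift (A := A) f hf (tmul k A p q) = f p q := rfl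

/-- The `k`-linear map underlying `map`. -/
def mapAux (f : P →ₗ[k] P') (fr : ∀ (a : A) p, f (op a • p) = op a • f p)
    (g : Q →ₗ[k] Q') (gl : ∀ (a : A) q, g (a • q) = a • g q) :
    BimodTensor k A P Q →ₗ[k] BimodTensor k A P' Q' :=
  BTensor.map k A f g fr gl

/-- The map `f ⊗ g : P ⊗_A Q → P' ⊗_A Q'` of `A^e`-modules for bimodule maps `f` and `g`. -/
def map (f : P →ₗ[k] P') (fl : ∀ (a : A) p, f (a • p) = a • f p)
    (fr : ∀ (a : A) p, f (op a • p) = op a • f p)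
    (g : Q →ₗ[k] Q') (gl : ∀ (a : A) q, g (a • q) = a • g q)
    (gr : ∀ (a : A) q, g (op a • q) = op a • g q) :
    BimodTensor k A P Q →ₗ[Env k A] BimodTensor k A P' Q' :=
  bimodHom (mapAux f fr g gl)
    (fun a x => by
      induction x using BimodTensor.induction with
      | h0 => simp only [smul_zero, map_zero]
      | ha x y hx hy => simp only [smul_add, map_add, hx, hy]
      | hm p q => exact congrArg (tmul k A · (g q)) (fl a p))
    (fun a x => by
      induction x using BimodTensor.induction with
      | h0 => simp only [smul_zero, map_zero]
      | ha x y hx hy => simp only [smul_add, map_add, hx, hy]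
      | hm p q => exact congrArg (tmul k A (f p)) (gr a q))

lemma map_tmul (f : P →ₗ[k] P') (fl fr) (g : Q →ₗ[k] Q') (gl gr) (p : P) (q : Q) :
    map (k := k) (A := A) f fl fr g gl gr (tmul k A p q) = tmul k A (f p) (g q) := rfl

end BimodTensor

end BimodTensor

/-! ### Tensor powers -/

section TensorPower

variable (k : Type*) (M : Type*) [CommRing k] [AddCommGroup M] [Module k M]

/-- The isomorphism `M ⊗ M^{⊗n} ≃ M^{⊗(n+1)}`, `m ⊗ (m₁ ⊗ ⋯ ⊗ mₙ) ↦ m ⊗ m₁ ⊗ ⋯ ⊗ mₙ`. -/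
def consE (n : ℕ) : M ⊗[k] (⨂[k]^n M) ≃ₗ[k] ⨂[k]^(n + 1) M :=
  (TensorProduct.congr
    (PiTensorProduct.subsingletonEquiv (R := k) (s := fun _ : Fin 1 => M) 0).symm
    (LinearEquiv.refl k (⨂[k]^n M))).trans
  (TensorPower.mulEquiv.trans (TensorPower.cast k M (add_comm 1 n)))

lemma consE_tprod (n : ℕ) (m : M) (x : Fin n → M) :
    consE k M n (m ⊗ₜ PiTensorProduct.tprod k x) =
      PiTensorProduct.tprod k (Fin.cons m x : Fin (n + 1) → M) := by
  have h1 : (PiTensorProduct.subsingletonEquiv (R := k) (s := fun _ : Fin 1 => M) 0).symm m =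
      PiTensorProduct.tprod k (fun _ : Fin 1 => m) := by
    rw [LinearEquiv.symm_apply_eq, PiTensorProduct.subsingletonEquiv_apply_tprod]
  simp only [consE, LinearEquiv.trans_apply, TensorProduct.congr_tmul, LinearEquiv.refl_apply, h1]
  have h2 := TensorPower.tprod_mul_tprod k (fun _ : Fin 1 => m) x
  rw [TensorPower.gMul_def] at h2
  rw [h2, TensorPower.cast_tprod]
  congr 1
  ext i
  refine Fin.cases ?_ (fun j => ?_) i
  · rfl
  · have : Fin.cast (add_comm 1 n).symm j.succ = Fin.natAdd 1 j := by
      ext; simp [add_comm]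
    simp only [Function.comp_apply, this, Fin.append_right, Fin.cons_succ]

variable {k M}

/-- Prepending a vector to a tensor. -/
def tcons {n : ℕ} (m : M) (x : ⨂[k]^n M) : ⨂[k]^(n + 1) M := consE k M n (m ⊗ₜ x)

lemma consE_tmul {n : ℕ} (m : M) (x : ⨂[k]^n M) : consE k M n (m ⊗ₜ x) = tcons m x := rfl

@[simp] lemma consE_symm_tcons {n : ℕ} (m : M) (x : ⨂[k]^n M) :
    (consE k M n).symm (tcons m x) = m ⊗ₜ x := by simp [tcons]

lemma tcons_add {n : ℕ} (m : M) (x y : ⨂[k]^n M) : tcons m (x + y) = tcons m x + tcons m y := by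
  simp [tcons, TensorProduct.tmul_add]

lemma add_tcons {n : ℕ} (m m' : M) (x : ⨂[k]^n M) :
    tcons (m + m') x = tcons m x + tcons m' x := by
  simp [tcons, TensorProduct.add_tmul]

lemma tcons_zero {n : ℕ} (m : M) : tcons m (0 : ⨂[k]^n M) = 0 := by simp [tcons]

lemma zero_tcons {n : ℕ} (x : ⨂[k]^n M) : tcons (0 : M) x = 0 := by simp [tcons]

lemma tcons_smul {n : ℕ} (c : k) (m : M) (x : ⨂[k]^n M) : tcons m (c • x) = c • tcons m x := by
  simp [tcons]

lemma tcons_sum {n : ℕ} {ι : Type*} (s : Finset ι) (m : M) (x : ι → ⨂[k]^n M) :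
    tcons m (∑ i ∈ s, x i) = ∑ i ∈ s, tcons m (x i) := by
  simp [tcons, TensorProduct.tmul_sum]

lemma sum_tcons {n : ℕ} {ι : Type*} (s : Finset ι) (m : ι → M) (x : ⨂[k]^n M) :
    tcons (∑ i ∈ s, m i) x = ∑ i ∈ s, tcons (m i) x := by
  simp [tcons, TensorProduct.sum_tmul]

@[elab_as_elim]
lemma tcons_induction {n : ℕ} {p : ⨂[k]^(n + 1) M → Prop} (x : ⨂[k]^(n + 1) M) (h0 : p 0)
    (hc : ∀ m y, p (tcons m y)) (ha : ∀ x y, p x → p y → p (x + y)) : p x := by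
  obtain ⟨t, rfl⟩ := (consE k M n).surjective x
  induction t with
  | zero => simpa using h0
  | add x y hx hy => simpa using ha _ _ hx hy
  | tmul m y => exact hc m y

lemma tcons_ext {n : ℕ} {Z : Type*} [AddCommGroup Z] [Module k Z]
    {f g : (⨂[k]^(n + 1) M) →ₗ[k] Z} (h : ∀ m y, f (tcons m y) = g (tcons m y)) : f = g := by
  refine LinearMap.ext fun x => ?_
  induction x using tcons_induction with
  | h0 => simp
  | ha x y hx hy => simp only [map_add, hx, hy]
  | hc m y => exact h m y

variable (k M) in
/-- The isomorphism `M^{⊗1} ≃ M`. -/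
def oneE : ⨂[k]^1 M ≃ₗ[k] M :=
  (consE k M 0).symm.trans
    ((TensorProduct.congr (LinearEquiv.refl k M) (PiTensorProduct.isEmptyEquiv (Fin 0))).trans
      (TensorProduct.rid k M))

lemma oneE_tcons (m : M) (c : ⨂[k]^0 M) :
    oneE k M (tcons m c) = PiTensorProduct.isEmptyEquiv (Fin 0) c • m := by
  simp [oneE]

end TensorPower

/-! ### The bar resolution -/

section Bar

variable (k : Type*) (A : Type*) [CommRing k] [Ring A] [Algebra k A]

/-- Left multiplication on the first factor of `A^{⊗(n+1)}`. -/
def lmulHom (n : ℕ) : A →ₐ[k] Module.End k (⨂[k]^(n + 1) A) :=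
  ((consE k A n).conjAlgEquiv k).toAlgHom.comp (lam k (⨂[k]^n A))

/-- Right multiplication on the last factor of `A^{⊗(n+1)}`. -/
def rmulHom : (n : ℕ) → (Aᵐᵒᵖ →ₐ[k] Module.End k (⨂[k]^(n + 1) A))
  | 0 => ((consE k A 0).conjAlgEquiv k).toAlgHom.comp
      ((Module.End.rTensorAlgHom k A (⨂[k]^0 A)).comp (Algebra.lsmul k k A))
  | n + 1 => ((consE k A (n + 1)).conjAlgEquiv k).toAlgHom.comp
      ((Module.End.lTensorAlgHom k (⨂[k]^(n + 1) A) A).comp (rmulHom n))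

variable {k A}

@[simp] lemma lmulHom_tcons {n : ℕ} (a b : A) (x : ⨂[k]^n A) :
    lmulHom k A n a (tcons b x) = tcons (a * b) x := by
  simp [lmulHom, LinearEquiv.conjAlgEquiv, consE_tmul]

@[simp] lemma rmulHom_zero_tcons (a b : A) (x : ⨂[k]^0 A) :
    rmulHom k A 0 (op a) (tcons b x) = tcons (b * a) x := by
  simp [rmulHom, LinearEquiv.conjAlgEquiv]
  rfl

@[simp] lemma rmulHom_succ_tcons {n : ℕ} (a : Aᵐᵒᵖ) (b : A) (x : ⨂[k]^(n + 1) A) :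
    rmulHom k A (n + 1) a (tcons b x) = tcons b (rmulHom k A n a x) := by
  simp [rmulHom, LinearEquiv.conjAlgEquiv]
  rfl

lemma lmulHom_rmulHom {n : ℕ} (a b : A) (x : ⨂[k]^(n + 1) A) :
    lmulHom k A n a (rmulHom k A n (op b) x) = rmulHom k A n (op b) (lmulHom k A n a x) := by
  induction x using tcons_induction with
  | h0 => simp
  | ha x y hx hy => simp only [map_add, hx, hy]
  | hc m y =>
    cases n with
    | zero => simp [mul_assoc]
    | succ n => simp

variable (k A) in
/-- The map `A ⊗ A^{⊗(n+1)} → A^{⊗(n+1)}` multiplying the first two factors. -/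
def mulFirst (n : ℕ) : A ⊗[k] (⨂[k]^(n + 1) A) →ₗ[k] ⨂[k]^(n + 1) A :=
  TensorProduct.lift (lmulHom k A n).toLinearMap

variable (k A) in
/-- The bar differential `δₙ : A^{⊗(n+2)} → A^{⊗(n+1)}`,
`δₙ(a₀ ⊗ ⋯ ⊗ aₙ₊₁) = ∑ᵢ (-1)ⁱ a₀ ⊗ ⋯ ⊗ aᵢ aᵢ₊₁ ⊗ ⋯ ⊗ aₙ₊₁` (the sum over `0 ≤ i ≤ n`), by recursion:
`δₙ(a₀ ⊗ x) = a₀ x - a₀ ⊗ δₙ₋₁(x)`. -/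
def barD : (n : ℕ) → (⨂[k]^(n + 2) A) →ₗ[k] (⨂[k]^(n + 1) A)
  | 0 => mulFirst k A 0 ∘ₗ (consE k A 1).symm.toLinearMap
  | n + 1 => (mulFirst k A (n + 1) - (consE k A (n + 1)).toLinearMap ∘ₗ (barD n).lTensor A) ∘ₗ
      (consE k A (n + 2)).symm.toLinearMap

@[simp] lemma barD_zero_tcons (a : A) (x : ⨂[k]^1 A) :
    barD k A 0 (tcons a x) = lmulHom k A 0 a x := by
  simp [barD, mulFirst]

@[simp] lemma barD_succ_tcons {n : ℕ} (a : A) (x : ⨂[k]^(n + 2) A) :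
    barD k A (n + 1) (tcons a x) = lmulHom k A (n + 1) a x - tcons a (barD k A n x) := by
  simp [barD, mulFirst, consE_tmul]

lemma barD_lmulHom {n : ℕ} (a : A) (x : ⨂[k]^(n + 2) A) :
    barD k A n (lmulHom k A (n + 1) a x) = lmulHom k A n a (barD k A n x) := by
  induction x using tcons_induction with
  | h0 => simp
  | ha x y hx hy => simp only [map_add, hx, hy]
  | hc m y =>
    cases n with
    | zero => simp
    | succ n => simp

lemma barD_rmulHom {n : ℕ} (a : A) (x : ⨂[k]^(n + 2) A) :
    barD k A n (rmulHom k A (n + 1) (op a) x) = rmulHom k A n (op a) (barD k A n x) := by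
  induction n with
  | zero =>
    induction x using tcons_induction with
    | h0 => simp
    | ha x y hx hy => simp only [map_add, hx, hy]
    | hc m y => simp [lmulHom_rmulHom]
  | succ n ih =>
    induction x using tcons_induction with
    | h0 => simp
    | ha x y hx hy => simp only [map_add, hx, hy]
    | hc m y => simp [lmulHom_rmulHom, ih]

variable (k A) in
/-- The augmentation `δ₀ : A ⊗ A → A` of the bar resolution. -/
def barAug : (⨂[k]^2 A) →ₗ[k] A := (oneE k A).toLinearMap ∘ₗ barD k A 0

lemma barAug_tcons (a b : A) (c : ⨂[k]^0 A) :
    barAug k A (tcons a (tcons b c)) = PiTensorProduct.isEmptyEquiv (Fin 0) c • (a * b) := by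
  simp [barAug, oneE_tcons]

lemma oneE_lmulHom (a : A) (x : ⨂[k]^1 A) : oneE k A (lmulHom k A 0 a x) = a * oneE k A x := by
  induction x using tcons_induction with
  | h0 => simp
  | ha x y hx hy => simp only [map_add, hx, hy, mul_add]
  | hc m y => simp [oneE_tcons]

lemma oneE_rmulHom (a : A) (x : ⨂[k]^1 A) :
    oneE k A (rmulHom k A 0 (op a) x) = oneE k A x * a := by
  induction x using tcons_induction with
  | h0 => simp
  | ha x y hx hy => simp only [map_add, hx, hy, add_mul]
  | hc m y => simp [oneE_tcons]

lemma barAug_lmulHom (a : A) (x : ⨂[k]^2 A) :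
    barAug k A (lmulHom k A 1 a x) = a * barAug k A x := by
  simp only [barAug, LinearMap.comp_apply, barD_lmulHom]
  exact oneE_lmulHom _ _

lemma barAug_rmulHom (a : A) (x : ⨂[k]^2 A) :
    barAug k A (rmulHom k A 1 (op a) x) = barAug k A x * a := by
  simp only [barAug, LinearMap.comp_apply, barD_rmulHom]
  exact oneE_rmulHom _ _

variable (k A) in
/-- The `n`-th term `A^{⊗(n+2)}` of the bar resolution of `A`. -/
def BarTerm (n : ℕ) : Type _ := ⨂[k]^(n + 2) A

instance (n : ℕ) : AddCommGroup (BarTerm k A n) := inferInstanceAs (AddCommGroup (⨂[k]^(n + 2) A))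
instance (n : ℕ) : Module k (BarTerm k A n) := inferInstanceAs (Module k (⨂[k]^(n + 2) A))
instance (n : ℕ) : AddCommMonoid (BarTerm k A n) := inferInstance
instance (n : ℕ) : AddMonoid (BarTerm k A n) := inferInstance
instance (n : ℕ) : AddZeroClass (BarTerm k A n) := inferInstance
instance (n : ℕ) : Zero (BarTerm k A n) := inferInstance
/-- `A` acts on the left by multiplication in the leftmost factor. -/
instance (n : ℕ) : Module A (BarTerm k A n) :=
  Module.compHom (BarTerm k A n)
    (show A →+* Module.End k (BarTerm k A n) from (lmulHom k A (n + 1)).toRingHom)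
/-- `A` acts on the right by multiplication in the rightmost factor. -/
instance (n : ℕ) : Module Aᵐᵒᵖ (BarTerm k A n) :=
  Module.compHom (BarTerm k A n)
    (show Aᵐᵒᵖ →+* Module.End k (BarTerm k A n) from (rmulHom k A (n + 1)).toRingHom)

lemma BarTerm.smul_def {n : ℕ} (a : A) (x : BarTerm k A n) : a • x = lmulHom k A (n + 1) a x := rfl
lemma BarTerm.op_smul_def {n : ℕ} (a : Aᵐᵒᵖ) (x : BarTerm k A n) :
    a • x = rmulHom k A (n + 1) a x := rfl

instance (n : ℕ) : IsScalarTower k A (BarTerm k A n) where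
  smul_assoc c a x := LinearMap.congr_fun (map_smul (lmulHom k A (n + 1)) c a) x
instance (n : ℕ) : IsScalarTower k Aᵐᵒᵖ (BarTerm k A n) where
  smul_assoc c a x := LinearMap.congr_fun (map_smul (rmulHom k A (n + 1)) c a) x
instance (n : ℕ) : SMulCommClass A Aᵐᵒᵖ (BarTerm k A n) where
  smul_comm a b x := lmulHom_rmulHom a b.unop x

variable (k A) in
/-- The bar differential as a map between the terms of the bar resolution. -/
def BarTerm.d (n : ℕ) : BarTerm k A (n + 1) →ₗ[k] BarTerm k A n := barD k A (n + 1)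

end Bar

/-! ### The bar resolution of a Hopf algebra -/

section Coaction

variable (k : Type*) (H : Type*) [CommRing k] [Ring H] [HopfAlgebra k H]

/-- For `c ∈ H ⊗ H`, the map `H ⊗ H^{⊗n} → H ⊗ H^{⊗(n+1)}` which is
`g ⊗ y ↦ c₁ g ⊗ (c₂ ⊗ y)`. -/
def prep (n : ℕ) : H ⊗[k] H →ₗ[k] H ⊗[k] (⨂[k]^n H) →ₗ[k] H ⊗[k] (⨂[k]^(n + 1) H) :=
  TensorProduct.map₂ (LinearMap.mul k H) (TensorProduct.curry (consE k H n).toLinearMap)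

/-- The coaction `h¹ ⊗ ⋯ ⊗ hⁿ ↦ ∑ h¹₁ ⋯ hⁿ₁ ⊗ (h¹₂ ⊗ ⋯ ⊗ hⁿ₂)` of `H` on `H^{⊗n}`. -/
def tpCoact : (n : ℕ) → (⨂[k]^n H) →ₗ[k] H ⊗[k] (⨂[k]^n H)
  | 0 => TensorProduct.mk k H (⨂[k]^0 H) 1
  | n + 1 => TensorProduct.lift ((prep k H n).compl₁₂ Coalgebra.comul (tpCoact n)) ∘ₗ
      (consE k H n).symm.toLinearMap

variable {k H}

lemma prep_tmul {n : ℕ} (p q g : H) (y : ⨂[k]^n H) :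
    prep k H n (p ⊗ₜ q) (g ⊗ₜ y) = (p * g) ⊗ₜ tcons q y := rfl

lemma tpCoact_zero (c : ⨂[k]^0 H) : tpCoact k H 0 c = 1 ⊗ₜ c := rfl

lemma tpCoact_tcons {n : ℕ} (h : H) (x : ⨂[k]^n H) :
    tpCoact k H (n + 1) (tcons h x) = prep k H n (Coalgebra.comul h) (tpCoact k H n x) := by
  simp [tpCoact]

variable (k H) in
/-- For `c ∈ H ⊗ H`, the map `g ⊗ y ↦ c₁ g ⊗ c₂ y`. -/
def lmul2 (n : ℕ) : H ⊗[k] H →ₗ[k] H ⊗[k] (⨂[k]^(n + 1) H) →ₗ[k] H ⊗[k] (⨂[k]^(n + 1) H) :=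
  TensorProduct.map₂ (LinearMap.mul k H) (lmulHom k H n).toLinearMap

variable (k H) in
/-- For `c ∈ H ⊗ H`, the map `g ⊗ y ↦ g c₁ ⊗ y c₂`. -/
def rmul2 (n : ℕ) : H ⊗[k] H →ₗ[k] H ⊗[k] (⨂[k]^(n + 1) H) →ₗ[k] H ⊗[k] (⨂[k]^(n + 1) H) :=
  TensorProduct.map₂ (LinearMap.mul k H).flip
    ((rmulHom k H n).toLinearMap ∘ₗ (MulOpposite.opLinearEquiv k).toLinearMap)

lemma lmul2_tmul {n : ℕ} (p q g : H) (y : ⨂[k]^(n + 1) H) :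
    lmul2 k H n (p ⊗ₜ q) (g ⊗ₜ y) = (p * g) ⊗ₜ lmulHom k H n q y := rfl

lemma rmul2_tmul {n : ℕ} (p q g : H) (y : ⨂[k]^(n + 1) H) :
    rmul2 k H n (p ⊗ₜ q) (g ⊗ₜ y) = (g * p) ⊗ₜ rmulHom k H n (op q) y := rfl

lemma lmul2_prep {n : ℕ} (c d : H ⊗[k] H) (t : H ⊗[k] (⨂[k]^n H)) :
    lmul2 k H n c (prep k H n d t) = prep k H n (c * d) t := by
  induction c with
  | zero => simp
  | add x y hx hy => simp only [map_add, LinearMap.add_apply, add_mul, hx, hy]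
  | tmul p q =>
  induction d with
  | zero => simp
  | add x y hx hy => simp only [map_add, LinearMap.add_apply, mul_add, hx, hy]
  | tmul r s =>
  induction t with
  | zero => simp
  | add x y hx hy => simp only [map_add, hx, hy]
  | tmul g y => simp [prep_tmul, lmul2_tmul, mul_assoc]

lemma rmul2_prep_zero (c d : H ⊗[k] H) (z : ⨂[k]^0 H) :
    rmul2 k H 0 c (prep k H 0 d (1 ⊗ₜ z)) = prep k H 0 (d * c) (1 ⊗ₜ z) := by
  induction c with
  | zero => simp
  | add x y hx hy => simp only [map_add, LinearMap.add_apply, mul_add, hx, hy]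
  | tmul p q =>
  induction d with
  | zero => simp
  | add x y hx hy => simp only [map_add, LinearMap.add_apply, add_mul, hx, hy]
  | tmul r s => simp [prep_tmul, rmul2_tmul]

lemma rmul2_prep_succ {n : ℕ} (c d : H ⊗[k] H) (t : H ⊗[k] (⨂[k]^(n + 1) H)) :
    rmul2 k H (n + 1) c (prep k H (n + 1) d t) = prep k H (n + 1) d (rmul2 k H n c t) := by
  induction c with
  | zero => simp
  | add x y hx hy => simp only [map_add, LinearMap.add_apply, hx, hy]
  | tmul p q =>
  induction d with
  | zero => simp
  | add x y hx hy => simp only [map_add, LinearMap.add_apply, hx, hy]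
  | tmul r s =>
  induction t with
  | zero => simp
  | add x y hx hy => simp only [map_add, hx, hy]
  | tmul g y => simp [prep_tmul, rmul2_tmul, mul_assoc]

lemma tpCoact_lmulHom {n : ℕ} (h : H) (x : ⨂[k]^(n + 1) H) :
    tpCoact k H (n + 1) (lmulHom k H n h x) =
      lmul2 k H n (Coalgebra.comul h) (tpCoact k H (n + 1) x) := by
  induction x using tcons_induction with
  | h0 => simp
  | ha x y hx hy => simp only [map_add, hx, hy]
  | hc m y => rw [lmulHom_tcons, tpCoact_tcons, tpCoact_tcons, lmul2_prep, Bialgebra.comul_mul]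

lemma tpCoact_rmulHom {n : ℕ} (h : H) (x : ⨂[k]^(n + 1) H) :
    tpCoact k H (n + 1) (rmulHom k H n (op h) x) =
      rmul2 k H n (Coalgebra.comul h) (tpCoact k H (n + 1) x) := by
  induction n with
  | zero =>
    induction x using tcons_induction with
    | h0 => simp
    | ha x y hx hy => simp only [map_add, hx, hy]
    | hc m y =>
      rw [rmulHom_zero_tcons, tpCoact_tcons, tpCoact_tcons, tpCoact_zero, rmul2_prep_zero,
        Bialgebra.comul_mul]
  | succ n ih =>
    induction x using tcons_induction with
    | h0 => simp
    | ha x y hx hy => simp only [map_add, hx, hy]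
    | hc m y => rw [rmulHom_succ_tcons, tpCoact_tcons, tpCoact_tcons, rmul2_prep_succ, ih]

lemma lTensor_barD_zero_prep (c : H ⊗[k] H) (t : H ⊗[k] (⨂[k]^1 H)) :
    (barD k H 0).lTensor H (prep k H 1 c t) = lmul2 k H 0 c t := by
  induction c with
  | zero => simp
  | add x y hx hy => simp only [map_add, LinearMap.add_apply, hx, hy]
  | tmul r s =>
  induction t with
  | zero => simp
  | add x y hx hy => simp only [map_add, hx, hy]
  | tmul g y => simp [prep_tmul, lmul2_tmul]

lemma lTensor_barD_succ_prep {n : ℕ} (c : H ⊗[k] H) (t : H ⊗[k] (⨂[k]^(n + 2) H)) :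
    (barD k H (n + 1)).lTensor H (prep k H (n + 2) c t) =
      lmul2 k H (n + 1) c t - prep k H (n + 1) c ((barD k H n).lTensor H t) := by
  induction c with
  | zero => simp
  | add x y hx hy => simp only [map_add, LinearMap.add_apply, hx, hy]; abel
  | tmul r s =>
  induction t with
  | zero => simp
  | add x y hx hy => simp only [map_add, hx, hy]; abel
  | tmul g y => simp [prep_tmul, lmul2_tmul, TensorProduct.tmul_sub]

lemma tpCoact_barD {n : ℕ} (x : ⨂[k]^(n + 2) H) :
    tpCoact k H (n + 1) (barD k H n x) =
      (barD k H n).lTensor H (tpCoact k H (n + 2) x) := by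
  induction n with
  | zero =>
    induction x using tcons_induction with
    | h0 => simp
    | ha x y hx hy => simp only [map_add, hx, hy]
    | hc m y =>
      rw [barD_zero_tcons, tpCoact_tcons, tpCoact_lmulHom, lTensor_barD_zero_prep]
  | succ n ih =>
    induction x using tcons_induction with
    | h0 => simp
    | ha x y hx hy => simp only [map_add, hx, hy]
    | hc m y =>
      rw [barD_succ_tcons, tpCoact_tcons, map_sub, tpCoact_tcons, tpCoact_lmulHom,
        lTensor_barD_succ_prep, ih]

lemma comul_oneE (x : ⨂[k]^1 H) : Coalgebra.comul (oneE k H x) =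
    (oneE k H).toLinearMap.lTensor H (tpCoact k H 1 x) := by
  induction x using tcons_induction with
  | h0 => simp
  | ha x y hx hy => simp only [map_add, hx, hy]
  | hc m c =>
    rw [oneE_tcons, tpCoact_tcons, tpCoact_zero, map_smul]
    generalize Coalgebra.comul (R := k) m = t
    induction t with
    | zero => simp
    | add x y hx hy => simp only [map_add, LinearMap.add_apply, smul_add, hx, hy]
    | tmul p q => simp [prep_tmul, oneE_tcons]

lemma comul_barAug (x : ⨂[k]^2 H) : Coalgebra.comul (barAug k H x) =
    (barAug k H).lTensor H (tpCoact k H 2 x) := by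
  rw [barAug, LinearMap.comp_apply, LinearMap.lTensor_comp, LinearMap.comp_apply, ← tpCoact_barD]
  exact comul_oneE _

variable (k H) in
/-- For `c ∈ H ⊗ (H ⊗ H)`, the map `f ⊗ (g ⊗ y) ↦ c₁ f ⊗ (c₂ g ⊗ (c₃ ⊗ y))`. -/
def prep3 (n : ℕ) : H ⊗[k] (H ⊗[k] H) →ₗ[k] H ⊗[k] (H ⊗[k] (⨂[k]^n H)) →ₗ[k]
    H ⊗[k] (H ⊗[k] (⨂[k]^(n + 1) H)) :=
  TensorProduct.map₂ (LinearMap.mul k H) (prep k H n)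

lemma prep3_tmul {n : ℕ} (p f : H) (q : H ⊗[k] H) (y : H ⊗[k] ⨂[k]^n H) :
    prep3 k H n (p ⊗ₜ q) (f ⊗ₜ y) = (p * f) ⊗ₜ prep k H n q y := rfl

lemma assoc_comul_map₂ {T T' : Type*} [AddCommGroup T] [Module k T] [AddCommGroup T'] [Module k T']
    (φ : H →ₗ[k] T →ₗ[k] T') (c : H ⊗[k] H) (t : H ⊗[k] T) :
    TensorProduct.assoc k H H T' ((Coalgebra.comul (R := k) (A := H)).rTensor T'
      (TensorProduct.map₂ (LinearMap.mul k H) φ c t)) =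
      TensorProduct.map₂ (LinearMap.mul k H) (TensorProduct.map₂ (LinearMap.mul k H) φ)
        (TensorProduct.assoc k H H H ((Coalgebra.comul (R := k) (A := H)).rTensor H c))
        (TensorProduct.assoc k H H T ((Coalgebra.comul (R := k) (A := H)).rTensor T t)) := by
  induction c with
  | zero => simp
  | add x y hx hy => simp only [map_add, LinearMap.add_apply, hx, hy]
  | tmul r s =>
  induction t with
  | zero => simp
  | add x y hx hy => simp only [map_add, hx, hy]
  | tmul g y =>
    rw [TensorProduct.map₂_apply_tmul, TensorProduct.map_tmul, LinearMap.rTensor_tmul,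
      LinearMap.rTensor_tmul, LinearMap.rTensor_tmul, LinearMap.mul_apply', Bialgebra.comul_mul]
    generalize Coalgebra.comul (R := k) r = a
    generalize Coalgebra.comul (R := k) g = b
    induction a with
    | zero => simp
    | add x y hx hy =>
      simp only [map_add, LinearMap.add_apply, add_mul, TensorProduct.add_tmul, hx, hy]
    | tmul a₁ a₂ =>
    induction b with
    | zero => simp
    | add x y hx hy =>
      simp only [map_add, mul_add, TensorProduct.add_tmul, hx, hy]
    | tmul b₁ b₂ => simp

lemma assoc_comul_prep {n : ℕ} (c : H ⊗[k] H) (t : H ⊗[k] (⨂[k]^n H)) :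
    TensorProduct.assoc k H H _ ((Coalgebra.comul (R := k) (A := H)).rTensor _
      (prep k H n c t)) =
      prep3 k H n (TensorProduct.assoc k H H H ((Coalgebra.comul (R := k) (A := H)).rTensor H c))
        (TensorProduct.assoc k H H _ ((Coalgebra.comul (R := k) (A := H)).rTensor _ t)) :=
  assoc_comul_map₂ _ c t

lemma lTensor_coact_prep {n : ℕ} (c : H ⊗[k] H) (t : H ⊗[k] (⨂[k]^n H)) :
    (tpCoact k H (n + 1)).lTensor H (prep k H n c t) =
      prep3 k H n ((Coalgebra.comul (R := k) (A := H)).lTensor H c) ((tpCoact k H n).lTensor H t) := by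
  induction c with
  | zero => simp
  | add x y hx hy => simp only [map_add, LinearMap.add_apply, hx, hy]
  | tmul r s =>
  induction t with
  | zero => simp
  | add x y hx hy => simp only [map_add, hx, hy]
  | tmul g y => simp [prep_tmul, prep3_tmul, tpCoact_tcons]

lemma tpCoact_coassoc (n : ℕ) (x : ⨂[k]^n H) :
    TensorProduct.assoc k H H _ ((Coalgebra.comul (R := k) (A := H)).rTensor _ (tpCoact k H n x)) =
      (tpCoact k H n).lTensor H (tpCoact k H n x) := by
  induction n with
  | zero => simp [tpCoact_zero, Algebra.TensorProduct.one_def]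
  | succ n ih =>
    refine LinearMap.congr_fun (f := (TensorProduct.assoc k H H _).toLinearMap ∘ₗ
      (Coalgebra.comul (R := k) (A := H)).rTensor _ ∘ₗ tpCoact k H (n + 1))
      (g := (tpCoact k H (n + 1)).lTensor H ∘ₗ tpCoact k H (n + 1)) (tcons_ext fun m y => ?_) x
    simp only [LinearMap.comp_apply, LinearEquiv.coe_coe]
    rw [tpCoact_tcons, assoc_comul_prep, lTensor_coact_prep, ih, Coalgebra.coassoc_apply]

lemma lid_counit_prep {n : ℕ} (c : H ⊗[k] H) (t : H ⊗[k] (⨂[k]^n H)) :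
    TensorProduct.lid k _ ((Coalgebra.counit (R := k) (A := H)).rTensor _ (prep k H n c t)) =
      tcons (TensorProduct.lid k H ((Coalgebra.counit (R := k) (A := H)).rTensor H c))
        (TensorProduct.lid k _ ((Coalgebra.counit (R := k) (A := H)).rTensor _ t)) := by
  induction c with
  | zero => simp [zero_tcons]
  | add x y hx hy => simp only [map_add, LinearMap.add_apply, add_tcons, hx, hy]
  | tmul r s =>
  induction t with
  | zero => simp [tcons_zero]
  | add x y hx hy => simp only [map_add, tcons_add, hx, hy]
  | tmul g y =>
    simp only [prep_tmul, LinearMap.rTensor_tmul, TensorProduct.lid_tmul, tcons_smul,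
      Bialgebra.counit_mul]
    rw [mul_comm, mul_smul]
    simp [tcons, ← TensorProduct.smul_tmul']

lemma tpCoact_counit (n : ℕ) (x : ⨂[k]^n H) :
    TensorProduct.lid k _ ((Coalgebra.counit (R := k) (A := H)).rTensor _ (tpCoact k H n x)) = x := by
  induction n with
  | zero => simp [tpCoact_zero]
  | succ n ih =>
    induction x using tcons_induction with
    | h0 => simp
    | ha x y hx hy => simp only [map_add, hx, hy]
    | hc m y =>
      rw [tpCoact_tcons, lid_counit_prep, ih, Coalgebra.rTensor_counit_comul]
      simp

variable (k H) in
/-- The bar resolution of `H` consists of Hopf bimodules, with the coaction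
`h⁰ ⊗ ⋯ ⊗ hⁿ⁺¹ ↦ ∑ h⁰₁ ⋯ hⁿ⁺¹₁ ⊗ (h⁰₂ ⊗ ⋯ ⊗ hⁿ⁺¹₂)`. -/
instance (n : ℕ) : HopfBimodule k H (BarTerm k H n) where
  coact := tpCoact k H (n + 2)
  coassoc := tpCoact_coassoc (n + 2)
  counit_coact := tpCoact_counit (n + 2)
  coact_smul h x := by
    refine (tpCoact_lmulHom h x).trans ?_
    have := sum_repr ((lmul2 k H (n + 1)).flip (tpCoact k H (n + 2) x)) h
    exact this.symm
  coact_op_smul h x := by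
    refine (tpCoact_rmulHom h x).trans ?_
    have := sum_repr ((rmul2 k H (n + 1)).flip (tpCoact k H (n + 2) x)) h
    exact this.symm

end Coaction

/-! ### The diagonal action on tensor powers -/

section Action

variable (k H M : Type*) [CommRing k] [Ring H] [HopfAlgebra k H] [AddCommGroup M] [Module k M]
  [Module H M] [IsScalarTower k H M]

/-- The diagonal action of `H` on `M^{⊗n}`:
`h (m₁ ⊗ ⋯ ⊗ mₙ) = ∑ h₁ m₁ ⊗ ⋯ ⊗ hₙ mₙ`, and `h c = ε(h) c` for `n = 0`. -/
def tpAct : (n : ℕ) → (H →ₐ[k] Module.End k (⨂[k]^n M))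
  | 0 => (Algebra.ofId k _).comp (Bialgebra.counitAlgHom k H)
  | n + 1 => ((consE k M n).conjAlgEquiv k).toAlgHom.comp (diag (Algebra.lsmul k k M) (tpAct n))

variable {k H M}

lemma tpAct_zero (h : H) (c : ⨂[k]^0 M) :
    tpAct k H M 0 h c = (Coalgebra.counit (R := k) h) • c := rfl

lemma tpAct_consE {n : ℕ} (h : H) (t : M ⊗[k] ⨂[k]^n M) :
    tpAct k H M (n + 1) h (consE k M n t) =
      consE k M n (diag (Algebra.lsmul k k M) (tpAct k H M n) h t) := by
  simp [tpAct, LinearEquiv.conjAlgEquiv]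

lemma tpAct_tcons {n : ℕ} (h : H) (m : M) (x : ⨂[k]^n M) :
    tpAct k H M (n + 1) h (tcons m x) = ∑ i ∈ (ℛ k h).index,
      tcons ((ℛ k h).left i • m) (tpAct k H M n ((ℛ k h).right i) x) := by
  rw [tcons, tpAct_consE, diag_apply, map_sum]
  rfl

lemma tpAct_one_tcons (h : H) (m : M) (c : ⨂[k]^0 M) :
    tpAct k H M 1 h (tcons m c) = tcons (h • m) c := by
  rw [tpAct_tcons]
  simp only [tpAct_zero, tcons_smul]
  have := sum_repr ((consE k M 0).toLinearMap ∘ₗ (TensorProduct.mk k M (⨂[k]^0 M)).flip c ∘ₗ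
    orb k H m ∘ₗ (TensorProduct.rid k H).toLinearMap ∘ₗ Coalgebra.counit.lTensor H) h
  simp only [LinearMap.comp_apply, Coalgebra.lTensor_counit_comul] at this
  simpa [consE_tmul] using this

end Action

section BarAction

variable {k H B : Type*} [CommRing k] [Ring H] [HopfAlgebra k H] [Ring B] [Algebra k B]
  [Module H B] [IsScalarTower k H B] [IsModuleAlgebra k H B]

lemma tpAct_lmulHom {n : ℕ} (h : H) (b : B) (x : ⨂[k]^(n + 1) B) :
    tpAct k H B (n + 1) h (lmulHom k B n b x) = ∑ i ∈ (ℛ k h).index,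
      lmulHom k B n ((ℛ k h).left i • b) (tpAct k H B (n + 1) ((ℛ k h).right i) x) := by
  obtain ⟨t, rfl⟩ := (consE k B n).surjective x
  have key : ∀ (b : B) (t : B ⊗[k] ⨂[k]^n B), lmulHom k B n b (consE k B n t) =
      consE k B n (lam k _ b t) := by
    intro b t
    simp [lmulHom, LinearEquiv.conjAlgEquiv]
  simp only [key, tpAct_consE, diag_lam, map_sum]

lemma tpAct_rmulHom {n : ℕ} (h : H) (b : B) (x : ⨂[k]^(n + 1) B) :
    tpAct k H B (n + 1) h (rmulHom k B n (op b) x) = ∑ i ∈ (ℛ k h).index,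
      rmulHom k B n (op ((ℛ k h).right i • b)) (tpAct k H B (n + 1) ((ℛ k h).left i) x) := by
  induction n generalizing h with
  | zero =>
    induction x using tcons_induction with
    | h0 => simp
    | ha x y hx hy => simp only [map_add, hx, hy, Finset.sum_add_distrib]
    | hc m y =>
      rw [rmulHom_zero_tcons]
      refine (tpAct_one_tcons h (m * b) y).trans ?_
      rw [IsModuleAlgebra.smul_mul' (k := k), sum_tcons]
      refine Finset.sum_congr rfl fun i _ => ?_
      refine Eq.trans ?_ (congrArg _ (tpAct_one_tcons _ m y).symm)
      rw [rmulHom_zero_tcons]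
  | succ n ih =>
    induction x using tcons_induction with
    | h0 => simp
    | ha x y hx hy => simp only [map_add, hx, hy, Finset.sum_add_distrib]
    | hc m y =>
      rw [rmulHom_succ_tcons, tpAct_tcons]
      simp only [ih, tpAct_tcons, tcons_sum, map_sum, rmulHom_succ_tcons]
      have := sum_coassoc ((consE k B (n + 1)).toLinearMap ∘ₗ
        TensorProduct.map (orb k H m) (TensorProduct.lift
          ((((rmulHom k B n).toLinearMap ∘ₗ (MulOpposite.opLinearEquiv k).toLinearMap).compl₁₂
            (orb k H b) ((tpAct k H B (n + 1)).toLinearMap.flip y)).flip))) h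
      simpa [consE_tmul] using this.symm

lemma tpAct_barD {n : ℕ} (h : H) (x : ⨂[k]^(n + 2) B) :
    tpAct k H B (n + 1) h (barD k B n x) = barD k B n (tpAct k H B (n + 2) h x) := by
  induction n generalizing h with
  | zero =>
    induction x using tcons_induction with
    | h0 => simp
    | ha x y hx hy => simp only [map_add, hx, hy]
    | hc m y => rw [barD_zero_tcons, tpAct_tcons, tpAct_lmulHom]; simp
  | succ n ih =>
    induction x using tcons_induction with
    | h0 => simp
    | ha x y hx hy => simp only [map_add, hx, hy]
    | hc m y =>
      rw [barD_succ_tcons, tpAct_tcons, map_sub, tpAct_lmulHom, tpAct_tcons]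
      simp [ih]

lemma oneE_tpAct (h : H) (x : ⨂[k]^1 B) :
    oneE k B (tpAct k H B 1 h x) = h • oneE k B x := by
  induction x using tcons_induction with
  | h0 => simp
  | ha x y hx hy => simp only [map_add, hx, hy, smul_add]
  | hc m c =>
    rw [tpAct_one_tcons, oneE_tcons, oneE_tcons]
    exact (map_smul (Algebra.lsmul k k B h) _ m).symm

lemma barAug_tpAct (h : H) (x : ⨂[k]^2 B) :
    barAug k B (tpAct k H B 2 h x) = h • barAug k B x := by
  simp only [barAug, LinearMap.comp_apply, ← tpAct_barD]
  exact oneE_tpAct _ _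

end BarAction

/-! ### Quadratic algebras -/

section Quadratic

universe u v

variable (k : Type u) {V : Type v} [Field k] [AddCommGroup V] [Module k V]
  (I : Submodule k (V ⊗[k] V))

/-- The map `V ⊗ V → T(V)`. -/
def quadMap (V : Type v) [AddCommGroup V] [Module k V] : V ⊗[k] V →ₗ[k] TensorAlgebra k V :=
  LinearMap.mul' k (TensorAlgebra k V) ∘ₗ
    TensorProduct.map (TensorAlgebra.ι k) (TensorAlgebra.ι k)

/-- The relations `r = 0` for `r ∈ I`. -/
def QuadRel (x y : TensorAlgebra k V) : Prop := ∃ r ∈ I, x = quadMap k V r ∧ y = 0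

/-- The quadratic algebra `T(V)/(I)` for `I ⊆ V ⊗ V`. -/
def QuadAlg : Type max u v := RingQuot (QuadRel k I)

instance : Ring (QuadAlg k I) := inferInstanceAs (Ring (RingQuot (QuadRel k I)))
instance : Algebra k (QuadAlg k I) := inferInstanceAs (Algebra k (RingQuot (QuadRel k I)))

instance : AddCommMonoid (QuadAlg k I) := inferInstance
instance : AddMonoid (QuadAlg k I) := inferInstance
instance : AddZeroClass (QuadAlg k I) := inferInstance
instance : Zero (QuadAlg k I) := inferInstance
instance : Semiring (QuadAlg k I) := inferInstance
instance : NonUnitalNonAssocSemiring (QuadAlg k I) := inferInstance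

namespace QuadAlg

/-- The map `V → T(V)/(I)`. -/
def gen : V →ₗ[k] QuadAlg k I :=
  (RingQuot.mkAlgHom k (QuadRel k I)).toLinearMap ∘ₗ TensorAlgebra.ι k

/-- The augmentation `T(V)/(I) → k`, which is zero on `V`. -/
def aug : QuadAlg k I →ₐ[k] k :=
  RingQuot.liftAlgHom k ⟨TensorAlgebra.lift k (0 : V →ₗ[k] k), fun x y h => by
    obtain ⟨r, -, rfl, rfl⟩ := h
    rw [map_zero (TensorAlgebra.lift k (0 : V →ₗ[k] k))]
    induction r with
    | zero => simp
    | add x y hx hy => simp only [map_add, hx, hy, add_zero]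
    | tmul v w => simp [quadMap]⟩

/-- The product `V ⊗ V → T(V)/(I)` of two generators. -/
def gen2 : V ⊗[k] V →ₗ[k] QuadAlg k I :=
  LinearMap.mul' k (QuadAlg k I) ∘ₗ TensorProduct.map (gen k I) (gen k I)

lemma gen2_eq_zero (r : V ⊗[k] V) (hr : r ∈ I) : gen2 k I r = 0 := by
  have h1 : gen2 k I = (RingQuot.mkAlgHom k (QuadRel k I)).toLinearMap ∘ₗ quadMap k V :=
    TensorProduct.ext' fun v w =>
      (map_mul (RingQuot.mkAlgHom k (QuadRel k I)) (TensorAlgebra.ι k v)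
        (TensorAlgebra.ι k w)).symm
  have h2 : RingQuot.mkAlgHom k (QuadRel k I) (quadMap k V r) =
      RingQuot.mkAlgHom k (QuadRel k I) 0 :=
    RingQuot.mkAlgHom_rel k ⟨r, hr, rfl, rfl⟩
  rw [h1]
  exact h2.trans (map_zero _)

end QuadAlg

open QuadAlg

/-- `B = T(V)/(I)` is Koszul: the trivial `B`-module `k` has a linear graded free resolution
`⋯ → P₂ → P₁ → P₀ → k → 0`, that is, one in which `Pᵢ` is a free `B`-module on generators of
degree `i`. In terms of bases this says that the matrix entries of the differentials lie in
the degree one part `V` of `B`; such a resolution is automatically minimal. -/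
def IsKoszul : Prop :=
  ∃ (ι : ℕ → Type max u v)
    (d : (i : ℕ) → (ι (i + 1) →₀ QuadAlg k I) →ₗ[QuadAlg k I] (ι i →₀ QuadAlg k I))
    (ε : (ι 0 →₀ QuadAlg k I) →ₗ[k] k),
    (∀ (b : QuadAlg k I) (p : ι 0 →₀ QuadAlg k I), ε (b • p) = aug k I b * ε p) ∧
    Function.Surjective ε ∧
    Function.Exact (d 0) ε ∧
    (∀ i, Function.Exact (d (i + 1)) (d i)) ∧
    (∀ i (e : ι (i + 1)) (e' : ι i), d i (Finsupp.single e 1) e' ∈ LinearMap.range (gen k I))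

/-- The action of `H` on `B = T(V)/(I)` is graded and comes from an action of `H` on `V`, whose
diagonal extension to `V ⊗ V` preserves the space `I` of relations. -/
class IsGradedAction (k : Type u) (H : Type*) {V : Type v} [Field k] [AddCommGroup V] [Module k V]
    (I : Submodule k (V ⊗[k] V)) [Ring H] [HopfAlgebra k H] [Module H V] [IsScalarTower k H V]
    [Module H (QuadAlg k I)] : Prop where
  smul_gen : ∀ (h : H) (v : V), h • gen k I v = gen k I (h • v)
  diag_mem : ∀ (h : H), ∀ r ∈ I, diag (Algebra.lsmul k k V) (Algebra.lsmul k k V) h r ∈ I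

variable {k} in
/-- The subspace `V^{⊗j} ⊗ I ⊗ V^{⊗(n-2-j)}` of `V^{⊗n}` for `j + 2 ≤ n`
(and `V^{⊗n}` for other values of `j`). -/
def relSub : (n j : ℕ) → Submodule k (⨂[k]^n V)
  | n + 2, 0 => LinearMap.range ((consE k V (n + 1)).toLinearMap ∘ₗ
      (consE k V n).toLinearMap.lTensor V ∘ₗ
      (TensorProduct.assoc k V V (⨂[k]^n V)).toLinearMap ∘ₗ I.subtype.rTensor (⨂[k]^n V))
  | n + 1, j + 1 => LinearMap.range ((consE k V n).toLinearMap ∘ₗ (relSub n j).subtype.lTensor V)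
  | 1, 0 => ⊤
  | 0, _ => ⊤

variable {k} in
/-- The space `D'ₙ = ⋂ⱼ V^{⊗j} ⊗ I ⊗ V^{⊗(n-2-j)}`, where `0 ≤ j ≤ n - 2`; it is `V^{⊗n}` for
`n ≤ 1`. -/
def koszulSpace (n : ℕ) : Submodule k (⨂[k]^n V) := ⨅ (j : ℕ) (_ : j + 2 ≤ n), relSub I n j

variable {k I}

lemma mem_koszulSpace {n : ℕ} {x : ⨂[k]^n V} :
    x ∈ koszulSpace I n ↔ ∀ j, j + 2 ≤ n → x ∈ relSub I n j := by
  simp [koszulSpace, Submodule.mem_iInf]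

@[elab_as_elim]
lemma relSub_zero_induction {n : ℕ} {p : (⨂[k]^(n + 2) V) → Prop} {x : ⨂[k]^(n + 2) V}
    (hx : x ∈ relSub I (n + 2) 0) (h0 : p 0) (ha : ∀ x y, p x → p y → p (x + y))
    (hm : ∀ r ∈ I, ∀ z : ⨂[k]^n V, p (consE k V (n + 1) ((consE k V n).toLinearMap.lTensor V
      (TensorProduct.assoc k V V (⨂[k]^n V) (r ⊗ₜ z))))) : p x := by
  rw [relSub] at hx
  obtain ⟨t, rfl⟩ := hx
  induction t with
  | zero => simpa using h0
  | add x y hx hy => simpa using ha _ _ hx hy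
  | tmul r z => exact hm r r.2 z

lemma mem_relSub_zero {n : ℕ} {r : V ⊗[k] V} (hr : r ∈ I) (z : ⨂[k]^n V) :
    consE k V (n + 1) ((consE k V n).toLinearMap.lTensor V
      (TensorProduct.assoc k V V (⨂[k]^n V) (r ⊗ₜ z))) ∈ relSub I (n + 2) 0 := by
  rw [relSub]
  exact ⟨(⟨r, hr⟩ : I) ⊗ₜ z, rfl⟩

@[elab_as_elim]
lemma relSub_succ_induction {n j : ℕ} {p : (⨂[k]^(n + 1) V) → Prop} {x : ⨂[k]^(n + 1) V}
    (hx : x ∈ relSub I (n + 1) (j + 1)) (h0 : p 0) (ha : ∀ x y, p x → p y → p (x + y))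
    (hm : ∀ v, ∀ y ∈ relSub I n j, p (tcons v y)) : p x := by
  rw [relSub] at hx
  obtain ⟨t, rfl⟩ := hx
  induction t with
  | zero => simpa using h0
  | add x y hx hy => simpa using ha _ _ hx hy
  | tmul v y => exact hm v y y.2

lemma mem_relSub_succ {n j : ℕ} {y : ⨂[k]^n V} (hy : y ∈ relSub I n j) (v : V) :
    tcons v y ∈ relSub I (n + 1) (j + 1) := by
  rw [relSub]
  exact ⟨v ⊗ₜ ⟨y, hy⟩, rfl⟩

/-- Contraction of the first factor with a linear form. -/
def contractL (φ : V →ₗ[k] k) (n : ℕ) : (⨂[k]^(n + 1) V) →ₗ[k] (⨂[k]^n V) :=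
  (TensorProduct.lid k _).toLinearMap ∘ₗ φ.rTensor _ ∘ₗ (consE k V n).symm.toLinearMap

/-- Contraction of the last factor with a linear form. -/
def contractR (φ : V →ₗ[k] k) : (n : ℕ) → (⨂[k]^(n + 1) V) →ₗ[k] (⨂[k]^n V)
  | 0 => contractL φ 0
  | n + 1 => (consE k V n).toLinearMap ∘ₗ (contractR φ n).lTensor V ∘ₗ
      (consE k V (n + 1)).symm.toLinearMap

lemma contractL_tcons (φ : V →ₗ[k] k) {n : ℕ} (v : V) (x : ⨂[k]^n V) :
    contractL φ n (tcons v x) = φ v • x := by simp [contractL]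

lemma contractR_zero_tcons (φ : V →ₗ[k] k) (v : V) (x : ⨂[k]^0 V) :
    contractR φ 0 (tcons v x) = φ v • x := contractL_tcons φ v x

lemma contractR_succ_tcons (φ : V →ₗ[k] k) {n : ℕ} (v : V) (x : ⨂[k]^(n + 1) V) :
    contractR φ (n + 1) (tcons v x) = tcons v (contractR φ n x) := by
  simp [contractR, consE_tmul]

lemma contractL_mem_relSub (φ : V →ₗ[k] k) {n j : ℕ} {x : ⨂[k]^(n + 1) V}
    (hx : x ∈ relSub I (n + 1) (j + 1)) : contractL φ n x ∈ relSub I n j := by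
  refine relSub_succ_induction hx (by simp) (fun x y hx hy => ?_) (fun v y hy => ?_)
  · rw [map_add]; exact add_mem hx hy
  · rw [contractL_tcons]; exact Submodule.smul_mem _ _ hy

lemma contractR_mem_relSub (φ : V →ₗ[k] k) {n j : ℕ} (hj : j + 2 ≤ n) {x : ⨂[k]^(n + 1) V}
    (hx : x ∈ relSub I (n + 1) j) : contractR φ n x ∈ relSub I n j := by
  induction j generalizing n with
  | zero =>
    obtain ⟨n, rfl⟩ : ∃ m, n = m + 2 := ⟨n - 2, by omega⟩
    refine relSub_zero_induction hx (by simp) (fun x y hx hy => ?_) (fun r hr z => ?_)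
    · rw [map_add]; exact add_mem hx hy
    · have key : contractR φ (n + 2) (consE k V (n + 2) ((consE k V (n + 1)).toLinearMap.lTensor V
          (TensorProduct.assoc k V V _ (r ⊗ₜ z)))) =
          consE k V (n + 1) ((consE k V n).toLinearMap.lTensor V
          (TensorProduct.assoc k V V _ (r ⊗ₜ contractR φ n z))) := by
        clear hr
        induction r with
        | zero => simp
        | add x y hx hy => simp only [map_add, TensorProduct.add_tmul, hx, hy]
        | tmul v w =>
          simp [consE_tmul, contractR_succ_tcons]
      rw [key]
      exact mem_relSub_zero hr _
  | succ j ih =>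
    obtain ⟨n, rfl⟩ : ∃ m, n = m + 1 := ⟨n - 1, by omega⟩
    refine relSub_succ_induction hx (by simp) (fun x y hx hy => ?_) (fun v y hy => ?_)
    · rw [map_add]; exact add_mem hx hy
    · rw [contractR_succ_tcons]
      exact mem_relSub_succ (ih (by omega) hy) v

lemma contractL_mem (φ : V →ₗ[k] k) {n : ℕ} {x : ⨂[k]^(n + 1) V}
    (hx : x ∈ koszulSpace I (n + 1)) : contractL φ n x ∈ koszulSpace I n :=
  mem_koszulSpace.2 fun j hj =>
    contractL_mem_relSub φ (mem_koszulSpace.1 hx (j + 1) (by omega))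

lemma contractR_mem (φ : V →ₗ[k] k) {n : ℕ} {x : ⨂[k]^(n + 1) V}
    (hx : x ∈ koszulSpace I (n + 1)) : contractR φ n x ∈ koszulSpace I n :=
  mem_koszulSpace.2 fun j hj =>
    contractR_mem_relSub φ hj (mem_koszulSpace.1 hx j (by omega))

variable (k V) in
/-- A basis of `V`. -/
abbrev bas [FiniteDimensional k V] : Module.Basis (Fin (Module.finrank k V)) k V :=
  Module.finBasis k V

lemma sum_tcons_contractL [FiniteDimensional k V] {n : ℕ} (x : ⨂[k]^(n + 1) V) :
    ∑ i, tcons (bas k V i) (contractL ((bas k V).coord i) n x) = x := by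
  induction x using tcons_induction with
  | h0 => simp [tcons_zero]
  | ha x y hx hy => simp only [map_add, tcons_add, Finset.sum_add_distrib, hx, hy]
  | hc v y =>
    conv_rhs => rw [← (bas k V).sum_repr v, sum_tcons]
    refine Finset.sum_congr rfl fun i _ => ?_
    rw [contractL_tcons, tcons_smul, Module.Basis.coord_apply]
    simp [tcons, ← TensorProduct.smul_tmul']

variable (k I) in
/-- The embedding `V^{⊗n} ⊗ B → B^{⊗(n+1)}`. -/
def emb : (n : ℕ) → (⨂[k]^n V) →ₗ[k] QuadAlg k I →ₗ[k] ⨂[k]^(n + 1) (QuadAlg k I)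
  | 0 => (TensorProduct.curry (consE k (QuadAlg k I) 0).toLinearMap).flip ∘ₗ
      PiTensorProduct.map (fun _ => gen k I)
  | n + 1 => TensorProduct.lift ((LinearMap.llcomp k (QuadAlg k I) _ _ ∘ₗ
      TensorProduct.curry (consE k (QuadAlg k I) (n + 1)).toLinearMap).compl₁₂ (gen k I)
      (emb n)) ∘ₗ (consE k V n).symm.toLinearMap

variable (k I) in
/-- The identification of the scalars `V^{⊗0}` with `B^{⊗0}`. -/
def emb0 : (⨂[k]^0 V) →ₗ[k] ⨂[k]^0 (QuadAlg k I) := PiTensorProduct.map (fun _ => gen k I)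

lemma emb_zero (c : ⨂[k]^0 V) (b : QuadAlg k I) : emb k I 0 c b = tcons b (emb0 k I c) := rfl

lemma emb_tcons {n : ℕ} (v : V) (x : ⨂[k]^n V) (b : QuadAlg k I) :
    emb k I (n + 1) (tcons v x) b = tcons (gen k I v) (emb k I n x b) := by
  simp [emb, consE_tmul]

lemma emb_mul {n : ℕ} (x : ⨂[k]^n V) (b c : QuadAlg k I) :
    rmulHom k (QuadAlg k I) n (op c) (emb k I n x b) = emb k I n x (b * c) := by
  induction n with
  | zero => simp [emb_zero]
  | succ n ih =>
    induction x using tcons_induction with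
    | h0 => simp
    | ha x y hx hy => simp only [map_add, LinearMap.add_apply, hx, hy]
    | hc v y => simp only [emb_tcons, rmulHom_succ_tcons, ih]

variable (k I) in
/-- The `n`-th term `Dₙ = B ⊗ D'ₙ ⊗ B` of the Koszul resolution of `B`, as a subspace of the term
`B^{⊗(n+2)}` of the bar resolution: the span of the elements `a ⊗ x ⊗ b` with `x ∈ D'ₙ`. -/
def koszulSub (n : ℕ) : Submodule k (⨂[k]^(n + 2) (QuadAlg k I)) :=
  Submodule.span k {t | ∃ (a b : QuadAlg k I), ∃ x ∈ koszulSpace I n, t = tcons a (emb k I n x b)}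

lemma tcons_emb_mem {n : ℕ} (a b : QuadAlg k I) {x : ⨂[k]^n V} (hx : x ∈ koszulSpace I n) :
    tcons a (emb k I n x b) ∈ koszulSub k I n := Submodule.subset_span ⟨a, b, x, hx, rfl⟩

lemma map_mem_of_koszulSub {Z : Type*} [AddCommGroup Z] [Module k Z] {n : ℕ}
    (f : (⨂[k]^(n + 2) (QuadAlg k I)) →ₗ[k] Z) (S : Submodule k Z)
    (hf : ∀ (a b : QuadAlg k I), ∀ x ∈ koszulSpace I n, f (tcons a (emb k I n x b)) ∈ S)
    {t : ⨂[k]^(n + 2) (QuadAlg k I)} (ht : t ∈ koszulSub k I n) : f t ∈ S := by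
  have : koszulSub k I n ≤ S.comap f := by
    rw [koszulSub, Submodule.span_le]
    rintro _ ⟨a, b, x, hx, rfl⟩
    exact hf a b x hx
  exact this ht

lemma lmulHom_mem {n : ℕ} (c : QuadAlg k I) {t : ⨂[k]^(n + 2) (QuadAlg k I)}
    (ht : t ∈ koszulSub k I n) : lmulHom k _ (n + 1) c t ∈ koszulSub k I n :=
  map_mem_of_koszulSub _ _ (fun a b x hx => by
    rw [lmulHom_tcons]; exact tcons_emb_mem _ _ hx) ht

lemma rmulHom_mem {n : ℕ} (c : (QuadAlg k I)ᵐᵒᵖ) {t : ⨂[k]^(n + 2) (QuadAlg k I)}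
    (ht : t ∈ koszulSub k I n) : rmulHom k _ (n + 1) c t ∈ koszulSub k I n :=
  map_mem_of_koszulSub _ _ (fun a b x hx => by
    obtain ⟨c, rfl⟩ := MulOpposite.op_surjective c
    rw [rmulHom_succ_tcons, emb_mul]; exact tcons_emb_mem _ _ hx) ht

variable (k I) in
/-- The map `v₁ ⊗ ⋯ ⊗ vₙ₊₁ ↦ v₁ ⊗ ⋯ ⊗ vₙ ⊗ vₙ₊₁ b`. -/
def lastMul [FiniteDimensional k V] (b : QuadAlg k I) (n : ℕ) (x : ⨂[k]^(n + 1) V) :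
    ⨂[k]^(n + 1) (QuadAlg k I) :=
  ∑ i, emb k I n (contractR ((bas k V).coord i) n x) (gen k I (bas k V i) * b)

variable [FiniteDimensional k V]

lemma lastMul_add (b : QuadAlg k I) {n : ℕ} (x y : ⨂[k]^(n + 1) V) :
    lastMul k I b n (x + y) = lastMul k I b n x + lastMul k I b n y := by
  simp [lastMul, Finset.sum_add_distrib]

lemma lastMul_succ_tcons (b : QuadAlg k I) {n : ℕ} (v : V) (x : ⨂[k]^(n + 1) V) :
    lastMul k I b (n + 1) (tcons v x) = tcons (gen k I v) (lastMul k I b n x) := by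
  simp [lastMul, contractR_succ_tcons, emb_tcons, tcons_sum]

lemma lastMul_zero_tcons (b : QuadAlg k I) (v : V) (c : ⨂[k]^0 V) :
    lastMul k I b 0 (tcons v c) = tcons (gen k I v * b) (emb0 k I c) := by
  conv_rhs => rw [← (bas k V).sum_repr v, map_sum, Finset.sum_mul, sum_tcons]
  refine Finset.sum_congr rfl fun i _ => ?_
  rw [contractR_zero_tcons, Module.Basis.coord_apply, map_smul, LinearMap.smul_apply, emb_zero,
    map_smul, smul_mul_assoc]
  simp [tcons, ← TensorProduct.smul_tmul']

lemma firstMul_eq_zero (b : QuadAlg k I) {n : ℕ} {x : ⨂[k]^(n + 2) V}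
    (hx : x ∈ relSub I (n + 2) 0) :
    ∑ i, lmulHom k (QuadAlg k I) (n + 1) (gen k I (bas k V i))
      (emb k I (n + 1) (contractL ((bas k V).coord i) (n + 1) x) b) = 0 := by
  have h1 : ∀ (v : V) (y : ⨂[k]^(n + 1) V), ∑ i, lmulHom k (QuadAlg k I) (n + 1)
      (gen k I (bas k V i)) (emb k I (n + 1) (contractL ((bas k V).coord i) (n + 1)
        (tcons v y)) b) = lmulHom k (QuadAlg k I) (n + 1) (gen k I v) (emb k I (n + 1) y b) := by
    intro v y
    conv_rhs => rw [← (bas k V).sum_repr v, map_sum, map_sum, LinearMap.sum_apply]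
    refine Finset.sum_congr rfl fun i _ => ?_
    simp [contractL_tcons]
  refine relSub_zero_induction hx (by simp) (fun x y hx hy => ?_) (fun r hr z => ?_)
  · simp only [map_add, LinearMap.add_apply, Finset.sum_add_distrib, hx, hy, add_zero]
  · have h2 : ∀ r : V ⊗[k] V, ∑ i, lmulHom k (QuadAlg k I) (n + 1)
      (gen k I (bas k V i)) (emb k I (n + 1) (contractL ((bas k V).coord i) (n + 1)
        (consE k V (n + 1) ((consE k V n).toLinearMap.lTensor V
          (TensorProduct.assoc k V V _ (r ⊗ₜ z))))) b) =
        tcons (gen2 k I r) (emb k I n z b) := by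
      intro r
      induction r with
      | zero => simp [zero_tcons]
      | add x y hx hy =>
        simp only [map_add, TensorProduct.add_tmul, LinearMap.add_apply, Finset.sum_add_distrib,
          hx, hy, add_tcons]
      | tmul v w =>
        simp only [TensorProduct.assoc_tmul, LinearMap.lTensor_tmul, LinearEquiv.coe_coe,
          consE_tmul]
        rw [h1, emb_tcons, lmulHom_tcons]
        rfl
    rw [h2, gen2_eq_zero k I r hr, zero_tcons]

lemma barD_emb (b : QuadAlg k I) {n : ℕ} {x : ⨂[k]^(n + 1) V} (hx : x ∈ koszulSpace I (n + 1)) :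
    barD k (QuadAlg k I) n (emb k I (n + 1) x b) = (-1 : k) ^ n • lastMul k I b n x := by
  induction n with
  | zero =>
    rw [pow_zero, one_smul]
    clear hx
    induction x using tcons_induction with
    | h0 => simp [lastMul]
    | ha x y hx hy => simp only [map_add, LinearMap.add_apply, hx, hy, lastMul_add]
    | hc v c =>
      rw [emb_tcons, barD_zero_tcons, emb_zero, lmulHom_tcons, lastMul_zero_tcons]
  | succ n ih =>
    have h1 := firstMul_eq_zero b (mem_koszulSpace.1 hx 0 (by omega))
    have h2 : lastMul k I b (n + 1) x = ∑ i, tcons (gen k I (bas k V i))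
        (lastMul k I b n (contractL ((bas k V).coord i) (n + 1) x)) := by
      clear h1 hx
      conv_lhs => rw [← sum_tcons_contractL x]
      have : ∀ (s : Finset (Fin (Module.finrank k V))) (f : _ → ⨂[k]^(n + 2) V),
          lastMul k I b (n + 1) (∑ i ∈ s, f i) = ∑ i ∈ s, lastMul k I b (n + 1) (f i) := by
        intro s f
        exact map_sum (AddMonoidHom.mk' (lastMul k I b (n + 1)) (lastMul_add b)) f s
      rw [this]
      simp only [lastMul_succ_tcons]
    conv_lhs => rw [← sum_tcons_contractL x, map_sum, LinearMap.sum_apply, map_sum]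
    simp only [emb_tcons, barD_succ_tcons, Finset.sum_sub_distrib, h1, zero_sub]
    rw [h2, ← Finset.sum_neg_distrib, Finset.smul_sum]
    refine Finset.sum_congr rfl fun i _ => ?_
    rw [ih (contractL_mem _ hx), tcons_smul, pow_succ]
    simp

lemma barD_mem {n : ℕ} {t : ⨂[k]^(n + 3) (QuadAlg k I)} (ht : t ∈ koszulSub k I (n + 1)) :
    barD k (QuadAlg k I) (n + 1) t ∈ koszulSub k I n := by
  refine map_mem_of_koszulSub _ _ (fun a b x hx => ?_) ht
  rw [barD_succ_tcons, barD_emb b hx]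
  refine sub_mem ?_ ?_
  · conv in emb k I (n + 1) x b => rw [← sum_tcons_contractL x, map_sum, LinearMap.sum_apply]
    rw [map_sum]
    refine sum_mem fun i _ => ?_
    rw [emb_tcons, lmulHom_tcons]
    exact tcons_emb_mem _ _ (contractL_mem _ hx)
  · rw [tcons_smul, lastMul, tcons_sum]
    exact Submodule.smul_mem _ _ (sum_mem fun i _ => tcons_emb_mem _ _ (contractR_mem _ hx))

end Quadratic

/-! ### The action of `H` on the Koszul resolution -/

section KoszulAction

universe u v w

variable {k : Type u} {V : Type v} {H : Type w} [Field k] [AddCommGroup V] [Module k V]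
  [Ring H] [HopfAlgebra k H] {I : Submodule k (V ⊗[k] V)}
  [Module H V] [IsScalarTower k H V] [Module H (QuadAlg k I)] [IsScalarTower k H (QuadAlg k I)]
  [IsModuleAlgebra k H (QuadAlg k I)] [IsGradedAction k H I]

lemma tpAct_mem_relSub {n j : ℕ} (h : H) {x : ⨂[k]^n V} (hx : x ∈ relSub I n j) :
    tpAct k H V n h x ∈ relSub I n j := by
  induction j generalizing n h with
  | zero =>
    match n, x, hx with
    | 0, x, hx => exact Submodule.mem_top
    | 1, x, hx => exact Submodule.mem_top
    | n + 2, x, hx =>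
      refine relSub_zero_induction hx (by simp) (fun x y hx hy => ?_) (fun r hr z => ?_)
      · rw [map_add]; exact add_mem hx hy
      · have key : ∀ r : V ⊗[k] V, tpAct k H V (n + 2) h (consE k V (n + 1)
            ((consE k V n).toLinearMap.lTensor V
              (TensorProduct.assoc k V V (⨂[k]^n V) (r ⊗ₜ z)))) =
            ∑ i ∈ (ℛ k h).index, consE k V (n + 1) ((consE k V n).toLinearMap.lTensor V
              (TensorProduct.assoc k V V (⨂[k]^n V)
                (diag (Algebra.lsmul k k V) (Algebra.lsmul k k V) ((ℛ k h).left i) r ⊗ₜ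
                  tpAct k H V n ((ℛ k h).right i) z))) := by
          intro r
          induction r with
          | zero => simp
          | add x y hx hy =>
            simp only [map_add, TensorProduct.add_tmul, hx, hy, Finset.sum_add_distrib]
          | tmul v w =>
            simp only [TensorProduct.assoc_tmul, LinearMap.lTensor_tmul, LinearEquiv.coe_coe,
              consE_tmul, tpAct_tcons, diag_apply, TensorProduct.sum_tmul, map_sum, tcons_sum]
            have := sum_coassoc ((consE k V (n + 1)).toLinearMap ∘ₗ
              TensorProduct.map (orb k H v) ((consE k V n).toLinearMap ∘ₗ
                TensorProduct.map (orb k H w) ((tpAct k H V n).toLinearMap.flip z))) h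
            simpa [consE_tmul] using this.symm
        rw [key]
        exact sum_mem fun i _ => mem_relSub_zero (IsGradedAction.diag_mem _ r hr) _
  | succ j ih =>
    match n, x, hx with
    | 0, x, hx => exact Submodule.mem_top
    | n + 1, x, hx =>
      refine relSub_succ_induction hx (by simp) (fun x y hx hy => ?_) (fun v y hy => ?_)
      · rw [map_add]; exact add_mem hx hy
      · rw [tpAct_tcons]
        exact sum_mem fun i _ => mem_relSub_succ (ih _ hy) _

lemma tpAct_mem {n : ℕ} (h : H) {x : ⨂[k]^n V} (hx : x ∈ koszulSpace I n) :
    tpAct k H V n h x ∈ koszulSpace I n :=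
  mem_koszulSpace.2 fun j hj => tpAct_mem_relSub h (mem_koszulSpace.1 hx j hj)

lemma tpAct_emb {n : ℕ} (h : H) (x : ⨂[k]^n V) (b : QuadAlg k I) :
    tpAct k H (QuadAlg k I) (n + 1) h (emb k I n x b) = ∑ i ∈ (ℛ k h).index,
      emb k I n (tpAct k H V n ((ℛ k h).left i) x) ((ℛ k h).right i • b) := by
  induction n generalizing h with
  | zero =>
    rw [emb_zero]
    refine (tpAct_one_tcons h b _).trans ?_
    have := sum_repr ((emb k I 0 x) ∘ₗ orb k H b ∘ₗ
      (TensorProduct.lid k H).toLinearMap ∘ₗ (Coalgebra.counit (R := k) (A := H)).rTensor H) h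
    simp only [LinearMap.comp_apply, Coalgebra.rTensor_counit_comul] at this
    simp only [LinearMap.rTensor_tmul, LinearEquiv.coe_coe, TensorProduct.lid_tmul, map_smul,
      one_smul, orb_apply, emb_zero] at this
    rw [← this]
    simp only [tpAct_zero, map_smul, LinearMap.smul_apply, emb_zero]
  | succ n ih =>
    induction x using tcons_induction with
    | h0 => simp
    | ha x y hx hy => simp only [map_add, LinearMap.add_apply, hx, hy, Finset.sum_add_distrib]
    | hc v y =>
      simp only [emb_tcons, tpAct_tcons, ih, tcons_sum, map_sum, LinearMap.sum_apply,
        IsGradedAction.smul_gen]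
      have := sum_coassoc ((consE k (QuadAlg k I) (n + 1)).toLinearMap ∘ₗ
        TensorProduct.map (QuadAlg.gen k I ∘ₗ orb k H v) (TensorProduct.lift
          ((emb k I n).compl₁₂ ((tpAct k H V n).toLinearMap.flip y) (orb k H b)))) h
      simpa [consE_tmul] using this.symm

lemma tpAct_mem_koszulSub {n : ℕ} (h : H) {t : ⨂[k]^(n + 2) (QuadAlg k I)}
    (ht : t ∈ koszulSub k I n) : tpAct k H (QuadAlg k I) (n + 2) h t ∈ koszulSub k I n :=
  map_mem_of_koszulSub _ _ (fun a b x hx => by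
    rw [tpAct_tcons]
    simp only [tpAct_emb, tcons_sum]
    exact sum_mem fun i _ => sum_mem fun j _ => tcons_emb_mem _ _ (tpAct_mem _ hx)) ht

end KoszulAction

section Restrict

variable {k S M : Type*} [CommRing k] [Ring S] [Algebra k S] [AddCommGroup M] [Module k M]

/-- The restriction of an action of an algebra to an invariant subspace. -/
def restrictHom (α : S →ₐ[k] Module.End k M) (N : Submodule k M) (hN : ∀ s, ∀ x ∈ N, α s x ∈ N) :
    S →ₐ[k] Module.End k N :=
  AlgHom.ofLinearMap
    { toFun := fun s => (α s).restrict (hN s)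
      map_add' := fun s t => LinearMap.ext fun x => Subtype.ext (by simp)
      map_smul' := fun c s => LinearMap.ext fun x => Subtype.ext (by simp) }
    (LinearMap.ext fun x => Subtype.ext (by simp))
    (fun s t => LinearMap.ext fun x => Subtype.ext (by simp))

lemma coe_restrictHom (α : S →ₐ[k] Module.End k M) (N : Submodule k M) (hN) (s : S) (x : N) :
    (restrictHom α N hN s x : M) = α s x := rfl

end Restrict

section KoszulTerm

universe u v w

variable (k : Type u) {V : Type v} [Field k] [AddCommGroup V] [Module k V]
  (I : Submodule k (V ⊗[k] V))

/-- The `n`-th term `Dₙ` of the Koszul resolution of `B = T(V)/(I)`. -/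
def KoszulTerm (n : ℕ) : Type _ := ↥(koszulSub k I n)

namespace KoszulTerm

instance (n : ℕ) : AddCommGroup (KoszulTerm k I n) :=
  inferInstanceAs (AddCommGroup ↥(koszulSub k I n))
instance (n : ℕ) : Module k (KoszulTerm k I n) := inferInstanceAs (Module k ↥(koszulSub k I n))

instance (n : ℕ) : AddCommMonoid (KoszulTerm k I n) := inferInstance
instance (n : ℕ) : AddMonoid (KoszulTerm k I n) := inferInstance
instance (n : ℕ) : AddZeroClass (KoszulTerm k I n) := inferInstance
instance (n : ℕ) : Zero (KoszulTerm k I n) := inferInstance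

variable {k I}

/-- The inclusion of the Koszul resolution into the bar resolution. -/
def incl (n : ℕ) : KoszulTerm k I n →ₗ[k] ⨂[k]^(n + 2) (QuadAlg k I) := (koszulSub k I n).subtype

lemma incl_injective (n : ℕ) : Function.Injective (incl (k := k) (I := I) n) :=
  Subtype.val_injective

lemma incl_mem {n : ℕ} (y : KoszulTerm k I n) : incl n y ∈ koszulSub k I n := y.2

/-- Left multiplication in the leftmost factor. -/
def leftHom (n : ℕ) : QuadAlg k I →ₐ[k] Module.End k (KoszulTerm k I n) :=
  restrictHom (lmulHom k (QuadAlg k I) (n + 1)) (koszulSub k I n) fun b _ => lmulHom_mem b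

/-- Right multiplication in the rightmost factor. -/
def rightHom (n : ℕ) : (QuadAlg k I)ᵐᵒᵖ →ₐ[k] Module.End k (KoszulTerm k I n) :=
  restrictHom (rmulHom k (QuadAlg k I) (n + 1)) (koszulSub k I n) fun b _ => rmulHom_mem b

/-- The left action of `B` by multiplication in the leftmost factor. -/
instance (n : ℕ) : Module (QuadAlg k I) (KoszulTerm k I n) :=
  Module.compHom _ (leftHom n).toRingHom

/-- The right action of `B` by multiplication in the rightmost factor. -/
instance (n : ℕ) : Module (QuadAlg k I)ᵐᵒᵖ (KoszulTerm k I n) :=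
  Module.compHom _ (rightHom n).toRingHom

lemma incl_smul {n : ℕ} (b : QuadAlg k I) (y : KoszulTerm k I n) :
    incl n (b • y) = lmulHom k (QuadAlg k I) (n + 1) b (incl n y) :=
  coe_restrictHom (lmulHom k (QuadAlg k I) (n + 1)) (koszulSub k I n) (fun b _ => lmulHom_mem b) b y

lemma incl_op_smul {n : ℕ} (b : (QuadAlg k I)ᵐᵒᵖ) (y : KoszulTerm k I n) :
    incl n (b • y) = rmulHom k (QuadAlg k I) (n + 1) b (incl n y) :=
  coe_restrictHom (rmulHom k (QuadAlg k I) (n + 1)) (koszulSub k I n) (fun b _ => rmulHom_mem b) b y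

instance (n : ℕ) : IsScalarTower k (QuadAlg k I) (KoszulTerm k I n) where
  smul_assoc c b y := LinearMap.congr_fun (map_smul (leftHom n) c b) y

instance (n : ℕ) : SMulCommClass (QuadAlg k I) (QuadAlg k I)ᵐᵒᵖ (KoszulTerm k I n) where
  smul_comm a b y := by
    apply incl_injective n
    obtain ⟨b, rfl⟩ := MulOpposite.op_surjective b
    rw [incl_smul, incl_op_smul, incl_op_smul, incl_smul, lmulHom_rmulHom]

section Diff

variable [FiniteDimensional k V]

variable (k I) in
/-- The differential `Dₙ₊₁ → Dₙ`, the restriction of the differential of the bar resolution. -/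
def d (n : ℕ) : KoszulTerm k I (n + 1) →ₗ[k] KoszulTerm k I n :=
  LinearMap.restrict (barD k (QuadAlg k I) (n + 1)) fun _ h => barD_mem h

lemma incl_d {n : ℕ} (y : KoszulTerm k I (n + 1)) :
    incl n (d k I n y) = barD k (QuadAlg k I) (n + 1) (incl (n + 1) y) := rfl

lemma d_smul {n : ℕ} (b : QuadAlg k I) (y : KoszulTerm k I (n + 1)) :
    d k I n (b • y) = b • d k I n y :=
  incl_injective n (by rw [incl_d, incl_smul, incl_smul, incl_d, barD_lmulHom])

lemma d_op_smul {n : ℕ} (b : QuadAlg k I) (y : KoszulTerm k I (n + 1)) :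
    d k I n (op b • y) = op b • d k I n y :=
  incl_injective n (by rw [incl_d, incl_op_smul, incl_op_smul, incl_d, barD_rmulHom])

end Diff

variable (k I) in
/-- The augmentation `D₀ = B ⊗ B → B`. -/
def aug : KoszulTerm k I 0 →ₗ[k] QuadAlg k I := barAug k (QuadAlg k I) ∘ₗ incl 0

lemma aug_apply (y : KoszulTerm k I 0) : aug k I y = barAug k (QuadAlg k I) (incl 0 y) := rfl

lemma aug_smul (b : QuadAlg k I) (y : KoszulTerm k I 0) : aug k I (b • y) = b * aug k I y := by
  rw [aug_apply, aug_apply, incl_smul, barAug_lmulHom]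

lemma aug_op_smul (b : QuadAlg k I) (y : KoszulTerm k I 0) :
    aug k I (op b • y) = aug k I y * b := by
  rw [aug_apply, aug_apply, incl_op_smul, barAug_rmulHom]

variable {H : Type w} [Ring H] [HopfAlgebra k H]
  [Module H V] [IsScalarTower k H V] [Module H (QuadAlg k I)] [IsScalarTower k H (QuadAlg k I)]
  [IsModuleAlgebra k H (QuadAlg k I)] [IsGradedAction k H I]

variable (k H I) in
/-- The diagonal action of `H` as a homomorphism of algebras. -/
def actHom (n : ℕ) : H →ₐ[k] Module.End k (KoszulTerm k I n) :=
  restrictHom (tpAct k H (QuadAlg k I) (n + 2)) (koszulSub k I n) fun h _ => tpAct_mem_koszulSub h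

/-- The diagonal action of `H`. -/
instance (n : ℕ) : Module H (KoszulTerm k I n) :=
  Module.compHom _ (actHom k I H n).toRingHom

lemma incl_act {n : ℕ} (h : H) (y : KoszulTerm k I n) :
    incl n (h • y) = tpAct k H (QuadAlg k I) (n + 2) h (incl n y) :=
  coe_restrictHom (tpAct k H (QuadAlg k I) (n + 2)) (koszulSub k I n)
    (fun h _ => tpAct_mem_koszulSub h) h y

instance (n : ℕ) : IsScalarTower k H (KoszulTerm k I n) where
  smul_assoc c b y := LinearMap.congr_fun (map_smul (actHom k I H n) c b) y

instance (n : ℕ) : EquivariantBimodule k H (QuadAlg k I) (KoszulTerm k I n) where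
  smul_smul' h b y := incl_injective n (by
    rw [incl_act, incl_smul, tpAct_lmulHom, map_sum]
    simp only [incl_act, incl_smul])
  smul_op_smul' h b y := incl_injective n (by
    rw [incl_act, incl_op_smul, tpAct_rmulHom, map_sum]
    simp only [incl_act, incl_op_smul])

lemma d_act [FiniteDimensional k V] {n : ℕ} (h : H) (y : KoszulTerm k I (n + 1)) :
    d k I n (h • y) = h • d k I n y :=
  incl_injective n (by rw [incl_d, incl_act, incl_act, incl_d, tpAct_barD])

lemma aug_act (h : H) (y : KoszulTerm k I 0) : aug k I (h • y) = h • aug k I y := by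
  rw [aug_apply, aug_apply, incl_act, barAug_tpAct]

end KoszulTerm

end KoszulTerm

/-! ### Free bimodules -/

section FreeBimod

variable (k A W : Type*) [CommRing k] [Ring A] [Algebra k A] [AddCommGroup W] [Module k W]

/-- The `A`-bimodule `A ⊗ W ⊗ A` for a vector space `W`. -/
def FreeBimod : Type _ := A ⊗[k] (W ⊗[k] A)

namespace FreeBimod

instance : AddCommGroup (FreeBimod k A W) := inferInstanceAs (AddCommGroup (A ⊗[k] (W ⊗[k] A)))
instance : Module k (FreeBimod k A W) := inferInstanceAs (Module k (A ⊗[k] (W ⊗[k] A)))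

/-- Left multiplication in the leftmost factor. -/
def leftHom : A →ₐ[k] Module.End k (FreeBimod k A W) := lam k (W ⊗[k] A)

/-- Right multiplication in the rightmost factor. -/
def rightHom : Aᵐᵒᵖ →ₐ[k] Module.End k (FreeBimod k A W) :=
  (Module.End.lTensorAlgHom k (W ⊗[k] A) A).comp
    ((Module.End.lTensorAlgHom k A W).comp (Algebra.lsmul k k A))

instance : Module A (FreeBimod k A W) := Module.compHom _ (leftHom k A W).toRingHom
instance : Module Aᵐᵒᵖ (FreeBimod k A W) := Module.compHom _ (rightHom k A W).toRingHom

variable {k A W} in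
/-- The element `a ⊗ w ⊗ a'`. -/
def mk (a : A) (w : W) (a' : A) : FreeBimod k A W := a ⊗ₜ[k] (w ⊗ₜ[k] a')

lemma smul_mk (b a : A) (w : W) (a' : A) : b • (mk a w a' : FreeBimod k A W) = mk (b * a) w a' :=
  rfl

lemma op_smul_mk (b a : A) (w : W) (a' : A) :
    op b • (mk a w a' : FreeBimod k A W) = mk a w (a' * b) := rfl

instance : IsScalarTower k A (FreeBimod k A W) where
  smul_assoc c a x := by
    change leftHom k A W (c • a) x = c • leftHom k A W a x
    rw [map_smul, LinearMap.smul_apply]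

instance : IsScalarTower k Aᵐᵒᵖ (FreeBimod k A W) where
  smul_assoc c a x := by
    change rightHom k A W (c • a) x = c • rightHom k A W a x
    rw [map_smul, LinearMap.smul_apply]

instance : SMulCommClass A Aᵐᵒᵖ (FreeBimod k A W) where
  smul_comm a b x :=
    LinearMap.congr_fun (TensorProduct.ext' fun _ _ => rfl :
      (lam k (W ⊗[k] A) a : A ⊗[k] (W ⊗[k] A) →ₗ[k] A ⊗[k] (W ⊗[k] A)) ∘ₗ
        LinearMap.lTensor A (LinearMap.lTensor W (Algebra.lsmul k k A b)) =
      LinearMap.lTensor A (LinearMap.lTensor W (Algebra.lsmul k k A b)) ∘ₗ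
        (lam k (W ⊗[k] A) a)) x

/-- `A ⊗ W ⊗ A` as a module over `A^e = A ⊗ A^op`: `(a ⊗ a') x = a x a'`. -/
instance : Module (Env k A) (FreeBimod k A W) := TensorProduct.Algebra.module

end FreeBimod

end FreeBimod

/-! ### Differential and augmentation of the bar resolution -/

namespace BarTerm

section

variable (k A : Type*) [CommRing k] [Ring A] [Algebra k A]

/-- The augmentation `A ⊗ A → A` of the bar resolution. -/
def aug : BarTerm k A 0 →ₗ[k] A := barAug k A

variable {k A}

lemma d_smul {n : ℕ} (a : A) (x : BarTerm k A (n + 1)) : d k A n (a • x) = a • d k A n x :=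
  barD_lmulHom a x
lemma d_op_smul {n : ℕ} (a : A) (x : BarTerm k A (n + 1)) :
    d k A n (op a • x) = op a • d k A n x := barD_rmulHom a x
lemma aug_smul (a : A) (x : BarTerm k A 0) : aug k A (a • x) = a * aug k A x := barAug_lmulHom a x
lemma aug_op_smul (a : A) (x : BarTerm k A 0) : aug k A (op a • x) = aug k A x * a :=
  barAug_rmulHom a x

end

variable {k H : Type*} [CommRing k] [Ring H] [HopfAlgebra k H]

lemma coact_d {n : ℕ} (x : BarTerm k H (n + 1)) :
    HopfBimodule.coact (d k H n x) = (d k H n).lTensor H (HopfBimodule.coact x) := tpCoact_barD x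

lemma comul_aug (x : BarTerm k H 0) : Coalgebra.comul (aug k H x) =
    (aug k H).lTensor H (HopfBimodule.coact x) := comul_barAug x

end BarTerm

/-! ### The resolution -/

section Resolution

universe u v w

variable (k : Type u) {V : Type v} (H : Type w) [Field k] [AddCommGroup V] [Module k V]
  [Ring H] [HopfAlgebra k H] (I : Submodule k (V ⊗[k] V))
  [Module H (QuadAlg k I)] [IsScalarTower k H (QuadAlg k I)] [IsModuleAlgebra k H (QuadAlg k I)]

/-- The algebra `A = B # H` for `B = T(V)/(I)`. -/
abbrev SmashAlg : Type _ := Smash k (QuadAlg k I) H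

/-- `A` as a module over `A^e = A ⊗ A^op`: `(a ⊗ a') x = a x a'`. -/
instance : Module (Env k (SmashAlg k H I)) (SmashAlg k H I) := TensorProduct.Algebra.module

/-- The `A`-bimodule `A ⊗_H C_i`, where `C_i = H^{⊗(i+2)}` is the bar resolution of `H`. -/
abbrev LeftTerm (i : ℕ) : Type _ := IndLeft k (QuadAlg k I) H (BarTerm k H i)

/-- The differential `id ⊗ d : A ⊗_H C_{i+1} → A ⊗_H C_i`. -/
def leftD (i : ℕ) : LeftTerm k H I (i + 1) →ₗ[k] LeftTerm k H I i :=
  IndLeft.map (QuadAlg k I) (BarTerm.d k H i) BarTerm.d_smul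

lemma leftD_smul (i : ℕ) (a : SmashAlg k H I) (p : LeftTerm k H I (i + 1)) :
    leftD k H I i (a • p) = a • leftD k H I i p := IndLeft.map_smul' _ _ a p

lemma leftD_op_smul (i : ℕ) (a : SmashAlg k H I) (p : LeftTerm k H I (i + 1)) :
    leftD k H I i (op a • p) = op a • leftD k H I i p :=
  IndLeft.map_op_smul _ _ BarTerm.d_op_smul BarTerm.coact_d a p

/-- The augmentation `A ⊗_H C_0 → A`, `a ⊗ x ↦ a ε(x)` for the augmentation `ε : C_0 → H` of the
bar resolution. -/
def leftAug : LeftTerm k H I 0 →ₗ[k] SmashAlg k H I :=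
  BTensor.lift k H (TensorProduct.lift
    ((LinearMap.mul k (SmashAlg k H I)).compl₂
      ((Smash.inr k (QuadAlg k I) H).toLinearMap ∘ₗ (BarTerm.aug k H))))
    fun a h x => by
      simp only [TensorProduct.lift.tmul, LinearMap.compl₂_apply, LinearMap.mul_apply',
        LinearMap.comp_apply, BarTerm.aug_smul, AlgHom.toLinearMap_apply, map_mul, Smash.smul_right_def,
        mul_assoc]

lemma leftAug_tmul (a : SmashAlg k H I) (x : BarTerm k H 0) :
    leftAug k H I (BTensor.tmul k H a x) = a * Smash.inr k (QuadAlg k I) H (BarTerm.aug k H x) := rfl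

lemma leftAug_smul (a : SmashAlg k H I) (p : LeftTerm k H I 0) :
    leftAug k H I (a • p) = a * leftAug k H I p := by
  induction p using BTensor.induction with
  | h0 => simp only [smul_zero, map_zero, mul_zero]
  | ha x y hx hy => simp only [smul_add, map_add, mul_add, hx, hy]
  | hm c x => rw [IndLeft.smul_tmul, leftAug_tmul, leftAug_tmul, mul_assoc]

lemma leftAug_op_smul (a : SmashAlg k H I) (p : LeftTerm k H I 0) :
    leftAug k H I (op a • p) = leftAug k H I p * a := by
  have h1 : ∀ (h : H) (p : LeftTerm k H I 0),
      leftAug k H I (op (Smash.inr k (QuadAlg k I) H h) • p) = leftAug k H I p * Smash.inr k (QuadAlg k I) H h := by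
    intro h p
    induction p using BTensor.induction with
    | h0 => simp only [smul_zero, map_zero, zero_mul]
    | ha x y hx hy => simp only [smul_add, map_add, add_mul, hx, hy]
    | hm c x =>
      rw [IndLeft.op_inr_smul, leftAug_tmul, leftAug_tmul, BarTerm.aug_op_smul, map_mul, mul_assoc]
  have h2 : ∀ (b : QuadAlg k I) (p : LeftTerm k H I 0),
      leftAug k H I (op (Smash.inl k (QuadAlg k I) H b) • p) = leftAug k H I p * Smash.inl k (QuadAlg k I) H b := by
    intro b p
    induction p using BTensor.induction with
    | h0 => simp only [smul_zero, map_zero, zero_mul]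
    | ha x y hx hy => simp only [smul_add, map_add, add_mul, hx, hy]
    | hm c x =>
      rw [IndLeft.op_inl_smul, leftAug_tmul, mul_assoc, Smash.inr_mul_inl, Finset.mul_sum]
      have h3 := sum_repr (LinearMap.mulLeft k c ∘ₗ LinearMap.mul' k (SmashAlg k H I) ∘ₗ
        TensorProduct.map ((Smash.inl k (QuadAlg k I) H).toLinearMap ∘ₗ orb k H b)
          (Smash.inr k (QuadAlg k I) H).toLinearMap) (BarTerm.aug k H x)
      simp only [LinearMap.comp_apply, TensorProduct.map_tmul, LinearMap.mul'_apply,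
        LinearMap.mulLeft_apply, AlgHom.toLinearMap_apply, orb_apply] at h3
      rw [h3, BarTerm.comul_aug]
      change leftAug k H I (IndLeft.twist c b (HopfBimodule.coact x)) = _
      generalize HopfBimodule.coact (k := k) (H := H) x = t
      induction t with
      | zero => simp only [map_zero, mul_zero]
      | add x y hx hy => simp only [map_add, mul_add, hx, hy]
      | tmul g y =>
        refine (leftAug_tmul k H I _ _).trans ?_
        simp only [LinearMap.lTensor_tmul, TensorProduct.map_tmul, LinearMap.mul'_apply,
          LinearMap.comp_apply, LinearMap.mulLeft_apply, LinearMap.id_apply,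
          AlgHom.toLinearMap_apply, orb_apply, mul_assoc]
  induction a using Smash.induction with
  | h0 => simp only [MulOpposite.op_zero, zero_smul, map_zero, mul_zero]
  | ha x y hx hy => simp only [MulOpposite.op_add, add_smul, map_add, mul_add, hx, hy]
  | hm b h =>
    rw [IndLeft.op_mk_smul, h1, h2, mul_assoc, Smash.inl_mul_inr]

variable [Module H V] [IsScalarTower k H V] [IsGradedAction k H I]

/-- The `A`-bimodule `D_j ⊗_B A`, where `D_j` is the Koszul resolution of `B`. -/
abbrev RightTerm (j : ℕ) : Type _ := IndRight k (QuadAlg k I) H (KoszulTerm k I j)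

/-- The augmentation `D_0 ⊗_B A → A`, `y ⊗ a ↦ ε(y) a` for the augmentation `ε : D_0 → B` of the
Koszul resolution. -/
def rightAug : RightTerm k H I 0 →ₗ[k] SmashAlg k H I :=
  BTensor.lift k (QuadAlg k I) (TensorProduct.lift
    ((LinearMap.mul k (SmashAlg k H I)) ∘ₗ
      ((Smash.inl k (QuadAlg k I) H).toLinearMap ∘ₗ (KoszulTerm.aug k I))))
    fun y b a => by
      simp only [TensorProduct.lift.tmul, LinearMap.mul_apply',
        LinearMap.comp_apply, KoszulTerm.aug_op_smul, AlgHom.toLinearMap_apply, map_mul,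
        Smash.smul_left_def, mul_assoc]

lemma rightAug_tmul (y : KoszulTerm k I 0) (a : SmashAlg k H I) :
    rightAug k H I (BTensor.tmul k (QuadAlg k I) y a) =
      Smash.inl k (QuadAlg k I) H (KoszulTerm.aug k I y) * a := rfl

lemma rightAug_op_smul (a : SmashAlg k H I) (q : RightTerm k H I 0) :
    rightAug k H I (op a • q) = rightAug k H I q * a := by
  induction q using BTensor.induction with
  | h0 => simp only [smul_zero, map_zero, zero_mul]
  | ha x y hx hy => simp only [smul_add, map_add, add_mul, hx, hy]
  | hm y c => rw [IndRight.op_smul_tmul, rightAug_tmul, rightAug_tmul, mul_assoc]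

lemma rightAug_smul (a : SmashAlg k H I) (q : RightTerm k H I 0) :
    rightAug k H I (a • q) = a * rightAug k H I q := by
  have h1 : ∀ (h : H) (q : RightTerm k H I 0),
      rightAug k H I (Smash.inr k (QuadAlg k I) H h • q) = Smash.inr k (QuadAlg k I) H h * rightAug k H I q := by
    intro h q
    induction q using BTensor.induction with
    | h0 => simp only [smul_zero, map_zero, mul_zero]
    | ha x y hx hy => simp only [smul_add, map_add, mul_add, hx, hy]
    | hm y c =>
      rw [IndRight.inr_smul, map_sum, rightAug_tmul, ← mul_assoc, Smash.inr_mul_inl,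
        Finset.sum_mul]
      refine Finset.sum_congr rfl fun i _ => ?_
      rw [rightAug_tmul, KoszulTerm.aug_act, mul_assoc]
  have h2 : ∀ (b : QuadAlg k I) (q : RightTerm k H I 0),
      rightAug k H I (Smash.inl k (QuadAlg k I) H b • q) = Smash.inl k (QuadAlg k I) H b * rightAug k H I q := by
    intro b q
    induction q using BTensor.induction with
    | h0 => simp only [smul_zero, map_zero, mul_zero]
    | ha x y hx hy => simp only [smul_add, map_add, mul_add, hx, hy]
    | hm y c =>
      rw [IndRight.inl_smul, rightAug_tmul, rightAug_tmul, KoszulTerm.aug_smul, map_mul, mul_assoc]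
  induction a using Smash.induction with
  | h0 => simp only [zero_smul, map_zero, zero_mul]
  | ha x y hx hy => simp only [add_smul, map_add, add_mul, hx, hy]
  | hm b h => rw [IndRight.mk_smul, h2, h1, ← mul_assoc, Smash.inl_mul_inr]

/-- The term `X_{i,j} = (A ⊗_H C_i) ⊗_A (D_j ⊗_B A)` of the double complex, an `A^e`-module. -/
abbrev XTerm (i j : ℕ) : Type _ :=
  BimodTensor k (SmashAlg k H I) (LeftTerm k H I i) (RightTerm k H I j)

/-- The augmentation `X_{0,0} → A`, `p ⊗ q ↦ ε(p) ε(q)`. -/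
def augZero : XTerm k H I 0 0 →ₗ[Env k (SmashAlg k H I)] SmashAlg k H I :=
  bimodHom
    (BimodTensor.lift
      ((LinearMap.mul k (SmashAlg k H I)).compl₁₂ (leftAug k H I) (rightAug k H I))
      fun p a q => by
        simp only [LinearMap.compl₁₂_apply, LinearMap.mul_apply', leftAug_op_smul, rightAug_smul,
          mul_assoc])
    (fun a x => by
      induction x using BimodTensor.induction with
      | h0 => simp only [smul_zero, map_zero]
      | ha x y hx hy => simp only [smul_add, map_add, hx, hy]
      | hm p q =>
        rw [BimodTensor.smul_tmul, BimodTensor.lift_tmul, BimodTensor.lift_tmul]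
        simp only [LinearMap.compl₁₂_apply, LinearMap.mul_apply', leftAug_smul, smul_eq_mul,
          mul_assoc])
    (fun a x => by
      induction x using BimodTensor.induction with
      | h0 => simp only [smul_zero, map_zero]
      | ha x y hx hy => simp only [smul_add, map_add, hx, hy]
      | hm p q =>
        rw [BimodTensor.op_smul_tmul, BimodTensor.lift_tmul, BimodTensor.lift_tmul]
        simp only [LinearMap.compl₁₂_apply, LinearMap.mul_apply', rightAug_op_smul,
          MulOpposite.smul_eq_mul_unop, MulOpposite.unop_op, mul_assoc])

variable [FiniteDimensional k V]

/-- The differential `d ⊗ id : D_{j+1} ⊗_B A → D_j ⊗_B A`. -/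
def rightD (j : ℕ) : RightTerm k H I (j + 1) →ₗ[k] RightTerm k H I j :=
  IndRight.map H (KoszulTerm.d k I j) KoszulTerm.d_op_smul

lemma rightD_smul (j : ℕ) (a : SmashAlg k H I) (q : RightTerm k H I (j + 1)) :
    rightD k H I j (a • q) = a • rightD k H I j q :=
  IndRight.map_smul' _ _ KoszulTerm.d_smul KoszulTerm.d_act a q

lemma rightD_op_smul (j : ℕ) (a : SmashAlg k H I) (q : RightTerm k H I (j + 1)) :
    rightD k H I j (op a • q) = op a • rightD k H I j q := IndRight.map_op_smul _ _ a q

/-- The horizontal differential `d ⊗ id : X_{i+1,j} → X_{i,j}`. -/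
def horD (i j : ℕ) : XTerm k H I (i + 1) j →ₗ[Env k (SmashAlg k H I)] XTerm k H I i j :=
  BimodTensor.map (leftD k H I i) (leftD_smul k H I i) (leftD_op_smul k H I i)
    LinearMap.id (fun _ _ => rfl) (fun _ _ => rfl)

/-- The vertical differential `(-1)ⁱ id ⊗ d : X_{i,j+1} → X_{i,j}`. -/
def verD (i j : ℕ) : XTerm k H I i (j + 1) →ₗ[Env k (SmashAlg k H I)] XTerm k H I i j :=
  (-1 : ℤ) ^ i • BimodTensor.map LinearMap.id (fun _ _ => rfl) (fun _ _ => rfl)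
    (rightD k H I j) (rightD_smul k H I j) (rightD_op_smul k H I j)

/-- The term `X_n = ⨁_{i+j=n} X_{i,j}` of the total complex. -/
abbrev XTotal (n : ℕ) : Type _ :=
  ⨁ p : {p : ℕ × ℕ // p.1 + p.2 = n}, XTerm k H I p.1.1 p.1.2

/-- The inclusion `X_{i,j} → X_n` for `i + j = n`. -/
def ofTerm {n : ℕ} (i j : ℕ) (h : i + j = n) :
    XTerm k H I i j →ₗ[Env k (SmashAlg k H I)] XTotal k H I n :=
  DirectSum.lof (Env k (SmashAlg k H I)) {p : ℕ × ℕ // p.1 + p.2 = n}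
    (fun p => XTerm k H I p.1.1 p.1.2) ⟨(i, j), h⟩

/-- The horizontal differential on `X_{i,j}` for `i + j = n + 1`, with values in `X_n`
(zero for `i = 0`). -/
def horPart (n : ℕ) : (i j : ℕ) → (h : i + j = n + 1) →
    XTerm k H I i j →ₗ[Env k (SmashAlg k H I)] XTotal k H I n
  | 0, _, _ => 0
  | i + 1, j, h => ofTerm k H I i j (by omega) ∘ₗ horD k H I i j

/-- The vertical differential on `X_{i,j}` for `i + j = n + 1`, with values in `X_n`
(zero for `j = 0`). -/
def verPart (n : ℕ) : (i j : ℕ) → (h : i + j = n + 1) →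
    XTerm k H I i j →ₗ[Env k (SmashAlg k H I)] XTotal k H I n
  | _, 0, _ => 0
  | i, j + 1, h => ofTerm k H I i j (by omega) ∘ₗ verD k H I i j

/-- The differential `X_{n+1} → X_n` of the total complex. -/
def totalD (n : ℕ) : XTotal k H I (n + 1) →ₗ[Env k (SmashAlg k H I)] XTotal k H I n :=
  DirectSum.toModule (Env k (SmashAlg k H I)) {p : ℕ × ℕ // p.1 + p.2 = n + 1} (XTotal k H I n)
    fun p => horPart k H I n p.1.1 p.1.2 p.2 + verPart k H I n p.1.1 p.1.2 p.2

/-- The augmentation on `X_{i,j}` (zero unless `i = j = 0`). -/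
def augPart : (i j : ℕ) → XTerm k H I i j →ₗ[Env k (SmashAlg k H I)] SmashAlg k H I
  | 0, 0 => augZero k H I
  | _, _ + 1 => 0
  | _ + 1, _ => 0

/-- The augmentation `X_0 → A`. -/
def totalAug : XTotal k H I 0 →ₗ[Env k (SmashAlg k H I)] SmashAlg k H I :=
  DirectSum.toModule (Env k (SmashAlg k H I)) {p : ℕ × ℕ // p.1 + p.2 = 0} (SmashAlg k H I)
    fun p => augPart k H I p.1.1 p.1.2

end Resolution

end SmashResolution

end

open scoped TensorProduct DirectSum Coalgebra
open MulOpposite (op unop)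

noncomputable section

namespace SmashResolution

set_option linter.unusedSectionVars false

/-! Write X for the double complex. The argument has three independent inputs: exactness of the
Koszul resolution of B, contractibility of the rows of X, and a description of each X_{i,j} that
shows freeness.

Koszul resolution. Koszulness is given as some linear free resolution P of k. Its differentials have
matrix entries in V, so following the entries from a generator of P_n down to P_0 yields a tensor in
V^{⊗n} (`resVec`). By induction on n these tensors form a basis of D'_n (`resMap_bijective`).
Injectivity comes from exactness and minimality. The image is D'_n because two successive
differentials compose to zero exactly on tensors whose first two factors satisfy the relations.
Hence P is the left Koszul complex B ⊗ D'_•, which is therefore exact (`leftKoszulD_exact`). On B ⊗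
D'_• ⊗ B the differential is a left part, which raises the degree of the first factor by one, plus a
right part, which preserves that degree. The left part is the left Koszul complex tensored with B,
so the top left-degree part of a cycle can be removed by subtracting a boundary. Descent on the left
degree gives `koszulTerm_exact`.

Rows and columns. The contraction x ↦ 1 ⊗ x of the bar resolution of H is right H-linear and
H-colinear. The right A-action on A ⊗_H C_i uses only the right action and the coaction on C_i, so
the contraction extends to right A-linear maps and survives (-) ⊗_A (D_j ⊗_B A). Every row is thus a
contractible complex over D_j ⊗_B A. As a complex of vector spaces, D_• ⊗_B A is D_• ⊗ H, hence
exact over B ⊗ H, that is, over A. The usual double complex chase (`exists_total_boundary`) then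
gives exactness of the total complex.

Freeness. As a right H-module A ⊗_H C_i is U ⊗ H with U = A ⊗ C'_i, by splitting off the last factor
of C_i. As a left A-module D_j ⊗_B A is B ⊗ N with N = D'_j ⊗ A under the diagonal H-action, that
is, the module induced from the H-module N. Hence X_{i,j} = (U ⊗ H) ⊗_H N = U ⊗ N = A ⊗ C'_i ⊗ D'_j
⊗ A (`inducedMap_bijective`). The outer A-actions touch only the outer factors, so the isomorphism
is A^e-linear, and A ⊗ W ⊗ A is A^e ⊗ W for a vector space W, which is free. -/

/-! ### Quadratic algebras: universal property, grading and low degrees -/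

section QuadAlgFacts

universe u v

variable {k : Type u} {V : Type v} [Field k] [AddCommGroup V] [Module k V]
  {I : Submodule k (V ⊗[k] V)}

namespace QuadAlg

/-- The universal property of `T(V)/(I)`. -/
def liftHom {E : Type*} [Ring E] [Algebra k E] (f : V →ₗ[k] E)
    (hf : ∀ r ∈ I, LinearMap.mul' k E (TensorProduct.map f f r) = 0) : QuadAlg k I →ₐ[k] E :=
  RingQuot.liftAlgHom k ⟨TensorAlgebra.lift k f, fun x y h => by
    obtain ⟨r, hr, rfl, rfl⟩ := h
    rw [map_zero (TensorAlgebra.lift k f), ← hf r hr]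
    -- Once 0 has been replaced by the product of `r`, the two sides agree for every tensor, so the
    -- membership in `I` can be dropped and induction on tensors applies.
    generalize r = t
    induction t with
    | zero => simp only [map_zero]
    | add x y hx hy => simp only [map_add, hx, hy]
    | tmul v w => simp [quadMap]⟩

lemma liftHom_gen {E : Type*} [Ring E] [Algebra k E] (f : V →ₗ[k] E) (hf) (v : V) :
    liftHom (I := I) f hf (gen k I v) = f v :=
  (RingQuot.liftAlgHom_mkAlgHom_apply k (TensorAlgebra.lift k f) _ (TensorAlgebra.ι k v)).trans
    (TensorAlgebra.lift_ι_apply f v)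

lemma hom_ext {E : Type*} [Ring E] [Algebra k E] {f g : QuadAlg k I →ₐ[k] E}
    (h : ∀ v, f (gen k I v) = g (gen k I v)) : f = g := by
  refine RingQuot.ringQuot_ext' (S := k) (s := QuadRel k I) f g ?_
  exact TensorAlgebra.hom_ext (LinearMap.ext h)

lemma aug_gen (v : V) : aug k I (gen k I v) = 0 :=
  (RingQuot.liftAlgHom_mkAlgHom_apply k (TensorAlgebra.lift k (0 : V →ₗ[k] k)) _
    (TensorAlgebra.ι k v)).trans (TensorAlgebra.lift_ι_apply 0 v)

lemma gen2_tmul (v w : V) : gen2 k I (v ⊗ₜ w) = gen k I v * gen k I w := rfl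

variable (k I) in
/-- The homomorphism `B → B[X]`, `v ↦ v X`, which encodes the grading of `B`. -/
def gradHom : QuadAlg k I →ₐ[k] Polynomial (QuadAlg k I) :=
  liftHom ((Polynomial.monomial (R := QuadAlg k I) 1).restrictScalars k ∘ₗ gen k I) (by
    intro r hr
    have : ∀ t : V ⊗[k] V, LinearMap.mul' k (Polynomial (QuadAlg k I))
        (TensorProduct.map ((Polynomial.monomial (R := QuadAlg k I) 1).restrictScalars k ∘ₗ gen k I)
          ((Polynomial.monomial (R := QuadAlg k I) 1).restrictScalars k ∘ₗ gen k I) t) =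
        Polynomial.monomial 2 (gen2 k I t) := by
      intro t
      induction t with
      | zero => simp only [map_zero]
      | add x y hx hy => simp only [map_add, hx, hy]
      | tmul v w => simp [gen2_tmul, Polynomial.monomial_mul_monomial]
    rw [this, gen2_eq_zero k I r hr, map_zero])

lemma gradHom_gen (v : V) : gradHom k I (gen k I v) = Polynomial.monomial 1 (gen k I v) :=
  liftHom_gen _ _ v

variable (k I) in
/-- The projection of `B` to its component of degree `m`. -/
def comp (m : ℕ) : QuadAlg k I →ₗ[k] QuadAlg k I :=
  (Polynomial.lcoeff (QuadAlg k I) m).restrictScalars k ∘ₗ (gradHom k I).toLinearMap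

lemma comp_apply (m : ℕ) (b : QuadAlg k I) : comp k I m b = (gradHom k I b).coeff m := rfl

lemma comp_eq_zero {m : ℕ} {b : QuadAlg k I} (h : (gradHom k I b).natDegree < m) :
    comp k I m b = 0 := Polynomial.coeff_eq_zero_of_natDegree_lt h

/-- In B[X] right multiplication by a generator becomes right multiplication by `C v * X`, which
shifts coefficients by one. This is the source of every statement below that a differential raises
the left degree. -/
lemma comp_succ_mul_gen (m : ℕ) (b : QuadAlg k I) (v : V) :
    comp k I (m + 1) (b * gen k I v) = comp k I m b * gen k I v := by
  rw [comp_apply, map_mul, gradHom_gen, ← Polynomial.C_mul_X_eq_monomial, ← mul_assoc,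
    Polynomial.coeff_mul_X, Polynomial.coeff_mul_C, comp_apply]

lemma comp_zero_mul_gen (b : QuadAlg k I) (v : V) : comp k I 0 (b * gen k I v) = 0 := by
  rw [comp_apply, map_mul, gradHom_gen, ← Polynomial.C_mul_X_eq_monomial, ← mul_assoc,
    Polynomial.coeff_mul_X_zero]

/-- Taking the constant coefficient of `gradHom` and applying the augmentation followed by the unit
are two algebra endomorphisms of B that kill V, so they coincide: the degree zero part of B is k. -/
lemma comp_zero (b : QuadAlg k I) : comp k I 0 b = algebraMap k _ (aug k I b) := by
  let f : QuadAlg k I →ₐ[k] QuadAlg k I :=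
    { (Polynomial.constantCoeff (R := QuadAlg k I)).comp (gradHom k I).toRingHom with
      commutes' := fun c => by simp [Polynomial.algebraMap_apply] }
  have : f = (Algebra.ofId k _).comp (aug k I) := hom_ext fun v => by
    change (gradHom k I (gen k I v)).coeff 0 = algebraMap k _ (aug k I (gen k I v))
    rw [gradHom_gen, aug_gen]
    simp
  exact DFunLike.congr_fun this b

/-- Evaluation at X = 1 is a left inverse of `gradHom`, since it is one on generators. -/
lemma sum_comp (b : QuadAlg k I) : (gradHom k I b).sum (fun _ c => c) = b := by
  let f : Polynomial (QuadAlg k I) →ₐ[k] QuadAlg k I :=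
    { Polynomial.eval₂RingHom' (RingHom.id (QuadAlg k I)) 1 (fun _ => Commute.one_right _) with
      commutes' := fun c => by simp [Polynomial.algebraMap_apply] }
  have h : f.comp (gradHom k I) = AlgHom.id k _ := hom_ext fun v => by
    rw [AlgHom.comp_apply, gradHom_gen]
    simp [f]
  have h2 := DFunLike.congr_fun h b
  rw [AlgHom.comp_apply] at h2
  refine Eq.trans ?_ h2
  change _ = Polynomial.eval₂ (RingHom.id _) 1 (gradHom k I b)
  rw [Polynomial.eval₂_def]
  simp

/-- Applying the augmentation to the coefficients of `gradHom` gives a homomorphism B → k[X] that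
kills V, hence one with constant values. -/
lemma aug_comp {m : ℕ} (b : QuadAlg k I) (hm : m ≠ 0) : aug k I (comp k I m b) = 0 := by
  have key : ((aug k I).toLinearMap ∘ₗ comp k I m) = 0 := by
    let f : Polynomial (QuadAlg k I) →ₐ[k] Polynomial k := Polynomial.mapAlgHom (aug k I)
    have h : f.comp (gradHom k I) = (Algebra.ofId k _).comp (aug k I) := hom_ext fun v => by
      rw [AlgHom.comp_apply, gradHom_gen]
      simp [f, aug_gen]
    refine LinearMap.ext fun b => ?_
    have h2 := congrArg (fun p => Polynomial.coeff p m) (DFunLike.congr_fun h b)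
    simp only [f, AlgHom.comp_apply, Polynomial.coe_mapAlgHom, Polynomial.coeff_map] at h2
    refine h2.trans ?_
    rw [Algebra.ofId_apply, Polynomial.algebraMap_apply, Polynomial.coeff_C, if_neg hm]
    rfl
  exact LinearMap.congr_fun key b

variable (k I) in
/-- The operators `(c, w, t) ↦ (0, c v, v ⊗ w)` on `k × V × (V ⊗ V)/I`. -/
def lowOp : V →ₗ[k] Module.End k (k × V × ((V ⊗[k] V) ⧸ I)) :=
  LinearMap.mk₂ k (fun v x => (0, x.1 • v, I.mkQ (v ⊗ₜ x.2.1)))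
    (fun v w x => by simp [TensorProduct.add_tmul])
    (fun c v x => by simp [smul_comm x.1 c v, ← TensorProduct.smul_tmul'])
    (fun v x y => by simp [TensorProduct.tmul_add, add_smul])
    (fun c v x => by simp [mul_smul])

lemma lowOp_apply (v : V) (x : k × V × ((V ⊗[k] V) ⧸ I)) :
    lowOp k I v x = (0, x.1 • v, I.mkQ (v ⊗ₜ x.2.1)) := rfl

lemma mul'_lowOp (t : V ⊗[k] V) (x : k × V × ((V ⊗[k] V) ⧸ I)) :
    LinearMap.mul' k _ (TensorProduct.map (lowOp k I) (lowOp k I) t) x =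
      (0, 0, x.1 • I.mkQ t) := by
  induction t with
  | zero => simp; rfl
  | add y z hy hz => simp only [map_add, LinearMap.add_apply, hy, hz]; simp
  | tmul v w =>
    simp [lowOp_apply, Module.End.mul_apply]

variable (k I) in
/-- The representation of `B` on the sum `k × V × (V ⊗ V)/I` of its components of degree at most
two. -/
def lowRep : QuadAlg k I →ₐ[k] Module.End k (k × V × ((V ⊗[k] V) ⧸ I)) :=
  liftHom (lowOp k I) fun r hr => LinearMap.ext fun x => by
    have : I.mkQ r = 0 := by simpa using hr
    rw [mul'_lowOp, this]
    simp

lemma lowRep_gen2 (t : V ⊗[k] V) : lowRep k I (gen2 k I t) (1, 0, 0) = (0, 0, I.mkQ t) := by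
  have : lowRep k I (gen2 k I t) =
      LinearMap.mul' k _ (TensorProduct.map (lowOp k I) (lowOp k I) t) := by
    induction t with
    | zero => simp only [map_zero]
    | add x y hx hy => simp only [map_add, hx, hy]
    | tmul v w =>
      rw [gen2_tmul, map_mul, lowRep, liftHom_gen, liftHom_gen]
      rfl
  rw [this, mul'_lowOp]
  simp

/-- B is a quotient, so elements are shown to be nonzero through a representation: `lowRep` of a
generator v, applied to (1, 0, 0), returns v in the middle component. -/
lemma gen_injective : Function.Injective (gen k I) := by
  rw [injective_iff_map_eq_zero]
  intro v hv
  have h : lowRep k I (gen k I v) (1, 0, 0) = (0, (1 : k) • v, I.mkQ (v ⊗ₜ 0)) := by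
    rw [lowRep, liftHom_gen]
    rfl
  rw [hv, map_zero] at h
  simpa using (congrArg (fun x => x.2.1) h).symm

/-- No relation in degree two appears beyond I: `lowRep` of a product of generators, applied to (1,
0, 0), reads off its class in (V ⊗ V)/I. -/
lemma ker_gen2 : LinearMap.ker (gen2 k I) = I := by
  refine le_antisymm (fun t ht => ?_) (fun t ht => gen2_eq_zero k I t ht)
  have h := lowRep_gen2 (I := I) t
  rw [LinearMap.mem_ker.1 ht, map_zero] at h
  simpa using (congrArg (fun x => x.2.2) h).symm

end QuadAlg

end QuadAlgFacts

/-! ### Orthogonality of the degree projections -/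

section QuadAlgComp

universe u v

variable {k : Type u} {V : Type v} [Field k] [AddCommGroup V] [Module k V]
  {I : Submodule k (V ⊗[k] V)}

namespace QuadAlg

/-- Two homomorphisms B → B[X][Y] are compared: grading B twice, and grading it once and then
sending `a X^i` to `a X^i Y^i`. Both send a generator v to `v X Y`, hence they agree, and comparing
coefficients gives the claim. -/
lemma comp_comp (m n : ℕ) (b : QuadAlg k I) :
    comp k I m (comp k I n b) = if m = n then comp k I n b else 0 := by
  let x : Polynomial (Polynomial (QuadAlg k I)) := Polynomial.monomial 1 Polynomial.X
  have hx : ∀ y : QuadAlg k I, Commute (Polynomial.C (Polynomial.C y)) x := fun y => by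
    simp only [x, commute_iff_eq, Polynomial.C_mul_monomial, Polynomial.monomial_mul_C,
      Polynomial.X_mul_C]
  let f : Polynomial (QuadAlg k I) →ₐ[k] Polynomial (Polynomial (QuadAlg k I)) :=
    { Polynomial.eval₂RingHom' (Polynomial.C.comp Polynomial.C) x hx with
      commutes' := fun c => by simp [Polynomial.algebraMap_apply] }
  have hf : ∀ p : Polynomial (QuadAlg k I),
      ((f p).coeff n).coeff m = if m = n then p.coeff n else 0 := by
    intro p
    induction p using Polynomial.induction_on' with
    | add p q hp hq =>
      rw [map_add, Polynomial.coeff_add, Polynomial.coeff_add, hp, hq]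
      split_ifs <;> simp
    | monomial i a =>
      have h1 : f (Polynomial.monomial i a) = Polynomial.monomial i (Polynomial.monomial i a) := by
        change Polynomial.eval₂ _ x (Polynomial.monomial i a) = _
        rw [Polynomial.eval₂_monomial, Polynomial.monomial_pow, RingHom.comp_apply,
          Polynomial.C_mul_monomial, one_mul, Polynomial.C_mul_X_pow_eq_monomial]
      rw [h1]
      rcases eq_or_ne i n with rfl | hi
      · simp [Polynomial.coeff_monomial, eq_comm]
      · simp [Polynomial.coeff_monomial, hi]
  have h : (Polynomial.mapAlgHom (gradHom k I)).comp (gradHom k I) = f.comp (gradHom k I) :=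
    hom_ext fun v => by
      rw [AlgHom.comp_apply, AlgHom.comp_apply, gradHom_gen]
      change Polynomial.map _ _ = Polynomial.eval₂ _ x _
      rw [Polynomial.map_monomial, Polynomial.eval₂_monomial, pow_one]
      change Polynomial.monomial 1 (gradHom k I (gen k I v)) = _
      rw [gradHom_gen, RingHom.comp_apply, Polynomial.C_mul_monomial, Polynomial.C_mul_X_eq_monomial]
  have h2 := congrArg (fun p => (Polynomial.coeff p n).coeff m) (DFunLike.congr_fun h b)
  simp only [AlgHom.comp_apply, hf, Polynomial.coe_mapAlgHom, Polynomial.coeff_map] at h2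
  exact h2

end QuadAlg

end QuadAlgComp

/-! ### The left Koszul complex -/

section LeftKoszul

universe u v

variable {k : Type u} {V : Type v} [Field k] [AddCommGroup V] [Module k V]
  {I : Submodule k (V ⊗[k] V)}

open QuadAlg

variable (k I) in
/-- The map `B ⊗ V^{⊗(n+1)} → B ⊗ V^{⊗n}`, `b ⊗ (v ⊗ x) ↦ b v ⊗ x`. -/
def lkD (n : ℕ) : QuadAlg k I ⊗[k] (⨂[k]^(n + 1) V) →ₗ[k] QuadAlg k I ⊗[k] (⨂[k]^n V) :=
  (LinearMap.mul' k (QuadAlg k I) ∘ₗ (gen k I).lTensor (QuadAlg k I)).rTensor (⨂[k]^n V) ∘ₗ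
    (TensorProduct.assoc k (QuadAlg k I) V (⨂[k]^n V)).symm.toLinearMap ∘ₗ
    (consE k V n).symm.toLinearMap.lTensor (QuadAlg k I)

lemma lkD_tmul_tcons {n : ℕ} (b : QuadAlg k I) (v : V) (x : ⨂[k]^n V) :
    lkD k I n (b ⊗ₜ tcons v x) = (b * gen k I v) ⊗ₜ x := by
  simp [lkD]

lemma lkD_tmul [FiniteDimensional k V] {n : ℕ} (b : QuadAlg k I) (x : ⨂[k]^(n + 1) V) :
    lkD k I n (b ⊗ₜ x) =
      ∑ i, (b * gen k I (bas k V i)) ⊗ₜ contractL ((bas k V).coord i) n x := by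
  conv_lhs => rw [← sum_tcons_contractL x, TensorProduct.tmul_sum, map_sum]
  simp only [lkD_tmul_tcons]

variable (k I) in
/-- The projection of `B ⊗ M` to the part with first factor of degree `m`. -/
def compL (m : ℕ) (M : Type*) [AddCommMonoid M] [Module k M] :
    QuadAlg k I ⊗[k] M →ₗ[k] QuadAlg k I ⊗[k] M := (comp k I m).rTensor M

variable (k I) in
/-- The map `B ⊗ M → M` given by the augmentation of `B`. -/
def augL (M : Type*) [AddCommMonoid M] [Module k M] : QuadAlg k I ⊗[k] M →ₗ[k] M :=
  (TensorProduct.lid k M).toLinearMap ∘ₗ (aug k I).toLinearMap.rTensor M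

section

variable {M : Type*} [AddCommMonoid M] [Module k M]

lemma compL_tmul (m : ℕ) (b : QuadAlg k I) (x : M) :
    compL k I m M (b ⊗ₜ x) = comp k I m b ⊗ₜ x := rfl

lemma augL_tmul (b : QuadAlg k I) (x : M) : augL k I M (b ⊗ₜ x) = aug k I b • x := rfl

lemma compL_zero (z : QuadAlg k I ⊗[k] M) : compL k I 0 M z = 1 ⊗ₜ augL k I M z := by
  induction z with
  | zero => simp
  | add x y hx hy => simp only [map_add, TensorProduct.tmul_add, hx, hy]
  | tmul b x =>
    rw [compL_tmul, augL_tmul, comp_zero, Algebra.algebraMap_eq_smul_one, TensorProduct.smul_tmul]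

lemma compL_compL (m n : ℕ) (z : QuadAlg k I ⊗[k] M) :
    compL k I m M (compL k I n M z) = if m = n then compL k I n M z else 0 := by
  induction z with
  | zero => simp
  | add x y hx hy =>
    rw [map_add, map_add, hx, hy]
    split_ifs <;> simp
  | tmul b x =>
    rw [compL_tmul, compL_tmul, comp_comp]
    split_ifs <;> simp

/-- Bounds the left degree of z; this is the number on which the later descent arguments run. -/
lemma exists_compL_eq_zero (z : QuadAlg k I ⊗[k] M) :
    ∃ N, ∀ m, N ≤ m → compL k I m M z = 0 := by
  induction z with
  | zero => exact ⟨0, fun m _ => map_zero _⟩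
  | add x y hx hy =>
    obtain ⟨N, hN⟩ := hx
    obtain ⟨N', hN'⟩ := hy
    exact ⟨max N N', fun m hm => by
      rw [map_add, hN m (le_trans (le_max_left _ _) hm), hN' m (le_trans (le_max_right _ _) hm),
        add_zero]⟩
  | tmul b x =>
    exact ⟨(gradHom k I b).natDegree + 1, fun m hm => by
      rw [compL_tmul, comp_eq_zero (by omega), TensorProduct.zero_tmul]⟩

lemma eq_zero_of_compL (z : QuadAlg k I ⊗[k] M) (hz : ∀ m, compL k I m M z = 0) : z = 0 := by
  -- The claim is made for all finite sets containing `s`, so that the sets belonging to two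
  -- summands can be replaced by their union.
  have key : ∀ z : QuadAlg k I ⊗[k] M, ∃ s : Finset ℕ, ∀ t, s ⊆ t → ∑ m ∈ t, compL k I m M z = z := by
    intro z
    induction z with
    | zero => exact ⟨∅, fun t _ => by simp⟩
    | add x y hx hy =>
      obtain ⟨s, hs⟩ := hx
      obtain ⟨s', hs'⟩ := hy
      refine ⟨s ∪ s', fun t ht => ?_⟩
      simp only [map_add, Finset.sum_add_distrib]
      rw [hs t (Finset.union_subset_left ht), hs' t (Finset.union_subset_right ht)]
    | tmul b x =>
      refine ⟨(gradHom k I b).support, fun t ht => ?_⟩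
      simp only [compL_tmul, ← TensorProduct.sum_tmul]
      congr 1
      conv_rhs => rw [← sum_comp b, Polynomial.sum_def]
      refine (Finset.sum_subset ht fun m _ hm => ?_).symm
      exact Polynomial.notMem_support_iff.1 hm
  obtain ⟨s, hs⟩ := key z
  rw [← hs s subset_rfl, Finset.sum_eq_zero fun m _ => hz m]

lemma augL_lTensor {N : Type*} [AddCommMonoid N] [Module k N] (f : M →ₗ[k] N)
    (z : QuadAlg k I ⊗[k] M) : augL k I N (f.lTensor _ z) = f (augL k I M z) := by
  induction z with
  | zero => simp
  | add x y hx hy => simp only [map_add, hx, hy]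
  | tmul b x => simp [augL_tmul]

end

lemma compL_succ_lkD (m n : ℕ) (z : QuadAlg k I ⊗[k] (⨂[k]^(n + 1) V)) :
    compL k I (m + 1) _ (lkD k I n z) = lkD k I n (compL k I m _ z) := by
  induction z with
  | zero => simp
  | add x y hx hy => simp only [map_add, hx, hy]
  | tmul b x =>
    induction x using tcons_induction with
    | h0 => simp
    | ha x y hx hy => simp only [map_add, TensorProduct.tmul_add, hx, hy]
    | hc v x => simp only [lkD_tmul_tcons, compL_tmul, comp_succ_mul_gen]

lemma augL_lkD {n : ℕ} (z : QuadAlg k I ⊗[k] (⨂[k]^(n + 1) V)) :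
    augL k I _ (lkD k I n z) = 0 := by
  induction z with
  | zero => simp
  | add x y hx hy => simp only [map_add, hx, hy, add_zero]
  | tmul b x =>
    induction x using tcons_induction with
    | h0 => simp
    | ha x y hx hy => simp only [map_add, TensorProduct.tmul_add, hx, hy, add_zero]
    | hc v x => simp [lkD_tmul_tcons, augL_tmul, aug_gen]

/-- On 1 ⊗ V ⊗ V^{⊗n} the map is `gen` tensored with the identity, and V embeds in B. -/
lemma lkD_one_injective (n : ℕ) :
    Function.Injective fun x : ⨂[k]^(n + 1) V => lkD k I n (1 ⊗ₜ x) := by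
  have h : (fun x : ⨂[k]^(n + 1) V => lkD k I n (1 ⊗ₜ x)) =
      (gen k I).rTensor (⨂[k]^n V) ∘ (consE k V n).symm := by
    funext x
    induction x using tcons_induction with
    | h0 => simp
    | ha x y hx hy =>
      simp only [Function.comp_apply] at hx hy
      simp only [Function.comp_apply, map_add, TensorProduct.tmul_add, hx, hy]
    | hc v x => simp [lkD_tmul_tcons]
  rw [h]
  exact (Module.Flat.rTensor_preserves_injective_linearMap _ gen_injective).comp
    (LinearEquiv.injective _)

/-- The relations in the first two factors are detected by the square of `lkD`. -/
lemma lkD_lkD_one_eq_zero {n : ℕ} (x : ⨂[k]^(n + 2) V) :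
    lkD k I n (lkD k I (n + 1) (1 ⊗ₜ x)) = 0 ↔ x ∈ relSub I (n + 2) 0 := by
  -- Splitting off the first two factors turns the square of `lkD` on 1 ⊗ V^{⊗(n+2)} into `gen2`
  -- tensored with the identity. Its kernel is I ⊗ V^{⊗n}, by `ker_gen2` and flatness.
  let ψ : (⨂[k]^(n + 2) V) ≃ₗ[k] (V ⊗[k] V) ⊗[k] (⨂[k]^n V) :=
    (consE k V (n + 1)).symm ≪≫ₗ (TensorProduct.congr (LinearEquiv.refl k V) (consE k V n).symm) ≪≫ₗ
      (TensorProduct.assoc k V V (⨂[k]^n V)).symm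
  have hψ : ∀ x, lkD k I n (lkD k I (n + 1) (1 ⊗ₜ x)) = (gen2 k I).rTensor _ (ψ x) := by
    intro x
    induction x using tcons_induction with
    | h0 => simp
    | ha x y hx hy => simp only [map_add, TensorProduct.tmul_add, hx, hy]
    | hc v x =>
      induction x using tcons_induction with
      | h0 => simp [tcons_zero]
      | ha x y hx hy => simp only [map_add, tcons_add, TensorProduct.tmul_add, hx, hy]
      | hc w x => simp [lkD_tmul_tcons, ψ, gen2_tmul]
  have hex : Function.Exact (I.subtype.rTensor (⨂[k]^n V)) ((gen2 k I).rTensor (⨂[k]^n V)) := by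
    refine Module.Flat.rTensor_exact _ (LinearMap.exact_iff.2 ?_)
    rw [ker_gen2, Submodule.range_subtype]
  rw [hψ, hex (ψ x), relSub]
  constructor
  · rintro ⟨t, ht⟩
    refine ⟨t, ?_⟩
    have : x = ψ.symm (I.subtype.rTensor _ t) := by rw [ht, LinearEquiv.symm_apply_apply]
    rw [this]
    rfl
  · rintro ⟨t, rfl⟩
    refine ⟨t, ?_⟩
    rw [← LinearEquiv.symm_apply_eq]
    rfl

/-- This is the recursion D'_{n+2} = (I ⊗ V^{⊗n}) ∩ (V ⊗ D'_{n+1}), with membership in V ⊗ D'_{n+1}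
expressed by contracting the first factor with a dual basis. -/
lemma mem_koszulSpace_succ_succ [FiniteDimensional k V] {n : ℕ} {x : ⨂[k]^(n + 2) V} :
    x ∈ koszulSpace I (n + 2) ↔ x ∈ relSub I (n + 2) 0 ∧
      ∀ i, contractL ((bas k V).coord i) (n + 1) x ∈ koszulSpace I (n + 1) := by
  refine ⟨fun h => ⟨mem_koszulSpace.1 h 0 (by omega), fun i => contractL_mem _ h⟩, fun h => ?_⟩
  refine mem_koszulSpace.2 fun j hj => ?_
  cases j with
  | zero => exact h.1
  | succ j =>
    rw [← sum_tcons_contractL x]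
    exact sum_mem fun i _ => mem_relSub_succ (mem_koszulSpace.1 (h.2 i) j (by omega)) _

lemma koszulSpace_eq_top {n : ℕ} (hn : n ≤ 1) : koszulSpace I n = ⊤ :=
  eq_top_iff.2 fun _ _ => mem_koszulSpace.2 fun j hj => by omega

variable (k I) in
/-- The contraction of the first factor as a map `D'ₙ₊₁ → D'ₙ`. -/
def contractLK (φ : V →ₗ[k] k) (n : ℕ) : koszulSpace I (n + 1) →ₗ[k] koszulSpace I n :=
  (contractL φ n).restrict fun _ h => contractL_mem φ h

variable (k I) in
/-- The contraction of the last factor as a map `D'ₙ₊₁ → D'ₙ`. -/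
def contractRK (φ : V →ₗ[k] k) (n : ℕ) : koszulSpace I (n + 1) →ₗ[k] koszulSpace I n :=
  (contractR φ n).restrict fun _ h => contractR_mem φ h

variable (k I) in
/-- The differential `B ⊗ D'ₙ₊₁ → B ⊗ D'ₙ` of the left Koszul complex. -/
def leftKoszulD [FiniteDimensional k V] (n : ℕ) :
    QuadAlg k I ⊗[k] koszulSpace I (n + 1) →ₗ[k] QuadAlg k I ⊗[k] koszulSpace I n :=
  ∑ i, TensorProduct.map (LinearMap.mulRight k (gen k I (bas k V i)))
    (contractLK k I ((bas k V).coord i) n)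

lemma leftKoszulD_tmul [FiniteDimensional k V] {n : ℕ} (b : QuadAlg k I)
    (x : koszulSpace I (n + 1)) : leftKoszulD k I n (b ⊗ₜ x) =
      ∑ i, (b * gen k I (bas k V i)) ⊗ₜ contractLK k I ((bas k V).coord i) n x := by
  simp [leftKoszulD, LinearMap.sum_apply]

/-- The left Koszul complex sits inside the B ⊗ V^{⊗n} with the maps `lkD`. Identities for
`leftKoszulD` are verified there, where no membership in D'_n has to be carried along. -/
lemma lTensor_subtype_leftKoszulD [FiniteDimensional k V] {n : ℕ}
    (z : QuadAlg k I ⊗[k] koszulSpace I (n + 1)) :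
    (koszulSpace I n).subtype.lTensor _ (leftKoszulD k I n z) =
      lkD k I n ((koszulSpace I (n + 1)).subtype.lTensor _ z) := by
  induction z with
  | zero => simp
  | add x y hx hy => simp only [map_add, hx, hy]
  | tmul b x =>
    rw [leftKoszulD_tmul, map_sum, LinearMap.lTensor_tmul, lkD_tmul]
    rfl

end LeftKoszul

/-! ### Comparison with a linear free resolution -/

section LinearResolution

universe u v

variable {k : Type u} {V : Type v} [Field k] [AddCommGroup V] [Module k V]
  {I : Submodule k (V ⊗[k] V)} {ι : ℕ → Type*} [∀ n, DecidableEq (ι n)]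
  (d : (i : ℕ) → (ι (i + 1) →₀ QuadAlg k I) →ₗ[QuadAlg k I] (ι i →₀ QuadAlg k I))
  (ε : (ι 0 →₀ QuadAlg k I) →ₗ[k] k) (c : (i : ℕ) → ι (i + 1) → ι i → V)

open QuadAlg

/-- The tensors in `V^{⊗n}` given by the generators of the `n`-th term of a linear free resolution
whose differentials have the matrix entries `c`. -/
def resVec : (n : ℕ) → ι n → ⨂[k]^n V
  | 0, e => (PiTensorProduct.isEmptyEquiv (Fin 0)).symm (ε (Finsupp.single e 1))
  | n + 1, e => (d n (Finsupp.single e 1)).sum fun e' _ => tcons (c n e e') (resVec n e')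

/-- The linear extension of `resVec`. -/
def resMap (n : ℕ) : (ι n →₀ k) →ₗ[k] ⨂[k]^n V := Finsupp.linearCombination k (resVec d ε c n)

/-- The comparison map from the `n`-th term of a linear free resolution to `B ⊗ V^{⊗n}`. -/
def resTensor (n : ℕ) : (ι n →₀ QuadAlg k I) →ₗ[k] QuadAlg k I ⊗[k] (⨂[k]^n V) :=
  (resMap d ε c n).lTensor _ ∘ₗ
    (TensorProduct.finsuppScalarRight k k (QuadAlg k I) (ι n)).symm.toLinearMap

lemma resTensor_single {n : ℕ} (e : ι n) (b : QuadAlg k I) :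
    resTensor d ε c n (Finsupp.single e b) = b ⊗ₜ resVec d ε c n e := by
  simp [resTensor, resMap]

/-- `resVec` is built from the matrix entries of d, so `resTensor` commutes with the differentials
on generators, and both composites are B-linear. -/
lemma lkD_resTensor (hc : ∀ i e e', gen k I (c i e e') = d i (Finsupp.single e 1) e') {n : ℕ}
    (f : ι (n + 1) →₀ QuadAlg k I) :
    lkD k I n (resTensor d ε c (n + 1) f) = resTensor d ε c n (d n f) := by
  induction f using Finsupp.induction_linear with
  | zero => simp
  | add f g hf hg => simp only [map_add, hf, hg]
  | single e b =>
    have h : Finsupp.single e b = b • Finsupp.single e (1 : QuadAlg k I) := by simp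
    rw [resTensor_single, h, map_smul, resVec]
    conv_rhs => rw [← Finsupp.sum_single (d n (Finsupp.single e 1)), Finsupp.smul_sum]
    rw [Finsupp.sum, Finsupp.sum, TensorProduct.tmul_sum, map_sum, map_sum]
    refine Finset.sum_congr rfl fun e' _ => ?_
    rw [lkD_tmul_tcons, hc, Finsupp.smul_single, resTensor_single, smul_eq_mul]

lemma isEmptyEquiv_augL_resTensor
    (hε : ∀ (b : QuadAlg k I) p, ε (b • p) = aug k I b * ε p) (f : ι 0 →₀ QuadAlg k I) :
    PiTensorProduct.isEmptyEquiv (Fin 0) (augL k I _ (resTensor d ε c 0 f)) = ε f := by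
  induction f using Finsupp.induction_linear with
  | zero => simp
  | add f g hf hg => simp only [map_add, hf, hg]
  | single e b =>
    have h : Finsupp.single e b = b • Finsupp.single e (1 : QuadAlg k I) := by simp
    rw [resTensor_single, h, hε, augL_tmul, resVec, map_smul, LinearEquiv.apply_symm_apply]
    rfl

/-- Minimality of a linear resolution: the coefficients of a boundary are B-multiples of elements of
V, which the augmentation kills. -/
lemma aug_apply_eq_zero_of_linear
    (hlin : ∀ i (e : ι (i + 1)) (e' : ι i),
      d i (Finsupp.single e 1) e' ∈ LinearMap.range (gen k I)) {n : ℕ}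
    (f : ι (n + 1) →₀ QuadAlg k I) (e' : ι n) : aug k I (d n f e') = 0 := by
  induction f using Finsupp.induction_linear with
  | zero => simp
  | add f g hf hg => rw [map_add, Finsupp.add_apply, map_add, hf, hg, add_zero]
  | single e b =>
    have h : Finsupp.single e b = b • Finsupp.single e (1 : QuadAlg k I) := by simp
    obtain ⟨v, hv⟩ := hlin n e e'
    rw [h, map_smul, Finsupp.smul_apply, ← hv, smul_eq_mul, map_mul, aug_gen, mul_zero]

lemma resTensor_injective {n : ℕ} (h : Function.Injective (resMap d ε c n)) :
    Function.Injective (resTensor d ε c n) :=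
  (Module.Flat.lTensor_preserves_injective_linearMap _ h).comp (LinearEquiv.injective _)

/-- The elements of a free module with scalar coefficients. -/
lemma resTensor_scalar {n : ℕ} (x : ι n →₀ k) : resTensor d ε c n
    (TensorProduct.finsuppScalarRight k k (QuadAlg k I) (ι n) (1 ⊗ₜ x)) =
      1 ⊗ₜ resMap d ε c n x := by
  simp [resTensor]

/-- By minimality the augmentation kills every coefficient of a boundary, while on scalar
coefficients it is the identity. -/
lemma eq_zero_of_scalar_mem_range
    (hlin : ∀ i (e : ι (i + 1)) (e' : ι i),
      d i (Finsupp.single e 1) e' ∈ LinearMap.range (gen k I)) {n : ℕ} (x : ι n →₀ k)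
    (f : ι (n + 1) →₀ QuadAlg k I)
    (hf : d n f = TensorProduct.finsuppScalarRight k k (QuadAlg k I) (ι n) (1 ⊗ₜ x)) : x = 0 := by
  ext e
  have h := aug_apply_eq_zero_of_linear d hlin f e
  rw [hf, TensorProduct.finsuppScalarRight_apply_tmul_apply, map_smul, map_one] at h
  simpa using h

lemma augL_resTensor_mem {n : ℕ} (f : ι n →₀ QuadAlg k I) :
    augL k I _ (resTensor d ε c n f) ∈ LinearMap.range (resMap d ε c n) := by
  rw [resTensor, LinearMap.comp_apply, augL_lTensor]
  exact LinearMap.mem_range_self _ _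

/-- In left degree one the hypothesis says that `lkD` agrees on 1 ⊗ x and on the degree zero part of
the image of f. As `lkD` is injective on 1 ⊗ V^{⊗(n+1)}, x is that degree zero part, which lies in
the range of `resMap`. -/
lemma mem_range_resMap_of_lkD_one {n : ℕ} (x : ⨂[k]^(n + 1) V) (f : ι (n + 1) →₀ QuadAlg k I)
    (hf : lkD k I n (resTensor d ε c (n + 1) f) = lkD k I n (1 ⊗ₜ x)) :
    x ∈ LinearMap.range (resMap d ε c (n + 1)) := by
  have h := congrArg (compL k I 1 _) hf
  rw [compL_succ_lkD, compL_succ_lkD, compL_zero, compL_zero, augL_tmul, map_one, one_smul] at h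
  rw [← lkD_one_injective n h]
  exact augL_resTensor_mem d ε c f

variable [FiniteDimensional k V]

/-- The tensor `lkD (1 ⊗ x)` is the sum over a basis of v_i ⊗ (i-th contraction of x). Each
contraction comes from the n-th term of the resolution, so the whole sum lifts. -/
lemma lkD_one_mem_range_resTensor {n : ℕ} (h : LinearMap.range (resMap d ε c n) = koszulSpace I n)
    (x : ⨂[k]^(n + 1) V)
    (hx : ∀ i, contractL ((bas k V).coord i) n x ∈ koszulSpace I n) :
    ∃ f, resTensor d ε c n f = lkD k I n (1 ⊗ₜ x) := by
  rw [← LinearMap.mem_range, lkD_tmul]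
  refine sum_mem fun i _ => ?_
  obtain ⟨y, hy⟩ : contractL ((bas k V).coord i) n x ∈ LinearMap.range (resMap d ε c n) := by
    rw [h]; exact hx i
  refine ⟨TensorProduct.finsuppScalarRight k k (QuadAlg k I) (ι n)
    ((1 * gen k I (bas k V i)) ⊗ₜ y), ?_⟩
  simp [resTensor, hy]

variable (hε : ∀ (b : QuadAlg k I) p, ε (b • p) = aug k I b * ε p)
  (hsurj : Function.Surjective ε) (h0 : Function.Exact (d 0) ε)
  (hd : ∀ i, Function.Exact (d (i + 1)) (d i))
  (hlin : ∀ i (e : ι (i + 1)) (e' : ι i),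
      d i (Finsupp.single e 1) e' ∈ LinearMap.range (gen k I))
  (hc : ∀ i e e', gen k I (c i e e') = d i (Finsupp.single e 1) e')

-- For injectivity, a scalar combination of generators killed by `resMap` lies in the kernel of ε,
-- hence is a boundary, hence vanishes by minimality. For the range, the degree zero part of a lift
-- along ε lies in the range of `resMap`.
include hε hsurj h0 hlin in
lemma resMap_zero_bijective : Function.Injective (resMap d ε c 0) ∧
    LinearMap.range (resMap d ε c 0) = koszulSpace I 0 := by
  constructor
  · rw [injective_iff_map_eq_zero]
    intro x hx
    have h1 := isEmptyEquiv_augL_resTensor d ε c hε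
      (TensorProduct.finsuppScalarRight k k (QuadAlg k I) (ι 0) (1 ⊗ₜ x))
    rw [resTensor_scalar, hx, TensorProduct.tmul_zero, map_zero, map_zero] at h1
    obtain ⟨f, hf⟩ := (h0 _).1 h1.symm
    exact eq_zero_of_scalar_mem_range d hlin x f hf
  · rw [koszulSpace_eq_top (by omega), eq_top_iff]
    intro x _
    obtain ⟨f, hf⟩ := hsurj (PiTensorProduct.isEmptyEquiv (Fin 0) x)
    rw [← isEmptyEquiv_augL_resTensor d ε c hε] at hf
    rw [← LinearEquiv.injective _ hf]
    exact augL_resTensor_mem d ε c f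

-- If `resMap` kills x, then the comparison map in degree n kills d x, so d x = 0. By exactness x is
-- a boundary, and minimality forces x = 0.
include hd hlin hc in
lemma resMap_succ_injective {n : ℕ} (hn : Function.Injective (resMap d ε c n)) :
    Function.Injective (resMap d ε c (n + 1)) := by
  rw [injective_iff_map_eq_zero]
  intro x hx
  have h1 := lkD_resTensor d ε c hc
    (TensorProduct.finsuppScalarRight k k (QuadAlg k I) (ι (n + 1)) (1 ⊗ₜ x))
  rw [resTensor_scalar, hx, TensorProduct.tmul_zero, map_zero] at h1
  obtain ⟨f, hf⟩ := (hd n _).1 (resTensor_injective d ε c hn (h1.symm.trans (map_zero _).symm))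
  exact eq_zero_of_scalar_mem_range d hlin x f hf

/-- By its recursive definition `resVec` in degree n + 1 lies in V tensored with the range in degree
n. -/
lemma contractL_resMap_mem {n : ℕ} (φ : V →ₗ[k] k) (x : ι (n + 1) →₀ k) :
    contractL φ n (resMap d ε c (n + 1) x) ∈ LinearMap.range (resMap d ε c n) := by
  induction x using Finsupp.induction_linear with
  | zero => simp
  | add f g hf hg => rw [map_add, map_add]; exact add_mem hf hg
  | single e b =>
    have h : resMap d ε c (n + 1) (Finsupp.single e b) = b • resVec d ε c (n + 1) e := by
      rw [resMap, Finsupp.linearCombination_single]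
    rw [h, map_smul, resVec, Finsupp.sum, map_sum]
    refine Submodule.smul_mem _ _ (sum_mem fun e' _ => ?_)
    rw [contractL_tcons]
    refine Submodule.smul_mem _ _ ⟨Finsupp.single e' 1, ?_⟩
    rw [resMap, Finsupp.linearCombination_single, one_smul]

include hε hsurj h0 hd hlin hc in
/-- The generators of the `n`-th term of a linear free resolution of `k` form a basis of `D'ₙ`. -/
lemma resMap_bijective (n : ℕ) : (Function.Injective (resMap d ε c n) ∧
    LinearMap.range (resMap d ε c n) = koszulSpace I n) ∧
    (Function.Injective (resMap d ε c (n + 1)) ∧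
    LinearMap.range (resMap d ε c (n + 1)) = koszulSpace I (n + 1)) := by
  -- Two consecutive degrees are carried along, because reaching degree n + 2 uses the range in
  -- degree n + 1 and the injectivity in degree n.
  induction n with
  | zero =>
    have hz := resMap_zero_bijective d ε c hε hsurj h0 hlin
    refine ⟨hz, resMap_succ_injective d ε c hd hlin hc hz.1, ?_⟩
    rw [koszulSpace_eq_top (n := 0 + 1) (by omega), eq_top_iff]
    intro x _
    obtain ⟨f, hf⟩ := lkD_one_mem_range_resTensor d ε c hz.2 x
      (fun i => by rw [koszulSpace_eq_top (by omega)]; exact Submodule.mem_top)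
    -- Here ε measures the part of left degree zero, and a value of `lkD` has none.
    have h1 : ε f = 0 := by
      rw [← isEmptyEquiv_augL_resTensor d ε c hε, hf, augL_lkD, map_zero]
    obtain ⟨g, rfl⟩ := (h0 f).1 h1
    rw [← lkD_resTensor d ε c hc] at hf
    exact mem_range_resMap_of_lkD_one d ε c x g hf
  | succ n ih =>
    refine ⟨ih.2, resMap_succ_injective d ε c hd hlin hc ih.2.1, le_antisymm ?_ ?_⟩
    · rintro _ ⟨x, rfl⟩
      refine mem_koszulSpace_succ_succ.2 ⟨?_, fun i => ?_⟩
      -- The relations hold in the first two factors because two successive differentials of the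
      -- resolution compose to zero.
      · rw [← lkD_lkD_one_eq_zero, ← resTensor_scalar, lkD_resTensor d ε c hc,
          lkD_resTensor d ε c hc, (hd n _).2 ⟨_, rfl⟩, map_zero]
      · rw [← ih.2.2]
        exact contractL_resMap_mem d ε c _ x
    · intro x hx
      obtain ⟨hx0, hx1⟩ := mem_koszulSpace_succ_succ.1 hx
      obtain ⟨f, hf⟩ := lkD_one_mem_range_resTensor d ε c ih.2.2 x hx1
      -- The relations satisfied by the first two factors of x make `lkD` kill `lkD (1 ⊗ x)`.
      -- Injectivity of the comparison map in degree n transfers this to f, which is then a boundary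
      -- by exactness.
      have h1 : d n f = 0 := by
        apply resTensor_injective d ε c ih.1.1
        rw [← lkD_resTensor d ε c hc, hf, (lkD_lkD_one_eq_zero x).2 hx0, map_zero]
      obtain ⟨g, rfl⟩ := (hd n f).1 h1
      rw [← lkD_resTensor d ε c hc] at hf
      exact mem_range_resMap_of_lkD_one d ε c x g hf

variable {d ε c} in
/-- The isomorphism from the `n`-th term of a linear free resolution to `B ⊗ D'ₙ`. -/
def resEquiv {n : ℕ} (h : Function.Injective (resMap d ε c n) ∧
    LinearMap.range (resMap d ε c n) = koszulSpace I n) :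
    (ι n →₀ QuadAlg k I) ≃ₗ[k] QuadAlg k I ⊗[k] koszulSpace I n :=
  (TensorProduct.finsuppScalarRight k k (QuadAlg k I) (ι n)).symm ≪≫ₗ
    TensorProduct.congr (LinearEquiv.refl k _)
      (LinearEquiv.ofInjective (resMap d ε c n) h.1 ≪≫ₗ LinearEquiv.ofEq _ _ h.2)

variable {d ε c} in
lemma lTensor_resEquiv {n : ℕ} (h : Function.Injective (resMap d ε c n) ∧
    LinearMap.range (resMap d ε c n) = koszulSpace I n) (f : ι n →₀ QuadAlg k I) :
    (koszulSpace I n).subtype.lTensor _ (resEquiv h f) = resTensor d ε c n f := by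
  obtain ⟨t, rfl⟩ := (TensorProduct.finsuppScalarRight k k (QuadAlg k I) (ι n)).surjective f
  rw [resEquiv, resTensor]
  simp only [LinearEquiv.trans_apply, LinearMap.comp_apply, LinearEquiv.coe_coe,
    LinearEquiv.symm_apply_apply]
  induction t with
  | zero => simp
  | add x y hx hy => simp only [map_add, hx, hy]
  | tmul b x => rfl

omit [FiniteDimensional k V] in
lemma lTensor_subtype_injective (n : ℕ) :
    Function.Injective ((koszulSpace I n).subtype.lTensor (QuadAlg k I)) :=
  Module.Flat.lTensor_preserves_injective_linearMap _ (Submodule.subtype_injective _)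

variable {d ε c} in
include hc in
lemma leftKoszulD_resEquiv {n : ℕ} (h : Function.Injective (resMap d ε c n) ∧
    LinearMap.range (resMap d ε c n) = koszulSpace I n)
    (h' : Function.Injective (resMap d ε c (n + 1)) ∧
    LinearMap.range (resMap d ε c (n + 1)) = koszulSpace I (n + 1))
    (f : ι (n + 1) →₀ QuadAlg k I) :
    leftKoszulD k I n (resEquiv h' f) = resEquiv h (d n f) := by
  apply lTensor_subtype_injective
  rw [lTensor_subtype_leftKoszulD, lTensor_resEquiv, lTensor_resEquiv, lkD_resTensor d ε c hc]

end LinearResolution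

/-! ### Exactness of the left Koszul complex -/

section LeftKoszulExact

universe u v

variable {k : Type u} {V : Type v} [Field k] [AddCommGroup V] [Module k V]
  {I : Submodule k (V ⊗[k] V)} [FiniteDimensional k V]

/-- The left Koszul complex of a Koszul algebra is exact. -/
theorem leftKoszulD_exact (hB : IsKoszul k I) :
    (∀ n, Function.Exact (leftKoszulD k I (n + 1)) (leftKoszulD k I n)) ∧
      Function.Exact (leftKoszulD k I 0) (augL k I (koszulSpace I 0)) := by
  obtain ⟨ι, d, ε, hε, hsurj, h0, hd, hlin⟩ := hB
  classical
  -- The vectors `c` are the matrix entries of the differentials. With them `resEquiv` identifies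
  -- the given resolution with the left Koszul complex, and exactness is carried across.
  choose c hc using hlin
  have hlin : ∀ i (e : ι (i + 1)) (e' : ι i),
      d i (Finsupp.single e 1) e' ∈ LinearMap.range (QuadAlg.gen k I) :=
    fun i e e' => ⟨c i e e', hc i e e'⟩
  have hbij := fun n => (resMap_bijective d ε c hε hsurj h0 hd hlin hc n).1
  refine ⟨fun n z => ?_, fun z => ?_⟩
  · obtain ⟨f, rfl⟩ := (resEquiv (hbij (n + 1))).surjective z
    rw [leftKoszulD_resEquiv hc (hbij n), LinearEquiv.map_eq_zero_iff, hd n f]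
    constructor
    · rintro ⟨g, rfl⟩
      exact ⟨resEquiv (hbij (n + 2)) g, leftKoszulD_resEquiv hc _ _ g⟩
    · rintro ⟨w, hw⟩
      obtain ⟨g, rfl⟩ := (resEquiv (hbij (n + 2))).surjective w
      rw [leftKoszulD_resEquiv hc (hbij (n + 1))] at hw
      exact ⟨g, LinearEquiv.injective _ hw⟩
  · obtain ⟨f, rfl⟩ := (resEquiv (hbij 0)).surjective z
    have h1 : augL k I _ (resEquiv (hbij 0) f) = 0 ↔ ε f = 0 := by
      rw [← isEmptyEquiv_augL_resTensor d ε c hε, ← lTensor_resEquiv (hbij 0), augL_lTensor,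
        LinearEquiv.map_eq_zero_iff, Submodule.subtype_apply, ZeroMemClass.coe_eq_zero]
    rw [h1, h0 f]
    constructor
    · rintro ⟨g, rfl⟩
      exact ⟨resEquiv (hbij 1) g, leftKoszulD_resEquiv hc _ _ g⟩
    · rintro ⟨w, hw⟩
      obtain ⟨g, rfl⟩ := (resEquiv (hbij 1)).surjective w
      rw [leftKoszulD_resEquiv hc (hbij 0)] at hw
      exact ⟨g, LinearEquiv.injective _ hw⟩

end LeftKoszulExact

/-! ### Appending a factor -/

section Snoc

variable {k M R : Type*} [CommRing k] [AddCommGroup M] [Module k M] [AddCommGroup R] [Module k R]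

/-- The map `M^{⊗n} ⊗ R → R^{⊗(n+1)}`, `(m₁ ⊗ ⋯ ⊗ mₙ) ⊗ r ↦ g m₁ ⊗ ⋯ ⊗ g mₙ ⊗ r`. -/
def snocMap (g : M →ₗ[k] R) : (n : ℕ) → (⨂[k]^n M) ⊗[k] R →ₗ[k] ⨂[k]^(n + 1) R
  | 0 => (consE k R 0).toLinearMap ∘ₗ (TensorProduct.comm k (⨂[k]^0 R) R).toLinearMap ∘ₗ
      (PiTensorProduct.map fun _ => g).rTensor R
  | n + 1 => (consE k R (n + 1)).toLinearMap ∘ₗ TensorProduct.map g (snocMap g n) ∘ₗ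
      (TensorProduct.assoc k M (⨂[k]^n M) R).toLinearMap ∘ₗ
        (consE k M n).symm.toLinearMap.rTensor R

lemma snocMap_zero (g : M →ₗ[k] R) (x : ⨂[k]^0 M) (r : R) :
    snocMap g 0 (x ⊗ₜ r) = tcons r (PiTensorProduct.map (fun _ => g) x) := rfl

lemma snocMap_tcons (g : M →ₗ[k] R) {n : ℕ} (m : M) (x : ⨂[k]^n M) (r : R) :
    snocMap g (n + 1) (tcons m x ⊗ₜ r) = tcons (g m) (snocMap g n (x ⊗ₜ r)) := by
  simp [snocMap, consE_tmul]

lemma isEmptyEquiv_map (g : M →ₗ[k] R) (x : ⨂[k]^0 M) :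
    PiTensorProduct.isEmptyEquiv (Fin 0) (PiTensorProduct.map (fun _ => g) x) =
      PiTensorProduct.isEmptyEquiv (Fin 0) x := by
  obtain ⟨c, rfl⟩ := (PiTensorProduct.isEmptyEquiv (R := k) (s := fun _ : Fin 0 => M)
    (Fin 0)).symm.surjective x
  rw [LinearEquiv.apply_symm_apply, PiTensorProduct.isEmptyEquiv_symm_apply, map_smul,
    PiTensorProduct.map_tprod, map_smul]
  simp

/-- Both empty tensor powers are k, and the induced map is the identity of k whatever g is. -/
lemma map_zero_bijective (g : M →ₗ[k] R) : Function.Bijective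
    (PiTensorProduct.map (fun _ : Fin 0 => g) : (⨂[k]^0 M) →ₗ[k] ⨂[k]^0 R) := by
  have h : (PiTensorProduct.isEmptyEquiv (Fin 0) : (⨂[k]^0 R) ≃ₗ[k] k) ∘
      (PiTensorProduct.map (fun _ : Fin 0 => g) : (⨂[k]^0 M) →ₗ[k] ⨂[k]^0 R) =
      (PiTensorProduct.isEmptyEquiv (Fin 0) : (⨂[k]^0 M) ≃ₗ[k] k) :=
    funext fun x => isEmptyEquiv_map g x
  rw [← (PiTensorProduct.isEmptyEquiv (Fin 0) : (⨂[k]^0 R) ≃ₗ[k] k).bijective.of_comp_iff', h]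
  exact LinearEquiv.bijective _

lemma snocMap_id_bijective (n : ℕ) : Function.Bijective (snocMap (LinearMap.id : M →ₗ[k] M) n) := by
  induction n with
  | zero =>
    exact ((consE k M 0).bijective.comp (TensorProduct.comm k (⨂[k]^0 M) M).bijective).comp
      ((TensorProduct.congr (LinearEquiv.ofBijective _ (map_zero_bijective LinearMap.id))
        (LinearEquiv.refl k M)).bijective)
  | succ n ih =>
    exact (consE k M (n + 1)).bijective.comp
      ((TensorProduct.congr (LinearEquiv.refl k M) (LinearEquiv.ofBijective _ ih)).bijective.comp
        ((TensorProduct.assoc k M (⨂[k]^n M) M).bijective.comp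
          (TensorProduct.congr (consE k M n).symm (LinearEquiv.refl k M)).bijective))

end Snoc

section SnocField

variable {k M R : Type*} [Field k] [AddCommGroup M] [Module k M] [AddCommGroup R] [Module k R]

/-- Over a field the tensor product of injective maps is injective. For the embedding of V in B this
shows that B ⊗ D'_n ⊗ B really embeds in the bar term, where D_n is defined as a span. -/
lemma snocMap_injective (g : M →ₗ[k] R) (hg : Function.Injective g) (n : ℕ) :
    Function.Injective (snocMap g n) := by
  induction n with
  | zero =>
    exact ((consE k R 0).injective.comp (TensorProduct.comm k (⨂[k]^0 R) R).injective).comp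
      (Module.Flat.rTensor_preserves_injective_linearMap _ (map_zero_bijective g).1)
  | succ n ih =>
    exact (consE k R (n + 1)).injective.comp
      ((TensorProduct.map_injective_of_flat_flat _ _ hg ih).comp
        ((TensorProduct.assoc k M (⨂[k]^n M) R).injective.comp
          (TensorProduct.congr (consE k M n).symm (LinearEquiv.refl k R)).injective))

end SnocField

/-- From d(a ⊗ x) = a x - a ⊗ d x and left linearity, d d(a ⊗ x) = a d x - (a d x - a ⊗ d d x), and
the remaining term vanishes by induction. -/
lemma barD_barD {k A : Type*} [CommRing k] [Ring A] [Algebra k A] {n : ℕ} (x : ⨂[k]^(n + 3) A) :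
    barD k A n (barD k A (n + 1) x) = 0 := by
  induction n with
  | zero =>
    induction x using tcons_induction with
    | h0 => simp only [map_zero]
    | ha x y hx hy => simp only [map_add, hx, hy, add_zero]
    | hc a x => rw [barD_succ_tcons, map_sub, barD_lmulHom, barD_zero_tcons, sub_self]
  | succ n ih =>
    induction x using tcons_induction with
    | h0 => simp only [map_zero]
    | ha x y hx hy => simp only [map_add, hx, hy, add_zero]
    | hc a x =>
      rw [barD_succ_tcons, map_sub, barD_lmulHom, barD_succ_tcons, ih, tcons_zero, sub_zero,
        sub_self]

/-! ### Exactness of the Koszul resolution -/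

section KoszulExact

universe u v

variable {k : Type u} {V : Type v} [Field k] [AddCommGroup V] [Module k V]
  {I : Submodule k (V ⊗[k] V)}

open QuadAlg

lemma emb_eq_snocMap {n : ℕ} (x : ⨂[k]^n V) (b : QuadAlg k I) :
    emb k I n x b = snocMap (gen k I) n (x ⊗ₜ b) := by
  induction n with
  | zero => rfl
  | succ n ih =>
    induction x using tcons_induction with
    | h0 => simp
    | ha x y hx hy => simp only [map_add, LinearMap.add_apply, TensorProduct.add_tmul, hx, hy]
    | hc v y => rw [emb_tcons, snocMap_tcons, ih]

variable (k I) in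
/-- The embedding `B ⊗ (D'ₙ ⊗ B) → B^{⊗(n+2)}`. -/
def koszulIncl (n : ℕ) : QuadAlg k I ⊗[k] (koszulSpace I n ⊗[k] QuadAlg k I) →ₗ[k]
    ⨂[k]^(n + 2) (QuadAlg k I) :=
  (consE k (QuadAlg k I) (n + 1)).toLinearMap ∘ₗ
    (snocMap (gen k I) n ∘ₗ (koszulSpace I n).subtype.rTensor _).lTensor _

lemma koszulIncl_tmul {n : ℕ} (a b : QuadAlg k I) (x : koszulSpace I n) :
    koszulIncl k I n (a ⊗ₜ (x ⊗ₜ b)) = tcons a (emb k I n x b) := by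
  rw [emb_eq_snocMap]
  rfl

lemma koszulIncl_injective (n : ℕ) : Function.Injective (koszulIncl k I n) :=
  (consE k (QuadAlg k I) (n + 1)).injective.comp
    (Module.Flat.lTensor_preserves_injective_linearMap _
      ((snocMap_injective _ gen_injective n).comp
        (Module.Flat.rTensor_preserves_injective_linearMap _ (Submodule.subtype_injective _))))

lemma range_koszulIncl (n : ℕ) : LinearMap.range (koszulIncl k I n) = koszulSub k I n := by
  apply le_antisymm
  · rintro _ ⟨z, rfl⟩
    induction z with
    | zero => simp
    | add x y hx hy => rw [map_add]; exact add_mem hx hy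
    | tmul a t =>
      induction t with
      | zero => simp
      | add x y hx hy => rw [TensorProduct.tmul_add, map_add]; exact add_mem hx hy
      | tmul x b => rw [koszulIncl_tmul]; exact tcons_emb_mem a b x.2
  · rw [koszulSub, Submodule.span_le]
    rintro _ ⟨a, b, x, hx, rfl⟩
    exact ⟨a ⊗ₜ (⟨x, hx⟩ ⊗ₜ b), koszulIncl_tmul a b ⟨x, hx⟩⟩

variable (k I) in
/-- The isomorphism `B ⊗ (D'ₙ ⊗ B) ≃ Dₙ`. -/
def koszulEquiv (n : ℕ) : QuadAlg k I ⊗[k] (koszulSpace I n ⊗[k] QuadAlg k I) ≃ₗ[k]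
    KoszulTerm k I n :=
  LinearEquiv.ofInjective _ (koszulIncl_injective n) ≪≫ₗ LinearEquiv.ofEq _ _ (range_koszulIncl n)

lemma incl_koszulEquiv {n : ℕ} (z : QuadAlg k I ⊗[k] (koszulSpace I n ⊗[k] QuadAlg k I)) :
    KoszulTerm.incl n (koszulEquiv k I n z) = koszulIncl k I n z := rfl

section

variable {M : Type*} [AddCommMonoid M] [Module k M]

lemma compL_lTensor {N : Type*} [AddCommMonoid N] [Module k N] (f : M →ₗ[k] N) (m : ℕ)
    (z : QuadAlg k I ⊗[k] M) :
    compL k I m _ (f.lTensor _ z) = f.lTensor _ (compL k I m _ z) := by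
  induction z with
  | zero => simp only [map_zero]
  | add x y hx hy => simp only [map_add, hx, hy]
  | tmul b x => rfl

end

variable [FiniteDimensional k V]

variable (k I) in
/-- The part `a ⊗ (v ⊗ x) ⊗ b ↦ a v ⊗ x ⊗ b` of the differential of the Koszul resolution. -/
def koszulDL (n : ℕ) : QuadAlg k I ⊗[k] (koszulSpace I (n + 1) ⊗[k] QuadAlg k I) →ₗ[k]
    QuadAlg k I ⊗[k] (koszulSpace I n ⊗[k] QuadAlg k I) :=
  (TensorProduct.assoc k _ _ _).toLinearMap ∘ₗ (leftKoszulD k I n).rTensor _ ∘ₗ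
    (TensorProduct.assoc k _ _ _).symm.toLinearMap

lemma koszulDL_tmul {n : ℕ} (a b : QuadAlg k I) (x : koszulSpace I (n + 1)) :
    koszulDL k I n (a ⊗ₜ (x ⊗ₜ b)) =
      ∑ i, (a * gen k I (bas k V i)) ⊗ₜ (contractLK k I ((bas k V).coord i) n x ⊗ₜ b) := by
  simp [koszulDL, leftKoszulD_tmul, TensorProduct.sum_tmul, map_sum]

variable (k I) in
/-- The map `D'ₙ₊₁ ⊗ B → D'ₙ ⊗ B`, `(x ⊗ v) ⊗ b ↦ ± x ⊗ v b`. -/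
def rightKoszulD (n : ℕ) : koszulSpace I (n + 1) ⊗[k] QuadAlg k I →ₗ[k]
    koszulSpace I n ⊗[k] QuadAlg k I :=
  -(-1 : k) ^ n • ∑ i, TensorProduct.map (contractRK k I ((bas k V).coord i) n)
    (LinearMap.mulLeft k (gen k I (bas k V i)))

variable (k I) in
/-- The differential of the Koszul resolution on `B ⊗ (D'ₙ₊₁ ⊗ B)`. -/
def koszulD (n : ℕ) : QuadAlg k I ⊗[k] (koszulSpace I (n + 1) ⊗[k] QuadAlg k I) →ₗ[k]
    QuadAlg k I ⊗[k] (koszulSpace I n ⊗[k] QuadAlg k I) :=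
  koszulDL k I n + (rightKoszulD k I n).lTensor _

/-- On D'_{n+1} every inner multiplication of the bar differential vanishes because of the relations
(`barD_emb`). Only the first multiplication, which is `koszulDL`, and the last one, which is
`rightKoszulD` with its sign, remain. -/
lemma koszulEquiv_koszulD {n : ℕ}
    (z : QuadAlg k I ⊗[k] (koszulSpace I (n + 1) ⊗[k] QuadAlg k I)) :
    koszulEquiv k I n (koszulD k I n z) = KoszulTerm.d k I n (koszulEquiv k I (n + 1) z) := by
  apply KoszulTerm.incl_injective
  rw [KoszulTerm.incl_d, incl_koszulEquiv, incl_koszulEquiv]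
  induction z with
  | zero => simp only [map_zero]
  | add x y hx hy => simp only [map_add, hx, hy]
  | tmul a t =>
    induction t with
    | zero => simp only [map_zero, TensorProduct.tmul_zero]
    | add x y hx hy => simp only [map_add, TensorProduct.tmul_add, hx, hy]
    | tmul x b =>
      rw [koszulIncl_tmul, barD_succ_tcons, barD_emb b x.2, koszulD, LinearMap.add_apply, map_add,
        koszulDL_tmul, map_sum, sub_eq_add_neg]
      congr 1
      · conv_rhs => rw [← sum_tcons_contractL (x : ⨂[k]^(n + 1) V), map_sum, LinearMap.sum_apply,
          map_sum]
        refine Finset.sum_congr rfl fun i _ => ?_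
        rw [koszulIncl_tmul, emb_tcons, lmulHom_tcons]
        rfl
      · rw [LinearMap.lTensor_tmul, rightKoszulD, LinearMap.smul_apply, TensorProduct.tmul_smul,
          map_smul, neg_smul, tcons_smul, lastMul, tcons_sum, LinearMap.sum_apply,
          TensorProduct.tmul_sum, map_sum]
        congr 2
        refine Finset.sum_congr rfl fun i _ => ?_
        rw [TensorProduct.map_tmul, koszulIncl_tmul]
        rfl

/-- Inherited from the bar complex, in which the Koszul complex is a subcomplex. -/
lemma koszulD_koszulD {n : ℕ} (z : QuadAlg k I ⊗[k] (koszulSpace I (n + 2) ⊗[k] QuadAlg k I)) :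
    koszulD k I n (koszulD k I (n + 1) z) = 0 := by
  apply (koszulEquiv k I n).injective
  apply KoszulTerm.incl_injective
  rw [koszulEquiv_koszulD, koszulEquiv_koszulD, KoszulTerm.incl_d, KoszulTerm.incl_d, barD_barD,
    map_zero, map_zero]

lemma aug_d (y : KoszulTerm k I 1) : KoszulTerm.aug k I (KoszulTerm.d k I 0 y) = 0 := by
  rw [KoszulTerm.aug_apply, KoszulTerm.incl_d, barAug, LinearMap.comp_apply, barD_barD, map_zero]

/-- The left part of the differential raises the left degree by one. The right part does not touch
the first factor (`compL_lTensor`). The descent below rests on this contrast. -/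
lemma compL_succ_koszulDL (m n : ℕ)
    (z : QuadAlg k I ⊗[k] (koszulSpace I (n + 1) ⊗[k] QuadAlg k I)) :
    compL k I (m + 1) _ (koszulDL k I n z) = koszulDL k I n (compL k I m _ z) := by
  induction z with
  | zero => simp only [map_zero]
  | add x y hx hy => simp only [map_add, hx, hy]
  | tmul a t =>
    induction t with
    | zero => simp only [map_zero, TensorProduct.tmul_zero]
    | add x y hx hy => simp only [map_add, TensorProduct.tmul_add, hx, hy]
    | tmul x b => simp only [koszulDL_tmul, compL_tmul, map_sum, comp_succ_mul_gen]

lemma compL_zero_koszulDL (n : ℕ)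
    (z : QuadAlg k I ⊗[k] (koszulSpace I (n + 1) ⊗[k] QuadAlg k I)) :
    compL k I 0 _ (koszulDL k I n z) = 0 := by
  induction z with
  | zero => simp only [map_zero]
  | add x y hx hy => simp only [map_add, hx, hy, add_zero]
  | tmul a t =>
    induction t with
    | zero => simp only [map_zero, TensorProduct.tmul_zero]
    | add x y hx hy => simp only [map_add, TensorProduct.tmul_add, hx, hy, add_zero]
    | tmul x b =>
      simp only [koszulDL_tmul, compL_tmul, map_sum, comp_zero_mul_gen, TensorProduct.zero_tmul,
        Finset.sum_const_zero]

/-- Up to reassociation this is the left Koszul complex tensored on the right with the vector space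
B. -/
lemma koszulDL_exact (hB : IsKoszul k I) (n : ℕ) :
    Function.Exact (koszulDL k I (n + 1)) (koszulDL k I n) :=
  Function.Exact.of_ladder_linearEquiv_of_exact (e₁ := TensorProduct.assoc k _ _ _)
    (e₂ := TensorProduct.assoc k _ _ _) (e₃ := TensorProduct.assoc k _ _ _)
    (LinearMap.ext fun z => by simp [koszulDL]) (LinearMap.ext fun z => by simp [koszulDL])
    (Module.Flat.rTensor_exact (QuadAlg k I) ((leftKoszulD_exact hB).1 n))

lemma koszulDL_zero_exact (hB : IsKoszul k I) :
    Function.Exact (koszulDL k I 0) (augL k I (koszulSpace I 0 ⊗[k] QuadAlg k I)) :=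
  Function.Exact.of_ladder_linearEquiv_of_exact (e₁ := TensorProduct.assoc k _ _ _)
    (e₂ := TensorProduct.assoc k _ _ _) (e₃ := LinearEquiv.refl k _)
    (LinearMap.ext fun z => by simp [koszulDL])
    (TensorProduct.ext (TensorProduct.ext' fun a x => LinearMap.ext fun b => by
      simp [augL_tmul, TensorProduct.smul_tmul']))
    (Module.Flat.rTensor_exact (QuadAlg k I) (leftKoszulD_exact hB).2)

/-- A part of top left degree `M` which is a boundary for `koszulDL` can be removed by subtracting a
boundary. -/
lemma exists_koszulD_compL {n M : ℕ} (z : QuadAlg k I ⊗[k] (koszulSpace I n ⊗[k] QuadAlg k I))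
    (hz : ∀ m, M + 1 ≤ m → compL k I m _ z = 0)
    (hM : ∃ w, koszulDL k I n w = compL k I M _ z) :
    ∃ w, ∀ m, M ≤ m → compL k I m _ (z - koszulD k I n w) = 0 := by
  obtain ⟨w, hw⟩ := hM
  cases M with
  | zero =>
    -- Values of `koszulDL` have no part of left degree zero, so here the degree zero part of z
    -- vanishes and nothing has to be subtracted.
    refine ⟨0, fun m _ => ?_⟩
    rw [map_zero, sub_zero]
    rcases Nat.eq_zero_or_pos m with rfl | hm
    · have h := congrArg (compL k I 0 _) hw
      rw [compL_compL, if_pos rfl, compL_zero_koszulDL] at h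
      exact h.symm
    · exact hz m hm
  | succ M =>
    -- Only the part of w of degree M is used. Its boundary then has parts in degree M + 1,
    -- cancelling the top part of z, and in degree M, where nothing is demanded.
    refine ⟨compL k I M _ w, fun m hm => ?_⟩
    have h1 : koszulDL k I n (compL k I M _ w) = compL k I (M + 1) _ z := by
      rw [← compL_succ_koszulDL, hw, compL_compL, if_pos rfl]
    rw [koszulD, LinearMap.add_apply, h1, map_sub, map_add, compL_compL, compL_lTensor, compL_compL,
      if_neg (by omega : m ≠ M), map_zero, add_zero]
    split_ifs with h
    · rw [h, sub_self]
    · rw [hz m (by omega), sub_zero]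

/-- Descent on a bound M for the left degree of the cycle: its top part is a cycle for `koszulDL`,
hence a boundary for it, and subtracting a boundary for `koszulD` lowers the bound. -/
lemma koszulD_exact (hB : IsKoszul k I) (n : ℕ) :
    Function.Exact (koszulD k I (n + 1)) (koszulD k I n) := by
  intro z
  refine ⟨fun hz => ?_, fun ⟨w, hw⟩ => by rw [← hw, koszulD_koszulD]⟩
  obtain ⟨M, hM⟩ := exists_compL_eq_zero z
  induction M generalizing z with
  | zero => exact ⟨0, by rw [map_zero, eq_zero_of_compL z fun m => hM m (Nat.zero_le m)]⟩
  | succ M ih =>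
    -- In left degree M + 1 the equation d z = 0 involves only the left part applied to the
    -- component of degree M, since z has no component of degree M + 1.
    have h1 : koszulDL k I n (compL k I M _ z) = 0 := by
      have h2 := congrArg (compL k I (M + 1) _) hz
      rw [koszulD, LinearMap.add_apply, map_add, compL_succ_koszulDL, compL_lTensor,
        hM _ le_rfl, map_zero, map_zero, add_zero] at h2
      exact h2
    obtain ⟨w, hw⟩ := exists_koszulD_compL z hM ((koszulDL_exact hB n _).1 h1)
    obtain ⟨w', hw'⟩ := ih (z - koszulD k I (n + 1) w)
      (by rw [map_sub, hz, koszulD_koszulD, sub_zero]) hw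
    exact ⟨w' + w, by rw [map_add, hw', sub_add_cancel]⟩

omit [FiniteDimensional k V] in
lemma aug_koszulEquiv (a b : QuadAlg k I) (x : koszulSpace I 0) :
    KoszulTerm.aug k I (koszulEquiv k I 0 (a ⊗ₜ (x ⊗ₜ b))) =
      PiTensorProduct.isEmptyEquiv (Fin 0) (x : ⨂[k]^0 V) • (a * b) := by
  rw [KoszulTerm.aug_apply, incl_koszulEquiv, koszulIncl_tmul, emb_zero, barAug_tcons]
  congr 1
  exact isEmptyEquiv_map _ _

-- On 1 ⊗ D'_0 ⊗ B, where D'_0 = k, the augmentation is an isomorphism onto B.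
omit [FiniteDimensional k V] in
lemma aug_koszulEquiv_one (t : koszulSpace I 0 ⊗[k] QuadAlg k I)
    (ht : KoszulTerm.aug k I (koszulEquiv k I 0 (1 ⊗ₜ t)) = 0) : t = 0 := by
  let e : koszulSpace I 0 ≃ₗ[k] k :=
    LinearEquiv.ofTop (koszulSpace I 0) (koszulSpace_eq_top (by omega)) ≪≫ₗ
      PiTensorProduct.isEmptyEquiv (Fin 0)
  have h : ∀ t, KoszulTerm.aug k I (koszulEquiv k I 0 (1 ⊗ₜ t)) =
      (TensorProduct.congr e (LinearEquiv.refl k _) ≪≫ₗ TensorProduct.lid k (QuadAlg k I)) t := by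
    intro t
    induction t with
    | zero => simp only [TensorProduct.tmul_zero, map_zero]
    | add x y hx hy => simp only [TensorProduct.tmul_add, map_add, hx, hy]
    | tmul x b =>
      rw [aug_koszulEquiv, one_mul]
      rfl
  rw [h, LinearEquiv.map_eq_zero_iff] at ht
  exact ht

/-- The Koszul resolution of a Koszul algebra is exact. -/
theorem koszulTerm_exact (hB : IsKoszul k I) :
    (∀ n, Function.Exact (KoszulTerm.d k I (n + 1)) (KoszulTerm.d k I n)) ∧
      Function.Exact (KoszulTerm.d k I 0) (KoszulTerm.aug k I) ∧
      Function.Surjective (KoszulTerm.aug k I) := by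
  refine ⟨fun n => ?_, fun y => ?_, fun b => ?_⟩
  · exact Function.Exact.of_ladder_linearEquiv_of_exact (e₁ := koszulEquiv k I (n + 2))
      (e₂ := koszulEquiv k I (n + 1)) (e₃ := koszulEquiv k I n)
      (LinearMap.ext fun z => (koszulEquiv_koszulD z).symm)
      (LinearMap.ext fun z => (koszulEquiv_koszulD z).symm) (koszulD_exact hB n)
  · refine ⟨fun hy => ?_, fun ⟨w, hw⟩ => by rw [← hw, aug_d]⟩
    obtain ⟨z, rfl⟩ := (koszulEquiv k I 0).surjective y
    suffices h : ∃ w, koszulD k I 0 w = z by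
      obtain ⟨w, rfl⟩ := h
      exact ⟨koszulEquiv k I 1 w, (koszulEquiv_koszulD w).symm⟩
    obtain ⟨M, hM⟩ := exists_compL_eq_zero z
    -- The descent is the same as before, but it stops at left degree zero, because `koszulDL` is
    -- exact at D_0 only on the kernel of `augL`. Hence the bound M + 1 in place of M.
    have key : ∀ M z, KoszulTerm.aug k I (koszulEquiv k I 0 z) = 0 →
        (∀ m, M + 1 ≤ m → compL k I m _ z = 0) → ∃ w, koszulD k I 0 w = z := by
      clear hM hy z M
      intro M
      induction M with
      | zero =>
        intro z hz hM
        -- An element concentrated in left degree zero has the form 1 ⊗ t, and the augmentation is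
        -- injective on such elements.
        have h1 : z = 1 ⊗ₜ augL k I _ z := by
          rw [← sub_eq_zero]
          refine eq_zero_of_compL _ fun m => ?_
          rw [← compL_zero, map_sub, compL_compL]
          split_ifs with h
          · rw [h, sub_self]
          · rw [hM m (by omega), sub_zero]
        rw [h1] at hz
        have h2 := aug_koszulEquiv_one _ hz
        exact ⟨0, by rw [map_zero, h1, h2, TensorProduct.tmul_zero]⟩
      | succ M ih =>
        intro z hz hM
        -- A part of positive left degree is killed by `augL`, so the exactness of the augmented
        -- left complex applies to it.
        have h1 : augL k I _ (compL k I (M + 1) _ z) = 0 := by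
          clear hM hz
          induction z with
          | zero => simp only [map_zero]
          | add x y hx hy => simp only [map_add, hx, hy, add_zero]
          | tmul b x => rw [compL_tmul, augL_tmul, aug_comp b (by omega), zero_smul]
        obtain ⟨w, hw⟩ := exists_koszulD_compL z hM ((koszulDL_zero_exact hB _).1 h1)
        obtain ⟨w', hw'⟩ := ih (z - koszulD k I 0 w)
          (by rw [map_sub, map_sub, hz, koszulEquiv_koszulD, aug_d, sub_zero]) hw
        exact ⟨w' + w, by rw [map_add, hw', sub_add_cancel]⟩
    exact key M z hy fun m hm => hM m (by omega)
  · refine ⟨koszulEquiv k I 0 (1 ⊗ₜ (⟨(PiTensorProduct.isEmptyEquiv (Fin 0)).symm 1, ?_⟩ ⊗ₜ b)), ?_⟩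
    · rw [koszulSpace_eq_top (by omega)]; exact Submodule.mem_top
    · rw [aug_koszulEquiv, LinearEquiv.apply_symm_apply, one_smul, one_mul]

end KoszulExact

/-! ### The rows of the double complex -/

namespace Smash

variable {k H B : Type*} [CommRing k] [Ring H] [HopfAlgebra k H] [Ring B] [Algebra k B]
  [Module H B] [IsScalarTower k H B] [IsModuleAlgebra k H B]

lemma mk_mul_inr (b : B) (h g : H) : mk k b h * inr k B H g = mk k b (h * g) := by
  rw [← inl_mul_inr, mul_assoc, ← map_mul, inl_mul_inr]

lemma inl_mul_mk (b c : B) (h : H) : inl k B H b * mk k c h = mk k (b * c) h := by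
  rw [← inl_mul_inr, ← mul_assoc, ← map_mul, inl_mul_inr]

end Smash

namespace IndLeft

section

variable {k H B C C' : Type*} [CommRing k] [Ring H] [HopfAlgebra k H] [Ring B] [Algebra k B]
  [Module H B] [IsScalarTower k H B] [IsModuleAlgebra k H B]
  [AddCommGroup C] [Module k C] [Module H C] [AddCommGroup C'] [Module k C'] [Module H C']

lemma tmul_mk (b : B) (h : H) (x : C) : (BTensor.tmul k H (Smash.mk k b h) x : IndLeft k B H C) =
    BTensor.tmul k H (Smash.inl k B H b) (h • x) := by
  rw [← BTensor.op_smul_tmul, Smash.smul_right_def, Smash.inl_mul_inr]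

-- As b # h = b h in A, the factor h can be moved across the tensor product over H, so the elements
-- b ⊗ x span: A ⊗_H C is B ⊗ C.
@[elab_as_elim]
lemma induction_inl {p : IndLeft k B H C → Prop} (x : IndLeft k B H C) (h0 : p 0)
    (ha : ∀ x y, p x → p y → p (x + y))
    (hm : ∀ (b : B) (x : C), p (BTensor.tmul k H (Smash.inl k B H b) x)) : p x := by
  induction x using BTensor.induction with
  | h0 => exact h0
  | ha x y hx hy => exact ha x y hx hy
  | hm a x =>
    induction a using Smash.induction with
    | h0 =>
      have : (BTensor.tmul k H (0 : Smash k B H) x : IndLeft k B H C) = 0 := by simp [BTensor.tmul]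
      rw [this]
      exact h0
    | ha a a' h h' => rw [BTensor.add_tmul]; exact ha _ _ h h'
    | hm b h => rw [tmul_mk]; exact hm b _

variable [IsScalarTower k H C]

variable (B) in
/-- The map `A ⊗_H C ≅ B ⊗ C → B ⊗ C' ≅ A ⊗_H C'` given by a linear map `C → C'`. -/
def extend (s : C →ₗ[k] C') : IndLeft k B H C →ₗ[k] IndLeft k B H C' :=
  BTensor.lift k H
    (BTensor.proj k H (Smash k B H) C' ∘ₗ
      TensorProduct.map (Smash.inl k B H).toLinearMap
        (s ∘ₗ TensorProduct.lift (Algebra.lsmul k k C : H →ₐ[k] _).toLinearMap) ∘ₗ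
      (TensorProduct.assoc k B H C).toLinearMap ∘ₗ (Smash.equiv k B H).toLinearMap.rTensor C)
    fun a r x => by
      induction a using Smash.induction with
      | h0 => simp only [smul_zero, TensorProduct.zero_tmul, map_zero]
      | ha a a' h h' => simp only [smul_add, TensorProduct.add_tmul, map_add, h, h']
      | hm b h =>
        rw [Smash.smul_right_def, Smash.mk_mul_inr]
        simp [Smash.equiv_mk]

lemma extend_mk (s : C →ₗ[k] C') (b : B) (h : H) (x : C) :
    extend B s (BTensor.tmul k H (Smash.mk k b h) x) =
      BTensor.tmul k H (Smash.inl k B H b) (s (h • x)) := by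
  rw [extend, BTensor.lift_tmul]
  simp [Smash.equiv_mk, BTensor.proj_tmul]

lemma extend_inl (s : C →ₗ[k] C') (b : B) (x : C) :
    extend B s (BTensor.tmul k H (Smash.inl k B H b) x) =
      BTensor.tmul k H (Smash.inl k B H b) (s x) := by
  rw [Smash.inl_apply, extend_mk, one_smul, Smash.inl_apply]

variable [Module Hᵐᵒᵖ C] [IsScalarTower k Hᵐᵒᵖ C] [SMulCommClass H Hᵐᵒᵖ C]
  [Module Hᵐᵒᵖ C'] [IsScalarTower k H C'] [IsScalarTower k Hᵐᵒᵖ C'] [SMulCommClass H Hᵐᵒᵖ C']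
  [HopfBimodule k H C] [HopfBimodule k H C']

open HopfBimodule

/-- In terms of B ⊗ C the right action of A is expressed by the coaction and the right H-action on C
alone. Compatibility of `s` with these two suffices; no left H-linearity is needed, and a
contraction of the bar resolution would not have it. -/
lemma extend_op_smul (s : C →ₗ[k] C') (hr : ∀ (h : H) x, s (op h • x) = op h • s x)
    (hc : ∀ x, coact (s x) = s.lTensor H (coact x)) (a : Smash k B H) (p : IndLeft k B H C) :
    extend B s (op a • p) = op a • extend B s p := by
  have h1 : ∀ (h : H) (p : IndLeft k B H C), extend B s (op (Smash.inr k B H h) • p) =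
      op (Smash.inr k B H h) • extend B s p := by
    intro h p
    induction p using induction_inl with
    | h0 => simp only [smul_zero, map_zero]
    | ha x y hx hy => simp only [smul_add, map_add, hx, hy]
    | hm b x => rw [op_inr_smul, extend_inl, extend_inl, op_inr_smul, hr]
  have h2 : ∀ (b : B) (p : IndLeft k B H C), extend B s (op (Smash.inl k B H b) • p) =
      op (Smash.inl k B H b) • extend B s p := by
    intro b p
    induction p using induction_inl with
    | h0 => simp only [smul_zero, map_zero]
    | ha x y hx hy => simp only [smul_add, map_add, hx, hy]
    | hm c x =>
      rw [op_inl_smul, extend_inl, op_inl_smul, hc]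
      generalize coact (k := k) (H := H) x = t
      induction t with
      | zero => simp only [map_zero]
      | add x y hx hy => simp only [map_add, hx, hy]
      | tmul g x => rw [twist_tmul, ← map_mul, extend_inl, LinearMap.lTensor_tmul, twist_tmul, map_mul]
  induction a using Smash.induction with
  | h0 => simp only [MulOpposite.op_zero, zero_smul, map_zero]
  | ha x y hx hy => simp only [MulOpposite.op_add, add_smul, map_add, hx, hy]
  | hm b h => rw [op_mk_smul, op_mk_smul, h1, h2]

end

end IndLeft

/-! ### The contraction of the bar resolution of a Hopf algebra -/

namespace BarTerm

variable (k H : Type*) [CommRing k] [Ring H] [HopfAlgebra k H]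

/-- The contraction `x ↦ 1 ⊗ x` of the bar resolution. -/
def cons (n : ℕ) : BarTerm k H n →ₗ[k] BarTerm k H (n + 1) :=
  (consE k H (n + 2)).toLinearMap ∘ₗ TensorProduct.mk k H (⨂[k]^(n + 2) H) 1

/-- The element `1 ⊗ 1`. -/
def oneOne : BarTerm k H 0 :=
  tcons (1 : H) (tcons (1 : H) ((PiTensorProduct.isEmptyEquiv (Fin 0)).symm 1))

variable {k H}

lemma cons_op_smul {n : ℕ} (h : H) (x : BarTerm k H n) :
    cons k H n (op h • x) = op h • cons k H n x := (rmulHom_succ_tcons _ _ _).symm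

lemma prep_one {n : ℕ} (t : H ⊗[k] (⨂[k]^n H)) : prep k H n (1 ⊗ₜ 1) t =
    ((consE k H n).toLinearMap ∘ₗ TensorProduct.mk k H (⨂[k]^n H) 1).lTensor H t := by
  induction t with
  | zero => simp only [map_zero]
  | add x y hx hy => simp only [map_add, hx, hy]
  | tmul g y => rw [prep_tmul, one_mul]; rfl

/-- Prepending 1 is colinear because 1 is grouplike. -/
lemma coact_cons {n : ℕ} (x : BarTerm k H n) :
    HopfBimodule.coact (cons k H n x) = (cons k H n).lTensor H (HopfBimodule.coact x) := by
  refine (tpCoact_tcons 1 x).trans ?_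
  rw [Bialgebra.comul_one, Algebra.TensorProduct.one_def]
  exact prep_one _

lemma coact_oneOne : HopfBimodule.coact (oneOne k H) = (1 : H) ⊗ₜ[k] oneOne k H := by
  refine (tpCoact_tcons 1 _).trans ?_
  rw [tpCoact_tcons, tpCoact_zero, Bialgebra.comul_one, Algebra.TensorProduct.one_def, prep_tmul,
    prep_tmul, one_mul, one_mul]
  rfl

lemma op_smul_oneOne (h : H) : op h • oneOne k H =
    tcons (1 : H) (tcons h ((PiTensorProduct.isEmptyEquiv (Fin 0)).symm 1)) := by
  refine (rmulHom_succ_tcons _ _ _).trans ?_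
  rw [rmulHom_zero_tcons, one_mul]

lemma d_cons {n : ℕ} (x : BarTerm k H (n + 1)) :
    d k H (n + 1) (cons k H (n + 1) x) = x - cons k H n (d k H n x) := by
  refine (barD_succ_tcons (1 : H) x).trans ?_
  rw [map_one]
  rfl

lemma tcons_oneE (y : ⨂[k]^1 H) :
    tcons (oneE k H y) ((PiTensorProduct.isEmptyEquiv (Fin 0)).symm 1) = y := by
  induction y using tcons_induction with
  | h0 => simp [zero_tcons]
  | ha x y hx hy => rw [map_add, add_tcons, hx, hy]
  | hc m c =>
    have h : ∀ a : k, tcons (a • m) ((PiTensorProduct.isEmptyEquiv (R := k)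
        (s := fun _ : Fin 0 => H) (Fin 0)).symm 1) =
        tcons m ((PiTensorProduct.isEmptyEquiv (Fin 0)).symm a) := fun a => by
      rw [tcons, TensorProduct.smul_tmul, ← map_smul, smul_eq_mul, mul_one, consE_tmul]
    rw [oneE_tcons, h, LinearEquiv.symm_apply_apply]

/-- The correction term 1 ⊗ ε(x) is written as the right action of ε(x) on 1 ⊗ 1, a form that makes
sense again for the right action of A. -/
lemma d_cons_zero (x : BarTerm k H 0) :
    d k H 0 (cons k H 0 x) = x - op (aug k H x) • oneOne k H := by
  rw [op_smul_oneOne]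
  refine (barD_succ_tcons (1 : H) x).trans ?_
  have h := tcons_oneE (barD k H 0 x)
  rw [map_one]
  exact congrArg (fun y : ⨂[k]^1 H => x - (show BarTerm k H 0 from tcons (1 : H) y)) h.symm

lemma d_d {n : ℕ} (x : BarTerm k H (n + 2)) : d k H n (d k H (n + 1) x) = 0 := barD_barD _

lemma aug_d (x : BarTerm k H 1) : aug k H (d k H 0 x) = 0 :=
  (congrArg (oneE k H) (barD_barD x)).trans (map_zero _)

lemma aug_oneOne : aug k H (oneOne k H) = 1 := by
  refine (barAug_tcons _ _ _).trans ?_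
  rw [LinearEquiv.apply_symm_apply, one_smul, one_mul]

end BarTerm

/-! ### The contraction of A ⊗_H C_• over A by right A-linear maps -/

section Rows

universe u v w

variable (k : Type u) {V : Type v} (H : Type w) [Field k] [AddCommGroup V] [Module k V]
  [Ring H] [HopfAlgebra k H] (I : Submodule k (V ⊗[k] V))
  [Module H (QuadAlg k I)] [IsScalarTower k H (QuadAlg k I)] [IsModuleAlgebra k H (QuadAlg k I)]

/-- The contraction of `A ⊗_H C_• → A`, a map of right `A`-modules. -/
def leftHtpy (i : ℕ) : LeftTerm k H I i →ₗ[k] LeftTerm k H I (i + 1) :=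
  IndLeft.extend (QuadAlg k I) (BarTerm.cons k H i)

/-- The preimage of `1` under the augmentation `A ⊗_H C_0 → A`. -/
def leftOne : LeftTerm k H I 0 := BTensor.tmul k H (Smash.inl k (QuadAlg k I) H 1) (BarTerm.oneOne k H)

variable {k H I}

lemma leftHtpy_op_smul (i : ℕ) (a : SmashAlg k H I) (p : LeftTerm k H I i) :
    leftHtpy k H I i (op a • p) = op a • leftHtpy k H I i p :=
  IndLeft.extend_op_smul _ BarTerm.cons_op_smul BarTerm.coact_cons a p

lemma leftD_tmul {i : ℕ} (a : SmashAlg k H I) (x : BarTerm k H (i + 1)) :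
    leftD k H I i (BTensor.tmul k H a x) = BTensor.tmul k H a (BarTerm.d k H i x) := rfl

lemma tmul_sub {i : ℕ} (a : SmashAlg k H I) (x y : BarTerm k H i) :
    (BTensor.tmul k H a (x - y) : LeftTerm k H I i) = BTensor.tmul k H a x - BTensor.tmul k H a y := by
  simp [BTensor.tmul, TensorProduct.tmul_sub]

/-- On the spanning elements b ⊗ x both maps act on x only, and the identity is that of the bar
resolution of H. -/
lemma leftD_leftHtpy {i : ℕ} (p : LeftTerm k H I (i + 1)) :
    leftD k H I (i + 1) (leftHtpy k H I (i + 1) p) + leftHtpy k H I i (leftD k H I i p) = p := by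
  induction p using IndLeft.induction_inl with
  | h0 => simp only [map_zero, add_zero]
  | ha x y hx hy =>
    simp only [map_add]
    rw [add_add_add_comm, hx, hy]
  | hm b x =>
    rw [leftHtpy, IndLeft.extend_inl, leftD_tmul, leftD_tmul, leftHtpy, IndLeft.extend_inl,
      BarTerm.d_cons, tmul_sub, sub_add_cancel]

lemma op_smul_leftOne (b : QuadAlg k I) (h : H) : op (Smash.mk k b h) • leftOne k H I =
    BTensor.tmul k H (Smash.inl k (QuadAlg k I) H b) (op h • BarTerm.oneOne k H) := by
  rw [IndLeft.op_mk_smul, leftOne, IndLeft.op_inl_smul, BarTerm.coact_oneOne, IndLeft.twist_tmul,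
    IndLeft.op_inr_smul, one_smul, map_one, one_mul]

/-- The section a ↦ `leftOne` · a of the augmentation is right A-linear, so this homotopy can be
tensored over A with any left module. -/
lemma leftD_leftHtpy_zero (p : LeftTerm k H I 0) :
    leftD k H I 0 (leftHtpy k H I 0 p) + op (leftAug k H I p) • leftOne k H I = p := by
  induction p using IndLeft.induction_inl with
  | h0 => simp only [map_zero, MulOpposite.op_zero, zero_smul, add_zero]
  | ha x y hx hy =>
    simp only [map_add, MulOpposite.op_add, add_smul]
    rw [add_add_add_comm, hx, hy]
  | hm b x =>
    rw [leftHtpy, IndLeft.extend_inl, leftD_tmul, BarTerm.d_cons_zero, tmul_sub, leftAug_tmul,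
      Smash.inl_mul_inr, op_smul_leftOne, sub_add_cancel]

lemma leftAug_leftOne : leftAug k H I (leftOne k H I) = 1 := by
  rw [leftOne, leftAug_tmul, BarTerm.aug_oneOne, map_one, map_one, one_mul]

lemma leftD_leftD {i : ℕ} (p : LeftTerm k H I (i + 2)) :
    leftD k H I i (leftD k H I (i + 1) p) = 0 := by
  induction p using BTensor.induction with
  | h0 => simp only [map_zero]
  | ha x y hx hy => simp only [map_add, hx, hy, add_zero]
  | hm a x =>
    rw [leftD_tmul, leftD_tmul, BarTerm.d_d]
    simp [BTensor.tmul]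

lemma leftAug_leftD (p : LeftTerm k H I 1) : leftAug k H I (leftD k H I 0 p) = 0 := by
  induction p using BTensor.induction with
  | h0 => simp only [map_zero]
  | ha x y hx hy => simp only [map_add, hx, hy, add_zero]
  | hm a x => rw [leftD_tmul, leftAug_tmul, BarTerm.aug_d, map_zero, mul_zero]

end Rows

/-! ### The column `D_• ⊗_B A` -/

namespace IndRight

section

variable (k B H D : Type*) [CommRing k] [Ring B] [Algebra k B] [Ring H] [HopfAlgebra k H]
  [Module H B] [IsScalarTower k H B] [IsModuleAlgebra k H B]
  [AddCommGroup D] [Module k D] [Module Bᵐᵒᵖ D] [IsScalarTower k Bᵐᵒᵖ D]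

/-- The map `D ⊗ B → D` given by the right action. -/
def actR : D ⊗[k] B →ₗ[k] D :=
  TensorProduct.lift (((Algebra.lsmul k k D : Bᵐᵒᵖ →ₐ[k] _).toLinearMap ∘ₗ
    (MulOpposite.opLinearEquiv k).toLinearMap).flip)

variable {k B D} in
lemma actR_tmul (y : D) (b : B) : actR k B D (y ⊗ₜ b) = op b • y := rfl

/-- The map `D ⊗_B A → D ⊗ H`, `y ⊗ (b # h) ↦ y b ⊗ h`. -/
def toTensor : IndRight k B H D →ₗ[k] D ⊗[k] H :=
  BTensor.lift k B ((actR k B D).rTensor H ∘ₗ (TensorProduct.assoc k D B H).symm.toLinearMap ∘ₗ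
      (Smash.equiv k B H).toLinearMap.lTensor D) fun y r a => by
    induction a using Smash.induction with
    | h0 => simp only [smul_zero, TensorProduct.tmul_zero, map_zero]
    | ha a a' h h' => simp only [smul_add, TensorProduct.tmul_add, map_add, h, h']
    | hm b h =>
      rw [Smash.smul_left_def, Smash.inl_mul_mk]
      simp [Smash.equiv_mk, actR_tmul, mul_smul]

variable {k B H D}

lemma toTensor_mk (y : D) (b : B) (h : H) :
    toTensor k B H D (BTensor.tmul k B y (Smash.mk k b h)) = (op b • y) ⊗ₜ h := by
  rw [toTensor, BTensor.lift_tmul]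
  simp [Smash.equiv_mk, actR_tmul]

lemma tmul_mk (y : D) (b : B) (h : H) :
    (BTensor.tmul k B y (Smash.mk k b h) : IndRight k B H D) =
      BTensor.tmul k B (op b • y) (Smash.inr k B H h) := by
  rw [BTensor.op_smul_tmul, Smash.smul_left_def, Smash.inl_mul_inr]

@[elab_as_elim]
lemma induction_inr {p : IndRight k B H D → Prop} (x : IndRight k B H D) (h0 : p 0)
    (ha : ∀ x y, p x → p y → p (x + y))
    (hm : ∀ (y : D) (h : H), p (BTensor.tmul k B y (Smash.inr k B H h))) : p x := by
  induction x using BTensor.induction with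
  | h0 => exact h0
  | ha x y hx hy => exact ha x y hx hy
  | hm y a =>
    induction a using Smash.induction with
    | h0 =>
      have : (BTensor.tmul k B y (0 : Smash k B H) : IndRight k B H D) = 0 := by simp [BTensor.tmul]
      rw [this]
      exact h0
    | ha a a' h h' => rw [BTensor.tmul_add]; exact ha _ _ h h'
    | hm b h => rw [tmul_mk]; exact hm _ h

lemma toTensor_inr (y : D) (h : H) :
    toTensor k B H D (BTensor.tmul k B y (Smash.inr k B H h)) = y ⊗ₜ h := by
  rw [Smash.inr_apply, toTensor_mk, MulOpposite.op_one, one_smul]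

variable (k B H D) in
/-- The isomorphism `D ⊗_B A ≃ D ⊗ H`. -/
def equivTensor : IndRight k B H D ≃ₗ[k] D ⊗[k] H :=
  LinearEquiv.ofLinearMap (toTensor k B H D)
    (BTensor.proj k B D (Smash k B H) ∘ₗ (Smash.inr k B H).toLinearMap.lTensor D)
    (TensorProduct.ext' fun y h => toTensor_inr y h)
    (LinearMap.ext fun x => by
      induction x using induction_inr with
      | h0 => simp only [map_zero]
      | ha x y hx hy => simp only [map_add, hx, hy]
      | hm y h =>
        rw [LinearMap.comp_apply, toTensor_inr]
        rfl)

lemma equivTensor_inr (y : D) (h : H) :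
    equivTensor k B H D (BTensor.tmul k B y (Smash.inr k B H h)) = y ⊗ₜ h := toTensor_inr y h

/-- Naturality of D ⊗_B A ≅ D ⊗ H in D, through which exactness of a complex of bimodules D passes
to D ⊗_B A. -/
lemma rTensor_comp_equivTensor {D' : Type*} [AddCommGroup D'] [Module k D'] [Module Bᵐᵒᵖ D']
    [IsScalarTower k Bᵐᵒᵖ D'] (f : D →ₗ[k] D') (hr : ∀ (b : B) y, f (op b • y) = op b • f y) :
    f.rTensor H ∘ₗ (equivTensor k B H D).toLinearMap =
      (equivTensor k B H D').toLinearMap ∘ₗ map H f hr :=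
  LinearMap.ext fun x => by
    induction x using induction_inr with
    | h0 => simp only [map_zero]
    | ha x y hx hy => simp only [map_add, hx, hy]
    | hm y h =>
      simp only [LinearMap.comp_apply, LinearEquiv.coe_coe]
      rw [map, BTensor.map_tmul, LinearMap.id_apply, equivTensor_inr, equivTensor_inr,
        LinearMap.rTensor_tmul]

end

end IndRight

instance KoszulTerm.isScalarTower_op {k V : Type*} [Field k] [AddCommGroup V] [Module k V]
    (I : Submodule k (V ⊗[k] V)) (n : ℕ) :
    IsScalarTower k (QuadAlg k I)ᵐᵒᵖ (KoszulTerm k I n) where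
  smul_assoc c b y := LinearMap.congr_fun (map_smul (KoszulTerm.rightHom n) c b) y

section Column

universe u v w

variable {k : Type u} {V : Type v} {H : Type w} [Field k] [AddCommGroup V] [Module k V]
  [FiniteDimensional k V] [Ring H] [HopfAlgebra k H] {I : Submodule k (V ⊗[k] V)}
  [Module H V] [IsScalarTower k H V]
  [Module H (QuadAlg k I)] [IsScalarTower k H (QuadAlg k I)] [IsModuleAlgebra k H (QuadAlg k I)]
  [IsGradedAction k H I]

/-- The column is the Koszul resolution of B tensored with the vector space H. -/
lemma rightD_exact (hB : IsKoszul k I) (j : ℕ) :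
    Function.Exact (rightD k H I (j + 1)) (rightD k H I j) :=
  (Function.Exact.iff_of_ladder_linearEquiv
    (IndRight.rTensor_comp_equivTensor _ KoszulTerm.d_op_smul)
    (IndRight.rTensor_comp_equivTensor _ KoszulTerm.d_op_smul)).1
    (Module.Flat.rTensor_exact H ((koszulTerm_exact hB).1 j))

omit [FiniteDimensional k V] in
lemma rTensor_aug_comp_equivTensor : (KoszulTerm.aug k I).rTensor H ∘ₗ
      (IndRight.equivTensor k (QuadAlg k I) H (KoszulTerm k I 0)).toLinearMap =
    (Smash.equiv k (QuadAlg k I) H).toLinearMap ∘ₗ rightAug k H I :=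
  LinearMap.ext fun x => by
    induction x using IndRight.induction_inr with
    | h0 => simp only [map_zero]
    | ha x y hx hy => simp only [map_add, hx, hy]
    | hm y h =>
      simp only [LinearMap.comp_apply, LinearEquiv.coe_coe]
      rw [IndRight.equivTensor_inr, rightAug_tmul, Smash.inl_mul_inr, Smash.equiv_mk,
        LinearMap.rTensor_tmul]

lemma rightAug_exact (hB : IsKoszul k I) :
    Function.Exact (rightD k H I 0) (rightAug k H I) :=
  (Function.Exact.iff_of_ladder_linearEquiv
    (IndRight.rTensor_comp_equivTensor _ KoszulTerm.d_op_smul) rTensor_aug_comp_equivTensor).1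
    (Module.Flat.rTensor_exact H (koszulTerm_exact hB).2.1)

lemma rightAug_surjective (hB : IsKoszul k I) : Function.Surjective (rightAug k H I) := by
  have h : Function.Surjective ((Smash.equiv k (QuadAlg k I) H).toLinearMap ∘ₗ rightAug k H I) := by
    rw [← rTensor_aug_comp_equivTensor, LinearMap.coe_comp]
    exact (LinearMap.rTensor_surjective H (koszulTerm_exact hB).2.2).comp (LinearEquiv.surjective _)
  intro a
  obtain ⟨x, hx⟩ := h (Smash.equiv k (QuadAlg k I) H a)
  exact ⟨x, (Smash.equiv k (QuadAlg k I) H).injective hx⟩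

end Column

/-! ### A double complex with exact augmented rows -/

section DoubleComplex

variable {X : ℕ → ℕ → Type*} {E : ℕ → Type*} [∀ i j, AddCommGroup (X i j)]
  [∀ j, AddCommGroup (E j)] (h : ∀ i j, X (i + 1) j →+ X i j) (v : ∀ i j, X i (j + 1) →+ X i j)
  (η : ∀ j, X 0 j →+ E j) (δ : ∀ j, E (j + 1) →+ E j)

/-- If the rows of a double complex are exact and augmented to a complex `E`, a total cycle
whose image in `E` is a boundary is a total boundary. -/
lemma exists_total_boundary (hh : ∀ i j x, h i j x = 0 → ∃ y, h (i + 1) j y = x)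
    (hη : ∀ j x, η j x = 0 → ∃ y, h 0 j y = x) (hηs : ∀ j, Function.Surjective (η j))
    (hv : ∀ i j x, h i j (v (i + 1) j x) = -v i j (h i (j + 1) x))
    (vv : ∀ i j x, v i j (v i (j + 1) x) = 0)
    (ηv : ∀ j x, η j (v 0 j x) = δ j (η (j + 1) x)) (n : ℕ)
    (z : ∀ i j, i + j = n → X i j)
    (hz : ∀ i j (e : i + j + 1 = n),
      h i j (z (i + 1) j (by omega)) + v i j (z i (j + 1) (by omega)) = 0)
    (hE : ∀ j (e : 0 + j = n), ∃ y, δ j y = η j (z 0 j e)) :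
    ∃ w : ∀ i j, i + j = n + 1 → X i j, ∀ i j (e : i + j = n),
      h i j (w (i + 1) j (by omega)) + v i j (w i (j + 1) (by omega)) = z i j e := by
  -- The chain w is built one column at a time. The first clause records that the image of its
  -- column i = 0 in E is a correct primitive of the image of z; the second is the required equation
  -- in the columns below m.
  suffices key : ∀ m, ∃ w : ∀ i j, i + j = n + 1 → X i j,
      (∀ j (e : 0 + j = n), η j (v 0 j (w 0 (j + 1) (by omega))) = η j (z 0 j e)) ∧
      ∀ i j (e : i + j = n), i < m →
        h i j (w (i + 1) j (by omega)) + v i j (w i (j + 1) (by omega)) = z i j e by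
    obtain ⟨w, -, hw⟩ := key (n + 1)
    exact ⟨w, fun i j e => hw i j e (by omega)⟩
  intro m
  induction m with
  | zero =>
    -- The primitive in E given by `hE` is lifted along the surjection η.
    have h1 : ∀ j (e : 0 + j = n), ∃ y, η j (v 0 j y) = η j (z 0 j e) := fun j e => by
      obtain ⟨y, hy⟩ := hE j e
      obtain ⟨x, rfl⟩ := hηs _ y
      exact ⟨x, by rw [ηv, hy]⟩
    choose y hy using h1
    -- Only column 0 matters at this stage. The zeros are placeholders: entries with i > 0 are
    -- overwritten later, and the position (0, 0) does not occur, since i + j = n + 1.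
    refine ⟨fun i j e => match i, j, e with
      | 0, j + 1, e => y j (by omega)
      | _, _, _ => 0, fun j e => hy j e, fun i j e hi => absurd hi (by omega)⟩
  | succ m ih =>
    obtain ⟨w, hw0, hw⟩ := ih
    -- The equation in column m prescribes h u. It is solvable since the prescribed value lies in
    -- the kernel of η when m = 0, by the first clause, and otherwise in the kernel of h: there h(z
    -- - v w) = h z + v h w = h z + v(z - v w) = h z + v z = 0.
    have h1 : ∀ j (e : m + j = n), ∃ u : X (m + 1) j,
        h m j u = z m j e - v m j (w m (j + 1) (by omega)) := by
      intro j e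
      cases m with
      | zero =>
        apply hη
        rw [map_sub, hw0 j e, sub_self]
      | succ i =>
        apply hh
        rw [map_sub, hv, eq_sub_of_add_eq (hw i (j + 1) (by omega) (by omega)), map_sub, vv,
          sub_zero, sub_neg_eq_add, hz i j (by omega)]
    choose u hu using h1
    -- Only column m + 1 is replaced, and the earlier equations involve only columns up to m.
    let w' : ∀ i j, i + j = n + 1 → X i j := fun i j e =>
      if hi : i = m + 1 then hi ▸ u j (by omega) else w i j e
    have hw' : ∀ i j e, i ≠ m + 1 → w' i j e = w i j e := fun i j e hi => dif_neg hi
    have hu' : ∀ j (e : m + j = n), w' (m + 1) j (by omega) = u j e := fun j e => dif_pos rfl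
    refine ⟨w', fun j e => ?_, fun i j e hi => ?_⟩
    · rw [hw' _ _ _ (by omega), hw0]
    · rcases Nat.lt_succ_iff_lt_or_eq.1 hi with hi | rfl
      · rw [hw' _ _ _ (by omega), hw' _ _ _ (by omega), hw i j e hi]
      · rw [hu' j e, hw' _ _ _ (by omega), hu, sub_add_cancel]

end DoubleComplex

/-! ### Exactness of the total complex -/

section Total

universe u v w

variable {k : Type u} {V : Type v} {H : Type w} [Field k] [AddCommGroup V] [Module k V]
  [Ring H] [HopfAlgebra k H] {I : Submodule k (V ⊗[k] V)}
  [Module H V] [IsScalarTower k H V]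
  [Module H (QuadAlg k I)] [IsScalarTower k H (QuadAlg k I)] [IsModuleAlgebra k H (QuadAlg k I)]
  [IsGradedAction k H I]

variable (k H I) in
/-- The contraction of the rows of the double complex. -/
def rowHtpy (i j : ℕ) : XTerm k H I i j →ₗ[k] XTerm k H I (i + 1) j :=
  BimodTensor.mapAux (leftHtpy k H I i) (leftHtpy_op_smul i) LinearMap.id fun _ _ => rfl

lemma rowHtpy_tmul {i j : ℕ} (p : LeftTerm k H I i) (q : RightTerm k H I j) :
    rowHtpy k H I i j (BimodTensor.tmul k _ p q) = BimodTensor.tmul k _ (leftHtpy k H I i p) q := rfl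

variable (k H I) in
/-- The augmentation `X_{0,j} → D_j ⊗_B A` of the rows of the double complex. -/
def rowAug (j : ℕ) : XTerm k H I 0 j →ₗ[k] RightTerm k H I j :=
  BimodTensor.lift
    ((Algebra.lsmul k k (RightTerm k H I j) : SmashAlg k H I →ₐ[k] _).toLinearMap ∘ₗ leftAug k H I)
    fun p a q => by
      simp only [LinearMap.comp_apply, AlgHom.toLinearMap_apply, Algebra.lsmul_coe,
        leftAug_op_smul, mul_smul]

lemma rowAug_tmul {j : ℕ} (p : LeftTerm k H I 0) (q : RightTerm k H I j) :
    rowAug k H I j (BimodTensor.tmul k _ p q) = leftAug k H I p • q := rfl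

lemma rowAug_surjective (j : ℕ) : Function.Surjective (rowAug k H I j) := fun q =>
  ⟨BimodTensor.tmul k _ (leftOne k H I) q, by rw [rowAug_tmul, leftAug_leftOne, one_smul]⟩

/-- The augmentation of X_{0,0} factors through the edge column D_0 ⊗_B A, which reduces exactness
at A to the row and column augmentations. -/
lemma augZero_eq (x : XTerm k H I 0 0) : augZero k H I x = rightAug k H I (rowAug k H I 0 x) := by
  induction x using BimodTensor.induction with
  | h0 => simp only [map_zero]
  | ha x y hx hy => simp only [map_add, hx, hy]
  | hm p q =>
    rw [rowAug_tmul, rightAug_smul]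
    rfl

lemma add_tmul {i j : ℕ} (p p' : LeftTerm k H I i) (q : RightTerm k H I j) :
    (BimodTensor.tmul k (SmashAlg k H I) (p + p') q : XTerm k H I i j) =
      BimodTensor.tmul k _ p q + BimodTensor.tmul k _ p' q := BTensor.add_tmul k _ p p' q

lemma zero_tmul {i j : ℕ} (q : RightTerm k H I j) :
    (BimodTensor.tmul k (SmashAlg k H I) (0 : LeftTerm k H I i) q : XTerm k H I i j) = 0 := by
  simp [BimodTensor.tmul, BTensor.tmul]
  rfl

lemma tmul_zero {i j : ℕ} (p : LeftTerm k H I i) :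
    (BimodTensor.tmul k (SmashAlg k H I) p (0 : RightTerm k H I j) : XTerm k H I i j) = 0 := by
  simp [BimodTensor.tmul, BTensor.tmul]
  rfl

variable [FiniteDimensional k V]

lemma horD_tmul {i j : ℕ} (p : LeftTerm k H I (i + 1)) (q : RightTerm k H I j) :
    horD k H I i j (BimodTensor.tmul k _ p q) = BimodTensor.tmul k _ (leftD k H I i p) q := rfl

lemma verD_tmul {i j : ℕ} (p : LeftTerm k H I i) (q : RightTerm k H I (j + 1)) :
    verD k H I i j (BimodTensor.tmul k _ p q) =
      (-1 : ℤ) ^ i • BimodTensor.tmul k _ p (rightD k H I j q) := rfl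

/-- The contraction of A ⊗_H C_• is right A-linear, so it is defined on the tensor product over A
and contracts every row. -/
lemma horD_rowHtpy {i j : ℕ} (x : XTerm k H I (i + 1) j) :
    horD k H I (i + 1) j (rowHtpy k H I (i + 1) j x) + rowHtpy k H I i j (horD k H I i j x) = x := by
  induction x using BimodTensor.induction with
  | h0 => simp only [map_zero, add_zero]
  | ha x y hx hy =>
    simp only [map_add]
    rw [add_add_add_comm, hx, hy]
  | hm p q =>
    rw [rowHtpy_tmul, horD_tmul, horD_tmul, rowHtpy_tmul, ← add_tmul, leftD_leftHtpy]

lemma horD_exists_of_eq_zero (i j : ℕ) (x : XTerm k H I (i + 1) j) (hx : horD k H I i j x = 0) :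
    ∃ y, horD k H I (i + 1) j y = x :=
  ⟨rowHtpy k H I (i + 1) j x, by
    have h := horD_rowHtpy x
    rwa [hx, map_zero, add_zero] at h⟩

/-- The term (`leftOne` · a) ⊗ q with a = ε(p) equals `leftOne` ⊗ a q, so the homotopy is from the
identity to a section of the row augmentation composed with that augmentation. -/
lemma horD_rowHtpy_zero {j : ℕ} (x : XTerm k H I 0 j) :
    horD k H I 0 j (rowHtpy k H I 0 j x) +
      BimodTensor.tmul k _ (leftOne k H I) (rowAug k H I j x) = x := by
  induction x using BimodTensor.induction with
  | h0 => simp only [map_zero, tmul_zero, add_zero]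
  | ha x y hx hy =>
    have h : ∀ q q' : RightTerm k H I j,
        (BimodTensor.tmul k (SmashAlg k H I) (leftOne k H I) (q + q') : XTerm k H I 0 j) =
        BimodTensor.tmul k _ (leftOne k H I) q + BimodTensor.tmul k _ (leftOne k H I) q' :=
      BTensor.tmul_add k _ _
    simp only [map_add, h]
    rw [add_add_add_comm, hx, hy]
  | hm p q =>
    have h : (BimodTensor.tmul k (SmashAlg k H I) (leftOne k H I) (leftAug k H I p • q) :
        XTerm k H I 0 j) = BimodTensor.tmul k _ (op (leftAug k H I p) • leftOne k H I) q :=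
      (BTensor.op_smul_tmul k _ _ _ _).symm
    rw [rowHtpy_tmul, horD_tmul, rowAug_tmul, h, ← add_tmul, leftD_leftHtpy_zero]

lemma horD_exists_of_rowAug_eq_zero (j : ℕ) (x : XTerm k H I 0 j) (hx : rowAug k H I j x = 0) :
    ∃ y, horD k H I 0 j y = x :=
  ⟨rowHtpy k H I 0 j x, by
    have h := horD_rowHtpy_zero x
    rwa [hx, tmul_zero, add_zero] at h⟩

lemma horD_horD {i j : ℕ} (x : XTerm k H I (i + 2) j) :
    horD k H I i j (horD k H I (i + 1) j x) = 0 := by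
  induction x using BimodTensor.induction with
  | h0 => simp only [map_zero]
  | ha x y hx hy => simp only [map_add, hx, hy, add_zero]
  | hm p q => rw [horD_tmul, horD_tmul, leftD_leftD, zero_tmul]

lemma rowAug_horD {j : ℕ} (x : XTerm k H I 1 j) : rowAug k H I j (horD k H I 0 j x) = 0 := by
  induction x using BimodTensor.induction with
  | h0 => simp only [map_zero]
  | ha x y hx hy => simp only [map_add, hx, hy, add_zero]
  | hm p q => rw [horD_tmul, rowAug_tmul, leftAug_leftD, zero_smul]

/-- The two tensor differentials commute, and the sign (-1)^i changes between columns i and i + 1.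
-/
lemma horD_verD (i j : ℕ) (x : XTerm k H I (i + 1) (j + 1)) :
    horD k H I i j (verD k H I (i + 1) j x) = -verD k H I i j (horD k H I i (j + 1) x) := by
  induction x using BimodTensor.induction with
  | h0 => simp only [map_zero, neg_zero]
  | ha x y hx hy => simp only [map_add, hx, hy, neg_add]
  | hm p q =>
    rw [verD_tmul, map_zsmul, horD_tmul, horD_tmul, verD_tmul, pow_succ, mul_neg_one, neg_smul]

lemma rowAug_verD (j : ℕ) (x : XTerm k H I 0 (j + 1)) :
    rowAug k H I j (verD k H I 0 j x) = rightD k H I j (rowAug k H I (j + 1) x) := by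
  induction x using BimodTensor.induction with
  | h0 => simp only [map_zero]
  | ha x y hx hy => simp only [map_add, hx, hy]
  | hm p q => rw [verD_tmul, pow_zero, one_smul, rowAug_tmul, rowAug_tmul, rightD_smul]

lemma verD_verD (hB : IsKoszul k I) (i j : ℕ) (x : XTerm k H I i (j + 2)) :
    verD k H I i j (verD k H I i (j + 1) x) = 0 := by
  induction x using BimodTensor.induction with
  | h0 => simp only [map_zero]
  | ha x y hx hy => simp only [map_add, hx, hy, add_zero]
  | hm p q =>
    rw [verD_tmul, map_zsmul, verD_tmul, (rightD_exact hB j).apply_apply_eq_zero, tmul_zero,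
      smul_zero, smul_zero]

lemma ofTerm_apply {n : ℕ} (i j : ℕ) (e : i + j = n) (x : XTerm k H I i j) :
    ofTerm k H I i j e x ⟨(i, j), e⟩ = x := DirectSum.lof_apply _ _ _

lemma ofTerm_apply_of_ne {n : ℕ} (i j : ℕ) (e : i + j = n) (x : XTerm k H I i j) (i' j' : ℕ)
    (e' : i' + j' = n) (h : i ≠ i') : ofTerm k H I i j e x ⟨(i', j'), e'⟩ = 0 :=
  DirectSum.of_eq_of_ne _ _ _ fun h' => h (congrArg (fun p => p.1.1) h').symm

@[elab_as_elim]
lemma XTotal.induction {n : ℕ} {p : XTotal k H I n → Prop} (x : XTotal k H I n) (h0 : p 0)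
    (ha : ∀ x y, p x → p y → p (x + y))
    (hm : ∀ i j e (y : XTerm k H I i j), p (ofTerm k H I i j e y)) : p x :=
  DirectSum.induction_on x h0 (fun ⟨(i, j), e⟩ y => hm i j e y) ha

lemma totalD_ofTerm {n : ℕ} (i j : ℕ) (e : i + j = n + 1) (y : XTerm k H I i j) :
    totalD k H I n (ofTerm k H I i j e y) = horPart k H I n i j e y + verPart k H I n i j e y := by
  rw [totalD, ofTerm, DirectSum.toModule_lof, LinearMap.add_apply]

lemma horPart_apply {n : ℕ} (a b : ℕ) (e : a + b = n + 1) (y : XTerm k H I a b) (i j : ℕ)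
    (e' : i + j = n) : horPart k H I n a b e y ⟨(i, j), e'⟩ =
      horD k H I i j (ofTerm k H I a b e y ⟨(i + 1, j), by omega⟩) := by
  cases a with
  | zero =>
    rw [ofTerm_apply_of_ne _ _ _ _ _ _ _ (by omega), map_zero]
    rfl
  | succ a =>
    have h0 : horPart k H I n (a + 1) b e =
        ofTerm k H I a b (by omega) ∘ₗ horD k H I a b := by rw [horPart]
    rw [h0, LinearMap.comp_apply]
    by_cases h : a = i
    · subst h
      obtain rfl : b = j := by omega
      rw [ofTerm_apply, ofTerm_apply]
    · rw [ofTerm_apply_of_ne _ _ _ _ _ _ _ h, ofTerm_apply_of_ne _ _ _ _ _ _ _ (by omega), map_zero]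

lemma verPart_apply {n : ℕ} (a b : ℕ) (e : a + b = n + 1) (y : XTerm k H I a b) (i j : ℕ)
    (e' : i + j = n) : verPart k H I n a b e y ⟨(i, j), e'⟩ =
      verD k H I i j (ofTerm k H I a b e y ⟨(i, j + 1), by omega⟩) := by
  cases b with
  | zero =>
    rw [ofTerm_apply_of_ne _ _ _ _ _ _ _ (by omega), map_zero, verPart]
    rfl
  | succ b =>
    have h0 : verPart k H I n a (b + 1) e =
        ofTerm k H I a b (by omega) ∘ₗ verD k H I a b := by rw [verPart]
    rw [h0, LinearMap.comp_apply]
    by_cases h : a = i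
    · subst h
      obtain rfl : b = j := by omega
      rw [ofTerm_apply, ofTerm_apply]
    · rw [ofTerm_apply_of_ne _ _ _ _ _ _ _ h, ofTerm_apply_of_ne _ _ _ _ _ _ _ h, map_zero]

/-- The total differential in components, the form in which `exists_total_boundary` is stated. -/
lemma totalD_apply {n : ℕ} (x : XTotal k H I (n + 1)) (i j : ℕ) (e : i + j = n) :
    totalD k H I n x ⟨(i, j), e⟩ = horD k H I i j (x ⟨(i + 1, j), by omega⟩) +
      verD k H I i j (x ⟨(i, j + 1), by omega⟩) := by
  induction x using XTotal.induction with
  | h0 => simp only [map_zero, DirectSum.zero_apply, add_zero]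
  | ha x y hx hy =>
    rw [map_add, DirectSum.add_apply, hx, hy, DirectSum.add_apply, DirectSum.add_apply, map_add,
      map_add, add_add_add_comm]
  | hm a b e' y => rw [totalD_ofTerm, DirectSum.add_apply, horPart_apply, verPart_apply]

lemma XTotal.ext {n : ℕ} {x y : XTotal k H I n} (h : ∀ i j e, x ⟨(i, j), e⟩ = y ⟨(i, j), e⟩) :
    x = y := DFinsupp.ext fun ⟨(i, j), e⟩ => h i j e

/-- Only finitely many pairs have sum n, so any family of components is an element of the direct
sum. -/
lemma XTotal.exists_apply_eq {n : ℕ} (f : ∀ i j, i + j = n → XTerm k H I i j) :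
    ∃ x : XTotal k H I n, ∀ i j e, x ⟨(i, j), e⟩ = f i j e := by
  have : Finite {p : ℕ × ℕ // p.1 + p.2 = n} :=
    Finite.of_equiv (Finset.HasAntidiagonal.antidiagonal n)
      (Equiv.subtypeEquivRight fun p => Finset.HasAntidiagonal.mem_antidiagonal)
  have := Fintype.ofFinite {p : ℕ × ℕ // p.1 + p.2 = n}
  let F : ∀ p : {p : ℕ × ℕ // p.1 + p.2 = n}, XTerm k H I p.1.1 p.1.2 :=
    fun p => f p.1.1 p.1.2 p.2
  exact ⟨DFinsupp.equivFunOnFintype.symm F,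
    fun i j e => congrFun (DFinsupp.equivFunOnFintype.apply_symm_apply F) ⟨(i, j), e⟩⟩

lemma totalAug_apply (x : XTotal k H I 0) :
    totalAug k H I x = augZero k H I (x ⟨(0, 0), rfl⟩) := by
  induction x using XTotal.induction with
  | h0 => simp only [map_zero, DirectSum.zero_apply]
  | ha x y hx hy => rw [map_add, hx, hy, DirectSum.add_apply, map_add]
  | hm i j e y =>
    obtain ⟨rfl, rfl⟩ : i = 0 ∧ j = 0 := by omega
    rw [ofTerm_apply, totalAug, ofTerm, DirectSum.toModule_lof]
    rfl

lemma totalD_totalD (hB : IsKoszul k I) {n : ℕ} (x : XTotal k H I (n + 2)) :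
    totalD k H I n (totalD k H I (n + 1) x) = 0 := XTotal.ext fun i j e => by
  rw [totalD_apply, totalD_apply, totalD_apply, map_add, map_add, horD_horD, verD_verD hB,
    horD_verD, zero_add, add_zero, neg_add_cancel]
  rfl

lemma totalAug_totalD (hB : IsKoszul k I) (x : XTotal k H I 1) :
    totalAug k H I (totalD k H I 0 x) = 0 := by
  rw [totalAug_apply, totalD_apply, augZero_eq, map_add, rowAug_horD, rowAug_verD, zero_add,
    (rightAug_exact hB).apply_apply_eq_zero]

lemma mem_range_totalD (hB : IsKoszul k I) {n : ℕ} (z : XTotal k H I n)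
    (hz : ∀ i j (e : i + j + 1 = n), horD k H I i j (z ⟨(i + 1, j), by omega⟩) +
      verD k H I i j (z ⟨(i, j + 1), by omega⟩) = 0)
    (hE : ∀ j (e : 0 + j = n), ∃ y, rightD k H I j y = rowAug k H I j (z ⟨(0, j), e⟩)) :
    ∃ w, totalD k H I n w = z := by
  obtain ⟨f, hf⟩ := exists_total_boundary (fun i j => (horD k H I i j).toAddMonoidHom)
    (fun i j => (verD k H I i j).toAddMonoidHom) (fun j => (rowAug k H I j).toAddMonoidHom)
    (fun j => (rightD k H I j).toAddMonoidHom) horD_exists_of_eq_zero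
    horD_exists_of_rowAug_eq_zero rowAug_surjective horD_verD (verD_verD hB) rowAug_verD n
    (fun i j e => z ⟨(i, j), e⟩) hz hE
  obtain ⟨w, hw⟩ := XTotal.exists_apply_eq f
  refine ⟨w, XTotal.ext fun i j e => ?_⟩
  rw [totalD_apply, hw, hw]
  exact hf i j e

theorem totalD_exact (hB : IsKoszul k I) (n : ℕ) :
    Function.Exact (totalD k H I (n + 1)) (totalD k H I n) := fun z => by
  refine ⟨fun hz => ?_, fun ⟨w, hw⟩ => by rw [← hw, totalD_totalD hB]⟩
  have hz' : ∀ i j (e : i + j = n), horD k H I i j (z ⟨(i + 1, j), by omega⟩) +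
      verD k H I i j (z ⟨(i, j + 1), by omega⟩) = 0 := fun i j e => by
    rw [← totalD_apply z i j e, hz]
    rfl
  refine mem_range_totalD hB z (fun i j e => hz' i j (by omega)) fun j e => ?_
  obtain rfl : j = n + 1 := by omega
  -- The component of z in X_{0,n+1} maps to a cycle of the column, because its vertical
  -- differential is minus a horizontal boundary and the row augmentation kills the latter.
  refine (rightD_exact hB n _).1 ?_
  rw [← rowAug_verD, eq_neg_of_add_eq_zero_right (hz' 0 n (by omega)), map_neg, rowAug_horD,
    neg_zero]

theorem totalAug_exact (hB : IsKoszul k I) :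
    Function.Exact (totalD k H I 0) (totalAug k H I) := fun z => by
  refine ⟨fun hz => ?_, fun ⟨w, hw⟩ => by rw [← hw, totalAug_totalD hB]⟩
  refine mem_range_totalD hB z (fun i j e => absurd e (by omega)) fun j e => ?_
  obtain rfl : j = 0 := by omega
  rw [totalAug_apply, augZero_eq] at hz
  exact (rightAug_exact hB _).1 hz

theorem totalAug_surjective (hB : IsKoszul k I) : Function.Surjective (totalAug k H I) := fun a => by
  obtain ⟨q, rfl⟩ := rightAug_surjective (H := H) hB a
  obtain ⟨x, rfl⟩ := rowAug_surjective 0 q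
  exact ⟨ofTerm k H I 0 0 rfl x, by rw [totalAug_apply, ofTerm_apply, augZero_eq]⟩

end Total

/-! ### The terms of the double complex as free bimodules -/

section

variable {k H N : Type*} [CommRing k] [Ring H] [HopfAlgebra k H] [AddCommGroup N] [Module k N]

/-- The action of `H` on `N` as a map `U ⊗ H ⊗ N → U ⊗ N`. -/
def actMid (U : Type*) [AddCommGroup U] [Module k U] (β : H →ₐ[k] Module.End k N) :
    (U ⊗[k] H) ⊗[k] N →ₗ[k] U ⊗[k] N :=
  (TensorProduct.lift β.toLinearMap).lTensor U ∘ₗ (TensorProduct.assoc k U H N).toLinearMap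

variable {U : Type*} [AddCommGroup U] [Module k U]

lemma actMid_tmul (β : H →ₐ[k] Module.End k N) (u : U) (h : H) (n : N) :
    actMid U β ((u ⊗ₜ h) ⊗ₜ n) = u ⊗ₜ β h n := by
  simp [actMid]

lemma actMid_mulRight (β : H →ₐ[k] Module.End k N) (h : H) (t : U ⊗[k] H) (n : N) :
    actMid U β ((LinearMap.mulRight k h).lTensor U t ⊗ₜ n) = actMid U β (t ⊗ₜ β h n) := by
  induction t with
  | zero => simp only [map_zero, TensorProduct.zero_tmul]
  | add x y hx hy => simp only [map_add, TensorProduct.add_tmul, hx, hy]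
  | tmul u g => simp [actMid_tmul]

variable {B : Type*} [Ring B] [Algebra k B] [Module H B] [IsScalarTower k H B]
  [IsModuleAlgebra k H B]

/-- Since h · 1 = ε(h) 1 in B, the counit axiom leaves the action on the second factor: N embeds in
B ⊗ N as an H-module. -/
lemma diag_one_tmul (β : H →ₐ[k] Module.End k N) (h : H) (n : N) :
    diag (Algebra.lsmul k k B) β h ((1 : B) ⊗ₜ n) = 1 ⊗ₜ β h n := by
  rw [diag_apply]
  simp only [Algebra.lsmul_coe, IsModuleAlgebra.smul_one' (k := k)]
  have := sum_repr ((TensorProduct.mk k B N 1) ∘ₗ β.toLinearMap.flip n ∘ₗ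
    (TensorProduct.lid k H).toLinearMap ∘ₗ (Coalgebra.counit (R := k) (A := H)).rTensor H) h
  simp only [LinearMap.comp_apply, Coalgebra.rTensor_counit_comul] at this
  simp only [LinearMap.rTensor_tmul, LinearEquiv.coe_coe, TensorProduct.lid_tmul,
    TensorProduct.mk_apply, one_smul, map_smul, LinearMap.flip_apply,
    AlgHom.toLinearMap_apply, TensorProduct.smul_tmul'] at this
  simp only [Algebra.algebraMap_eq_smul_one]
  exact this

end

/-! ### Tensoring a module free over H with an induced module, over B # H -/

section Induced

variable {k H B P Q U N : Type*} [CommRing k] [Ring H] [HopfAlgebra k H] [Ring B] [Algebra k B]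
  [Module H B] [IsScalarTower k H B] [IsModuleAlgebra k H B]
  [AddCommGroup P] [Module k P] [Module (Smash k B H)ᵐᵒᵖ P] [IsScalarTower k (Smash k B H)ᵐᵒᵖ P]
  [AddCommGroup Q] [Module k Q] [Module (Smash k B H) Q] [IsScalarTower k (Smash k B H) Q]
  [AddCommGroup U] [Module k U] [AddCommGroup N] [Module k N]
  (f : P ≃ₗ[k] U ⊗[k] H) (e : Q ≃ₗ[k] B ⊗[k] N) (β : H →ₐ[k] Module.End k N)

/-- The right action of `B` on a right module over `B # H`. -/
def actInl : P ⊗[k] B →ₗ[k] P :=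
  TensorProduct.lift (((Algebra.lsmul k k P : (Smash k B H)ᵐᵒᵖ →ₐ[k] _).toLinearMap ∘ₗ
    (MulOpposite.opLinearEquiv k).toLinearMap ∘ₗ (Smash.inl k B H).toLinearMap).flip)

omit [IsScalarTower k (Smash k B H) Q] in
lemma actInl_tmul (p : P) (b : B) :
    actInl (k := k) (H := H) (p ⊗ₜ b) = op (Smash.inl k B H b) • p := rfl

/-- The map `P ⊗ Q → U ⊗ N` for `P ≅ U ⊗ H` and `Q ≅ B ⊗ N`, which sends `p ⊗ b n` to the image of
`p b ⊗ n`. -/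
def inducedAux : P ⊗[k] Q →ₗ[k] U ⊗[k] N :=
  actMid U β ∘ₗ (f.toLinearMap ∘ₗ actInl (k := k) (H := H) (B := B)).rTensor N ∘ₗ
    (TensorProduct.assoc k P B N).symm.toLinearMap ∘ₗ e.toLinearMap.lTensor P

lemma inducedAux_tmul (p : P) (b : B) (n : N) : inducedAux f e β (p ⊗ₜ e.symm (b ⊗ₜ n)) =
    actMid U β (f (op (Smash.inl k B H b) • p) ⊗ₜ n) := by
  simp [inducedAux, actInl_tmul]

variable {f e β}
  (hf : ∀ h p, f (op (Smash.inr k B H h) • p) = (LinearMap.mulRight k h).lTensor U (f p))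
  (hl : ∀ b q, e (Smash.inl k B H b • q) = lam k N b (e q))
  (hr : ∀ h q, e (Smash.inr k B H h • q) = diag (Algebra.lsmul k k B) β h (e q))

-- For b in B this is associativity of the right action on p. For h in H the rule h c = ∑ (h₁ · c)
-- h₂ in A gives p h c ⊗ n = ∑ p (h₁ · c) h₂ ⊗ n, and moving h₂ across to n gives exactly the image
-- of p ⊗ h (c ⊗ n) under the diagonal action.
include hf hl hr in
lemma inducedAux_balanced (p : P) (a : Smash k B H) (q : Q) :
    inducedAux f e β ((op a • p) ⊗ₜ q) = inducedAux f e β (p ⊗ₜ (a • q)) := by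
  have h1 : ∀ (b : B) (p : P) (q : Q), inducedAux f e β ((op (Smash.inl k B H b) • p) ⊗ₜ q) =
      inducedAux f e β (p ⊗ₜ (Smash.inl k B H b • q)) := by
    intro b p q
    obtain ⟨t, rfl⟩ := e.symm.surjective q
    induction t with
    | zero => simp only [map_zero, smul_zero, TensorProduct.tmul_zero]
    | add x y hx hy => simp only [map_add, smul_add, TensorProduct.tmul_add, hx, hy]
    | tmul c n =>
      have h : Smash.inl k B H b • e.symm (c ⊗ₜ n) = e.symm ((b * c) ⊗ₜ n) := by
        rw [LinearEquiv.eq_symm_apply, hl, LinearEquiv.apply_symm_apply, lam_apply]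
      rw [h, inducedAux_tmul, inducedAux_tmul, map_mul, MulOpposite.op_mul, mul_smul]
  have h2 : ∀ (h : H) (p : P) (q : Q), inducedAux f e β ((op (Smash.inr k B H h) • p) ⊗ₜ q) =
      inducedAux f e β (p ⊗ₜ (Smash.inr k B H h • q)) := by
    intro h p q
    obtain ⟨t, rfl⟩ := e.symm.surjective q
    induction t with
    | zero => simp only [map_zero, smul_zero, TensorProduct.tmul_zero]
    | add x y hx hy => simp only [map_add, smul_add, TensorProduct.tmul_add, hx, hy]
    | tmul c n =>
      have h : Smash.inr k B H h • e.symm (c ⊗ₜ n) = ∑ i ∈ (ℛ k h).index,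
          e.symm (((ℛ k h).left i • c) ⊗ₜ β ((ℛ k h).right i) n) := by
        rw [← map_sum, LinearEquiv.eq_symm_apply, hr, LinearEquiv.apply_symm_apply, diag_apply]
        rfl
      rw [h, inducedAux_tmul, TensorProduct.tmul_sum, map_sum, ← mul_smul, ← MulOpposite.op_mul,
        Smash.inr_mul_inl, Finset.op_sum, Finset.sum_smul, map_sum, TensorProduct.sum_tmul, map_sum]
      refine Finset.sum_congr rfl fun i _ => ?_
      rw [inducedAux_tmul, MulOpposite.op_mul, mul_smul, hf, actMid_mulRight]
  induction a using Smash.induction with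
  | h0 => simp only [MulOpposite.op_zero, zero_smul, TensorProduct.zero_tmul, TensorProduct.tmul_zero]
  | ha x y hx hy =>
    simp only [MulOpposite.op_add, add_smul, TensorProduct.add_tmul, TensorProduct.tmul_add, map_add,
      hx, hy]
  | hm b h => rw [← Smash.inl_mul_inr, MulOpposite.op_mul, mul_smul, mul_smul, h2, h1]

variable (f e) in
/-- The map `U ⊗ N → P ⊗_A Q` for `P ≅ U ⊗ H` and `Q ≅ B ⊗ N`. -/
def inducedMap : U ⊗[k] N →ₗ[k] BTensor k (Smash k B H) P Q :=
  BTensor.proj k (Smash k B H) P Q ∘ₗ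
    TensorProduct.map (f.symm.toLinearMap ∘ₗ (TensorProduct.mk k U H).flip 1)
      (e.symm.toLinearMap ∘ₗ TensorProduct.mk k B N 1)

omit [IsScalarTower k (Smash k B H)ᵐᵒᵖ P] [IsScalarTower k (Smash k B H) Q] in
lemma inducedMap_tmul (u : U) (n : N) : inducedMap f e (u ⊗ₜ n) =
    BTensor.tmul k (Smash k B H) (f.symm (u ⊗ₜ 1)) (e.symm (1 ⊗ₜ n)) := rfl

include hf hl hr in
/-- If `P ≅ U ⊗ H` is free as a right `H`-module and `Q ≅ B ⊗ N` is induced from the `H`-module `N`,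
then `P ⊗_A Q ≅ U ⊗ N`. -/
lemma inducedMap_bijective : Function.Bijective (inducedMap f e :
    U ⊗[k] N →ₗ[k] BTensor k (Smash k B H) P Q) := by
  constructor
  · have h : BTensor.lift k (Smash k B H) (inducedAux f e β) (inducedAux_balanced hf hl hr) ∘ₗ
        inducedMap f e = LinearMap.id := TensorProduct.ext' fun u n => by
      rw [LinearMap.comp_apply, inducedMap_tmul, BTensor.lift_tmul, inducedAux_tmul, map_one,
        MulOpposite.op_one, one_smul, LinearEquiv.apply_symm_apply, actMid_tmul, map_one]
      rfl
    exact Function.LeftInverse.injective (g := BTensor.lift k (Smash k B H) (inducedAux f e β)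
      (inducedAux_balanced hf hl hr)) fun x => LinearMap.congr_fun h x
  -- In p ⊗ (c ⊗ n) the factor c moves to the left, leaving 1 ⊗ n on the right. Then p c is written
  -- in U ⊗ H, and for each term u ⊗ h the factor h moves back, replacing 1 ⊗ n by 1 ⊗ h n.
  · rw [← LinearMap.range_eq_top, eq_top_iff]
    rintro x -
    induction x using BTensor.induction with
    | h0 => exact zero_mem _
    | ha x y hx hy => exact add_mem hx hy
    | hm p q =>
    obtain ⟨t, rfl⟩ := e.symm.surjective q
    induction t with
    | zero => rw [map_zero, BTensor.tmul, TensorProduct.tmul_zero, map_zero]; exact zero_mem _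
    | add x y hx hy => rw [map_add, BTensor.tmul_add]; exact add_mem hx hy
    | tmul c n =>
    have h1 : e.symm (c ⊗ₜ n) = Smash.inl k B H c • e.symm (1 ⊗ₜ n) := by
      rw [LinearEquiv.symm_apply_eq, hl, LinearEquiv.apply_symm_apply, lam_apply, mul_one]
    rw [h1, ← BTensor.op_smul_tmul]
    obtain ⟨s, hs⟩ := f.symm.surjective (op (Smash.inl k B H c) • p)
    rw [← hs]
    clear hs h1
    induction s with
    | zero => rw [map_zero, BTensor.tmul, TensorProduct.zero_tmul, map_zero]; exact zero_mem _
    | add x y hx hy => rw [map_add, BTensor.add_tmul]; exact add_mem hx hy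
    | tmul u h =>
    have h2 : f.symm (u ⊗ₜ h) = op (Smash.inr k B H h) • f.symm (u ⊗ₜ 1) := by
      rw [LinearEquiv.symm_apply_eq, hf, LinearEquiv.apply_symm_apply, LinearMap.lTensor_tmul,
        LinearMap.mulRight_apply, one_mul]
    have h3 : Smash.inr k B H h • e.symm (1 ⊗ₜ n) = e.symm (1 ⊗ₜ β h n) := by
      rw [LinearEquiv.eq_symm_apply, hr, LinearEquiv.apply_symm_apply, diag_one_tmul]
    rw [h2, BTensor.op_smul_tmul, h3]
    exact ⟨u ⊗ₜ β h n, inducedMap_tmul u _⟩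

end Induced

/-! ### The bar resolution side -/

section BarSide

variable (k H B : Type*) [CommRing k] [Ring H] [HopfAlgebra k H] [Ring B] [Algebra k B]
  [Module H B] [IsScalarTower k H B] [IsModuleAlgebra k H B]

/-- The isomorphism `H ⊗ (H^{⊗i} ⊗ H) ≃ H^{⊗(i+2)}`. -/
def barEquiv (i : ℕ) : H ⊗[k] ((⨂[k]^i H) ⊗[k] H) ≃ₗ[k] BarTerm k H i :=
  TensorProduct.congr (LinearEquiv.refl k H)
    (LinearEquiv.ofBijective _ (snocMap_id_bijective i)) ≪≫ₗ consE k H (i + 1)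

variable {k H B}

lemma smul_barEquiv {i : ℕ} (g h : H) (t : (⨂[k]^i H) ⊗[k] H) :
    g • barEquiv k H i (h ⊗ₜ t) = barEquiv k H i ((g * h) ⊗ₜ t) := lmulHom_tcons _ _ _

lemma rmulHom_snocMap {i : ℕ} (x : ⨂[k]^i H) (h g : H) :
    rmulHom k H i (op g) (snocMap LinearMap.id i (x ⊗ₜ h)) =
      snocMap LinearMap.id i (x ⊗ₜ (h * g)) := by
  induction i with
  | zero => rw [snocMap_zero, snocMap_zero, rmulHom_zero_tcons]
  | succ i ih =>
    induction x using tcons_induction with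
    | h0 => simp only [TensorProduct.zero_tmul, map_zero]
    | ha x y hx hy => simp only [TensorProduct.add_tmul, map_add, hx, hy]
    | hc m y => rw [snocMap_tcons, snocMap_tcons, rmulHom_succ_tcons, ih]

lemma op_smul_barEquiv {i : ℕ} (g h h' : H) (x : ⨂[k]^i H) :
    op g • barEquiv k H i (h ⊗ₜ (x ⊗ₜ h')) = barEquiv k H i (h ⊗ₜ (x ⊗ₜ (h' * g))) :=
  (rmulHom_succ_tcons (op g) h (snocMap LinearMap.id i (x ⊗ₜ h'))).trans
    (congrArg (tcons h) (rmulHom_snocMap x h' g))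

variable (k H B) in
/-- The map `A ⊗_H H^{⊗(i+2)} → (A ⊗ H^{⊗i}) ⊗ H`. -/
def indBarTo (i : ℕ) : IndLeft k B H (BarTerm k H i) →ₗ[k]
    (Smash k B H ⊗[k] (⨂[k]^i H)) ⊗[k] H :=
  BTensor.lift k H
    ((TensorProduct.assoc k _ _ _).symm.toLinearMap ∘ₗ
      (LinearMap.mul' k (Smash k B H) ∘ₗ
        (Smash.inr k B H).toLinearMap.lTensor (Smash k B H)).rTensor _ ∘ₗ
      (TensorProduct.assoc k (Smash k B H) H ((⨂[k]^i H) ⊗[k] H)).symm.toLinearMap ∘ₗ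
      (barEquiv k H i).symm.toLinearMap.lTensor (Smash k B H))
    fun a h x => by
      obtain ⟨t, rfl⟩ := (barEquiv k H i).surjective x
      induction t with
      | zero => simp only [map_zero, smul_zero, TensorProduct.tmul_zero]
      | add x y hx hy => simp only [map_add, smul_add, TensorProduct.tmul_add, hx, hy]
      | tmul g t =>
        rw [smul_barEquiv]
        simp [Smash.smul_right_def, mul_assoc]

lemma indBarTo_tmul {i : ℕ} (a : Smash k B H) (h : H) (t : (⨂[k]^i H) ⊗[k] H) :
    indBarTo k H B i (BTensor.tmul k H a (barEquiv k H i (h ⊗ₜ t))) =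
      (TensorProduct.assoc k _ _ _).symm ((a * Smash.inr k B H h) ⊗ₜ t) := by
  rw [indBarTo, BTensor.lift_tmul]
  simp

variable (k H B) in
/-- The isomorphism `A ⊗_H H^{⊗(i+2)} ≃ (A ⊗ H^{⊗i}) ⊗ H`. -/
def indBarEquiv (i : ℕ) : IndLeft k B H (BarTerm k H i) ≃ₗ[k]
    (Smash k B H ⊗[k] (⨂[k]^i H)) ⊗[k] H :=
  LinearEquiv.ofLinearMap (indBarTo k H B i)
    (BTensor.proj k H (Smash k B H) (BarTerm k H i) ∘ₗ
      ((barEquiv k H i).toLinearMap ∘ₗ TensorProduct.mk k H _ 1).lTensor (Smash k B H) ∘ₗ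
      (TensorProduct.assoc k _ _ _).toLinearMap)
    (TensorProduct.ext (TensorProduct.ext' fun a x => LinearMap.ext fun h => by
      have h1 := indBarTo_tmul (i := i) a 1 (x ⊗ₜ[k] h)
      rw [map_one, mul_one] at h1
      exact h1))
    (BTensor.hom_ext fun a x => by
      obtain ⟨t, rfl⟩ := (barEquiv k H i).surjective x
      induction t with
      | zero => simp only [map_zero, BTensor.tmul, TensorProduct.tmul_zero]
      | add x y hx hy => simp only [map_add, BTensor.tmul_add, hx, hy]
      | tmul h t =>
        rw [LinearMap.comp_apply, indBarTo_tmul]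
        simp only [LinearMap.comp_apply, LinearEquiv.coe_coe, LinearEquiv.apply_symm_apply,
          LinearMap.lTensor_tmul, TensorProduct.mk_apply, BTensor.proj_tmul, LinearMap.id_apply]
        rw [← Smash.smul_right_def, BTensor.op_smul_tmul, smul_barEquiv, mul_one])

lemma indBarEquiv_symm_tmul {i : ℕ} (a : Smash k B H) (x : ⨂[k]^i H) (h : H) :
    (indBarEquiv k H B i).symm ((a ⊗ₜ x) ⊗ₜ h) =
      BTensor.tmul k H a (barEquiv k H i (1 ⊗ₜ (x ⊗ₜ h))) := rfl

/-- H acts on the right of C_i through its last factor, and this factor is the one split off. So A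
⊗_H C_i is free over H on the right, as `inducedMap_bijective` requires. -/
lemma indBarEquiv_op_inr_smul {i : ℕ} (h : H) (p : IndLeft k B H (BarTerm k H i)) :
    indBarEquiv k H B i (op (Smash.inr k B H h) • p) =
      (LinearMap.mulRight k h).lTensor _ (indBarEquiv k H B i p) := by
  obtain ⟨t, rfl⟩ := (indBarEquiv k H B i).symm.surjective p
  induction t with
  | zero =>
    rw [LinearEquiv.map_zero, smul_zero, LinearEquiv.map_zero, LinearMap.map_zero]
  | add x y hx hy =>
    rw [LinearEquiv.map_add, smul_add, LinearEquiv.map_add, LinearEquiv.map_add, LinearMap.map_add,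
      hx, hy]
  | tmul u g =>
    induction u with
    | zero =>
      rw [TensorProduct.zero_tmul, LinearEquiv.map_zero, smul_zero, LinearEquiv.map_zero,
        LinearMap.map_zero]
    | add x y hx hy =>
      rw [TensorProduct.add_tmul, LinearEquiv.map_add, smul_add, LinearEquiv.map_add,
        LinearEquiv.map_add, LinearMap.map_add, hx, hy]
    | tmul a x =>
      rw [LinearEquiv.apply_symm_apply, LinearMap.lTensor_tmul, ← LinearEquiv.eq_symm_apply,
        indBarEquiv_symm_tmul, IndLeft.op_inr_smul, op_smul_barEquiv, LinearMap.mulRight_apply,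
        indBarEquiv_symm_tmul]

end BarSide

/-! ### The Koszul resolution side -/

section KoszulSide

universe u v w

variable (k : Type u) {V : Type v} (H : Type w) [Field k] [AddCommGroup V] [Module k V]
  [Ring H] [HopfAlgebra k H] (I : Submodule k (V ⊗[k] V))
  [Module H (QuadAlg k I)] [IsScalarTower k H (QuadAlg k I)] [IsModuleAlgebra k H (QuadAlg k I)]

variable {k I} in
lemma smul_koszulEquiv {n : ℕ} (a b : QuadAlg k I) (t : koszulSpace I n ⊗[k] QuadAlg k I) :
    a • koszulEquiv k I n (b ⊗ₜ t) = koszulEquiv k I n ((a * b) ⊗ₜ t) := by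
  apply KoszulTerm.incl_injective
  rw [KoszulTerm.incl_smul, incl_koszulEquiv, incl_koszulEquiv]
  exact lmulHom_tcons _ _ _

variable {k I} in
lemma op_smul_koszulEquiv {n : ℕ} (a b c : QuadAlg k I) (x : koszulSpace I n) :
    op a • koszulEquiv k I n (b ⊗ₜ (x ⊗ₜ c)) = koszulEquiv k I n (b ⊗ₜ (x ⊗ₜ (c * a))) := by
  apply KoszulTerm.incl_injective
  rw [KoszulTerm.incl_op_smul, incl_koszulEquiv, incl_koszulEquiv, koszulIncl_tmul, koszulIncl_tmul,
    rmulHom_succ_tcons, emb_mul]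

/-- The map `Dₙ ⊗_B A → B ⊗ (D'ₙ ⊗ A)`. -/
def indKoszulTo (n : ℕ) : IndRight k (QuadAlg k I) H (KoszulTerm k I n) →ₗ[k]
    QuadAlg k I ⊗[k] (koszulSpace I n ⊗[k] SmashAlg k H I) :=
  BTensor.lift k (QuadAlg k I)
    (((LinearMap.mul' k (SmashAlg k H I) ∘ₗ
          (Smash.inl k (QuadAlg k I) H).toLinearMap.rTensor _).lTensor _ ∘ₗ
        (TensorProduct.assoc k (koszulSpace I n) (QuadAlg k I)
          (SmashAlg k H I)).toLinearMap).lTensor _ ∘ₗ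
      (TensorProduct.assoc k (QuadAlg k I) (koszulSpace I n ⊗[k] QuadAlg k I)
        (SmashAlg k H I)).toLinearMap ∘ₗ
      (koszulEquiv k I n).symm.toLinearMap.rTensor _)
    fun y b a => by
      obtain ⟨t, rfl⟩ := (koszulEquiv k I n).surjective y
      induction t with
      | zero => simp only [map_zero, smul_zero, TensorProduct.zero_tmul]
      | add x y hx hy => simp only [map_add, smul_add, TensorProduct.add_tmul, hx, hy]
      | tmul c t =>
        induction t with
        | zero => simp only [map_zero, smul_zero, TensorProduct.zero_tmul, TensorProduct.tmul_zero]
        | add x y hx hy =>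
          simp only [map_add, smul_add, TensorProduct.add_tmul, TensorProduct.tmul_add, hx, hy]
        | tmul x c' =>
          rw [op_smul_koszulEquiv]
          simp [Smash.smul_left_def, mul_assoc]

variable {k H I} in
lemma indKoszulTo_tmul {n : ℕ} (b c : QuadAlg k I) (x : koszulSpace I n) (a : SmashAlg k H I) :
    indKoszulTo k H I n (BTensor.tmul k _ (koszulEquiv k I n (b ⊗ₜ (x ⊗ₜ c))) a) =
      b ⊗ₜ (x ⊗ₜ (Smash.inl k _ H c * a)) := by
  rw [indKoszulTo, BTensor.lift_tmul]
  simp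

/-- The isomorphism `Dₙ ⊗_B A ≃ B ⊗ (D'ₙ ⊗ A)`. -/
def indKoszulEquiv (n : ℕ) : IndRight k (QuadAlg k I) H (KoszulTerm k I n) ≃ₗ[k]
    QuadAlg k I ⊗[k] (koszulSpace I n ⊗[k] SmashAlg k H I) :=
  LinearEquiv.ofLinearMap (indKoszulTo k H I n)
    (BTensor.proj k (QuadAlg k I) (KoszulTerm k I n) (SmashAlg k H I) ∘ₗ
      ((koszulEquiv k I n).toLinearMap ∘ₗ
        ((TensorProduct.mk k (koszulSpace I n) (QuadAlg k I)).flip 1).lTensor _).rTensor _ ∘ₗ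
      (TensorProduct.assoc k _ _ _).symm.toLinearMap)
    (TensorProduct.ext' fun b t => by
      induction t with
      | zero => simp only [TensorProduct.tmul_zero, map_zero]
      | add x y hx hy => simp only [TensorProduct.tmul_add, map_add, hx, hy]
      | tmul x a =>
        have h := indKoszulTo_tmul (H := H) b 1 x a
        rw [map_one, one_mul] at h
        exact h)
    (BTensor.hom_ext fun y a => by
      obtain ⟨t, rfl⟩ := (koszulEquiv k I n).surjective y
      induction t with
      | zero => simp only [map_zero, BTensor.tmul, TensorProduct.zero_tmul]
      | add x y hx hy => simp only [map_add, BTensor.add_tmul, hx, hy]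
      | tmul c t =>
        induction t with
        | zero => simp only [map_zero, BTensor.tmul, TensorProduct.zero_tmul,
            TensorProduct.tmul_zero]
        | add x y hx hy => simp only [map_add, BTensor.add_tmul, TensorProduct.tmul_add, hx, hy]
        | tmul x c' =>
          rw [LinearMap.comp_apply, indKoszulTo_tmul]
          simp only [LinearMap.comp_apply, LinearEquiv.coe_coe, TensorProduct.assoc_symm_tmul,
            LinearMap.rTensor_tmul, LinearMap.lTensor_tmul, LinearMap.flip_apply,
            TensorProduct.mk_apply, BTensor.proj_tmul, LinearMap.id_apply]
          rw [← Smash.smul_left_def, ← BTensor.op_smul_tmul, op_smul_koszulEquiv, one_mul])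

variable {k H I}

lemma indKoszulEquiv_symm_tmul {n : ℕ} (b : QuadAlg k I) (x : koszulSpace I n)
    (a : SmashAlg k H I) : (indKoszulEquiv k H I n).symm (b ⊗ₜ (x ⊗ₜ a)) =
      BTensor.tmul k _ (koszulEquiv k I n (b ⊗ₜ (x ⊗ₜ 1))) a := rfl

lemma indKoszulEquiv_symm_op_smul {n : ℕ} (b : QuadAlg k I) (x : koszulSpace I n)
    (a a' : SmashAlg k H I) : op a' • (indKoszulEquiv k H I n).symm (b ⊗ₜ (x ⊗ₜ a)) =
      (indKoszulEquiv k H I n).symm (b ⊗ₜ (x ⊗ₜ (a * a'))) := rfl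

variable [Module H V] [IsScalarTower k H V] [IsGradedAction k H I]

variable (k H I) in
/-- The action of `H` on `D'ₙ`. -/
def koszulAct (n : ℕ) : H →ₐ[k] Module.End k (koszulSpace I n) :=
  restrictHom (tpAct k H V n) (koszulSpace I n) fun h _ => tpAct_mem h

variable (k H I) in
/-- The diagonal action of `H` on `D'ₙ ⊗ A`. -/
def koszulSmashAct (n : ℕ) : H →ₐ[k] Module.End k (koszulSpace I n ⊗[k] SmashAlg k H I) :=
  diag (koszulAct k H I n) ((Algebra.lmul k (SmashAlg k H I)).comp (Smash.inr k (QuadAlg k I) H))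

/-- As h · 1 = ε(h) 1, the counit axiom absorbs the action on the last factor. This makes B ⊗ D'_n ⊗
1 stable under H. -/
lemma tpAct_emb_one {n : ℕ} (h : H) (x : ⨂[k]^n V) :
    tpAct k H (QuadAlg k I) (n + 1) h (emb k I n x 1) = emb k I n (tpAct k H V n h x) 1 := by
  rw [tpAct_emb]
  simp only [IsModuleAlgebra.smul_one' (k := k), Algebra.algebraMap_eq_smul_one, map_smul]
  have := sum_repr ((emb k I n).flip 1 ∘ₗ (tpAct k H V n).toLinearMap.flip x ∘ₗ
    (TensorProduct.rid k H).toLinearMap ∘ₗ (Coalgebra.counit (R := k) (A := H)).lTensor H) h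
  simp only [LinearMap.comp_apply, Coalgebra.lTensor_counit_comul] at this
  simpa using this

lemma smul_koszulEquiv_one {n : ℕ} (h : H) (b : QuadAlg k I) (x : koszulSpace I n) :
    h • koszulEquiv k I n (b ⊗ₜ (x ⊗ₜ 1)) = ∑ i ∈ (ℛ k h).index,
      koszulEquiv k I n (((ℛ k h).left i • b) ⊗ₜ (koszulAct k H I n ((ℛ k h).right i) x ⊗ₜ 1)) := by
  apply KoszulTerm.incl_injective
  rw [KoszulTerm.incl_act, incl_koszulEquiv, koszulIncl_tmul, map_sum, tpAct_tcons]
  refine Finset.sum_congr rfl fun i _ => ?_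
  rw [incl_koszulEquiv, koszulIncl_tmul, tpAct_emb_one]
  rfl

lemma indKoszulEquiv_inl_smul {n : ℕ} (b : QuadAlg k I) (q : RightTerm k H I n) :
    indKoszulEquiv k H I n (Smash.inl k (QuadAlg k I) H b • q) =
      lam k (koszulSpace I n ⊗[k] SmashAlg k H I) b (indKoszulEquiv k H I n q) := by
  obtain ⟨t, rfl⟩ := (indKoszulEquiv k H I n).symm.surjective q
  induction t with
  | zero => simp only [map_zero, smul_zero]
  | add x y hx hy => simp only [map_add, smul_add, hx, hy]
  | tmul c t =>
    induction t with
    | zero => simp only [TensorProduct.tmul_zero, map_zero, smul_zero]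
    | add x y hx hy => simp only [TensorProduct.tmul_add, map_add, smul_add, hx, hy]
    | tmul x a =>
      rw [LinearEquiv.apply_symm_apply, ← LinearEquiv.eq_symm_apply, indKoszulEquiv_symm_tmul,
        IndRight.inl_smul, smul_koszulEquiv, lam_apply, indKoszulEquiv_symm_tmul]

/-- On D_n ⊗_B A the coproduct of h is distributed first over D_n and A, and then within D_n over B
and D'_n. In B ⊗ (D'_n ⊗ A) the bracketing is the other one, and coassociativity identifies the two.
-/
lemma indKoszulEquiv_inr_smul {n : ℕ} (h : H) (q : RightTerm k H I n) :
    indKoszulEquiv k H I n (Smash.inr k (QuadAlg k I) H h • q) =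
      diag (M := QuadAlg k I) (N := koszulSpace I n ⊗[k] SmashAlg k H I)
        (Algebra.lsmul k k (QuadAlg k I)) (koszulSmashAct k H I n) h
        (indKoszulEquiv k H I n q) := by
  obtain ⟨t, rfl⟩ := (indKoszulEquiv k H I n).symm.surjective q
  induction t with
  | zero => simp only [map_zero, smul_zero]
  | add x y hx hy => simp only [map_add, smul_add, hx, hy]
  | tmul c t =>
    induction t with
    | zero => simp only [TensorProduct.tmul_zero, map_zero, smul_zero]
    | add x y hx hy => simp only [TensorProduct.tmul_add, map_add, smul_add, hx, hy]
    | tmul x a =>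
      rw [LinearEquiv.apply_symm_apply, indKoszulEquiv_symm_tmul, IndRight.inr_smul, diag_apply]
      simp only [smul_koszulEquiv_one, BTensor.sum_tmul, ← indKoszulEquiv_symm_tmul, map_sum,
        LinearEquiv.apply_symm_apply, koszulSmashAct, diag_apply, TensorProduct.tmul_sum]
      exact sum_coassoc (TensorProduct.map (orb k H c)
        (TensorProduct.map ((koszulAct k H I n).toLinearMap.flip x)
          (LinearMap.mulRight k a ∘ₗ (Smash.inr k (QuadAlg k I) H).toLinearMap))) h

end KoszulSide

/-! ### The isomorphism of X_{i,j} with A ⊗ C'_i ⊗ D'_j ⊗ A, and freeness over A^e -/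

section FreeTerms

universe u v w

variable (k : Type u) {V : Type v} (H : Type w) [Field k] [AddCommGroup V] [Module k V]
  [Ring H] [HopfAlgebra k H] (I : Submodule k (V ⊗[k] V))
  [Module H V] [IsScalarTower k H V]
  [Module H (QuadAlg k I)] [IsScalarTower k H (QuadAlg k I)] [IsModuleAlgebra k H (QuadAlg k I)]
  [IsGradedAction k H I]

/-- The reassociation `A ⊗ (C' ⊗ D') ⊗ A ≃ (A ⊗ C') ⊗ (D' ⊗ A)`. -/
def freeAssoc (A C D : Type*) [Ring A] [Algebra k A] [AddCommGroup C] [Module k C]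
    [AddCommGroup D] [Module k D] :
    FreeBimod k A (C ⊗[k] D) ≃ₗ[k] (A ⊗[k] C) ⊗[k] (D ⊗[k] A) :=
  (show A ⊗[k] ((C ⊗[k] D) ⊗[k] A) ≃ₗ[k] (A ⊗[k] C) ⊗[k] (D ⊗[k] A) from
    TensorProduct.congr (LinearEquiv.refl k A) (TensorProduct.assoc k C D A) ≪≫ₗ
      (TensorProduct.assoc k A C (D ⊗[k] A)).symm)

@[elab_as_elim]
lemma FreeBimod.induction {A C D : Type*} [Ring A] [Algebra k A] [AddCommGroup C] [Module k C]
    [AddCommGroup D] [Module k D] {p : FreeBimod k A (C ⊗[k] D) → Prop}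
    (x : FreeBimod k A (C ⊗[k] D)) (h0 : p 0) (ha : ∀ x y, p x → p y → p (x + y))
    (hm : ∀ a c d a', p (FreeBimod.mk a (c ⊗ₜ d) a')) : p x := by
  obtain ⟨t, rfl⟩ := (freeAssoc k A C D).symm.surjective x
  induction t with
  | zero => rw [map_zero]; exact h0
  | add x y hx hy => rw [map_add]; exact ha _ _ hx hy
  | tmul s t =>
    induction s with
    | zero => rw [TensorProduct.zero_tmul, map_zero]; exact h0
    | add x y hx hy => rw [TensorProduct.add_tmul, map_add]; exact ha _ _ hx hy
    | tmul a c =>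
      induction t with
      | zero => rw [TensorProduct.tmul_zero, map_zero]; exact h0
      | add x y hx hy => rw [TensorProduct.tmul_add, map_add]; exact ha _ _ hx hy
      | tmul d a' => exact hm a c d a'

/-- The map `A ⊗ C'_i ⊗ D'_j ⊗ A → X_{i,j}`,
`a ⊗ c ⊗ d ⊗ a' ↦ (a ⊗ (1 ⊗ c ⊗ 1)) ⊗ ((1 ⊗ d ⊗ 1) ⊗ a')`. -/
def freeToXAux (i j : ℕ) :
    FreeBimod k (SmashAlg k H I) ((⨂[k]^i H) ⊗[k] koszulSpace I j) →ₗ[k] XTerm k H I i j :=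
  inducedMap (P := LeftTerm k H I i) (Q := RightTerm k H I j)
    (U := SmashAlg k H I ⊗[k] (⨂[k]^i H)) (N := koszulSpace I j ⊗[k] SmashAlg k H I)
    (indBarEquiv k H (QuadAlg k I) i) (indKoszulEquiv k H I j) ∘ₗ
    (freeAssoc k (SmashAlg k H I) (⨂[k]^i H) (koszulSpace I j)).toLinearMap

variable {k H I} in
lemma freeToXAux_mk {i j : ℕ} (a a' : SmashAlg k H I) (c : ⨂[k]^i H) (d : koszulSpace I j) :
    freeToXAux k H I i j (FreeBimod.mk a (c ⊗ₜ d) a') =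
      BimodTensor.tmul k _ (BTensor.tmul k H a (barEquiv k H i (1 ⊗ₜ (c ⊗ₜ 1))))
        ((indKoszulEquiv k H I j).symm (1 ⊗ₜ (d ⊗ₜ a'))) := rfl

/-- This is `inducedMap_bijective` with U = A ⊗ C'_i and with N = D'_j ⊗ A under the diagonal action
of H. -/
lemma freeToXAux_bijective (i j : ℕ) : Function.Bijective (freeToXAux k H I i j) :=
  (inducedMap_bijective (P := LeftTerm k H I i) (Q := RightTerm k H I j)
    (U := SmashAlg k H I ⊗[k] (⨂[k]^i H)) (N := koszulSpace I j ⊗[k] SmashAlg k H I)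
    (β := koszulSmashAct k H I j) indBarEquiv_op_inr_smul indKoszulEquiv_inl_smul indKoszulEquiv_inr_smul).comp (LinearEquiv.bijective _)

/-- The map `A ⊗ C'_i ⊗ D'_j ⊗ A → X_{i,j}` as a map of `A^e`-modules. -/
def freeToX (i j : ℕ) : FreeBimod k (SmashAlg k H I) ((⨂[k]^i H) ⊗[k] koszulSpace I j)
    →ₗ[Env k (SmashAlg k H I)] XTerm k H I i j :=
  bimodHom (freeToXAux k H I i j)
    (fun a x => by
      induction x using FreeBimod.induction with
      | h0 => simp only [smul_zero, map_zero]
      | ha x y hx hy => simp only [smul_add, map_add, hx, hy]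
      | hm b c d b' => rw [FreeBimod.smul_mk, freeToXAux_mk, freeToXAux_mk, BimodTensor.smul_tmul,
          IndLeft.smul_tmul])
    (fun a x => by
      induction x using FreeBimod.induction with
      | h0 => simp only [smul_zero, map_zero]
      | ha x y hx hy => simp only [smul_add, map_add, hx, hy]
      | hm b c d b' => rw [FreeBimod.op_smul_mk, freeToXAux_mk, freeToXAux_mk,
          BimodTensor.op_smul_tmul, indKoszulEquiv_symm_op_smul])

/-- The isomorphism `X_{i,j} ≃ A ⊗ C'_i ⊗ D'_j ⊗ A` of `A^e`-modules. -/
def xTermEquiv (i j : ℕ) : XTerm k H I i j ≃ₗ[Env k (SmashAlg k H I)]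
    FreeBimod k (SmashAlg k H I) ((⨂[k]^i H) ⊗[k] koszulSpace I j) :=
  (LinearEquiv.ofBijective (freeToX k H I i j) (freeToXAux_bijective k H I i j)).symm

/-- The isomorphism `A^e ⊗ W ≃ A ⊗ W ⊗ A`. -/
def envEquiv (A W : Type*) [Ring A] [Algebra k A] [AddCommGroup W] [Module k W] :
    Env k A ⊗[k] W ≃ₗ[k] FreeBimod k A W :=
  (show (A ⊗[k] Aᵐᵒᵖ) ⊗[k] W ≃ₗ[k] A ⊗[k] (W ⊗[k] A) from
    TensorProduct.assoc k A Aᵐᵒᵖ W ≪≫ₗ TensorProduct.congr (LinearEquiv.refl k A)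
      (TensorProduct.comm k Aᵐᵒᵖ W ≪≫ₗ
        TensorProduct.congr (LinearEquiv.refl k W) (MulOpposite.opLinearEquiv k).symm))

lemma envEquiv_tmul {A W : Type*} [Ring A] [Algebra k A] [AddCommGroup W] [Module k W] (a : A)
    (b : Aᵐᵒᵖ) (w : W) : envEquiv k A W ((a ⊗ₜ b) ⊗ₜ w) = FreeBimod.mk a w b.unop := rfl

/-- A ⊗ W ⊗ A is A^e ⊗ W after exchanging the last two factors, so a basis of the vector space W
gives a basis over A^e. -/
instance FreeBimod.free (A W : Type*) [Ring A] [Algebra k A] [AddCommGroup W] [Module k W] :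
    Module.Free (Env k A) (FreeBimod k A W) := by
  let e : Env k A ⊗[k] W ≃ₗ[Env k A] FreeBimod k A W :=
    { envEquiv k A W with
      map_smul' := fun r t => by
        change envEquiv k A W (r • t) = r • envEquiv k A W t
        induction r using TensorProduct.induction_on with
        | zero =>
          exact (congrArg (envEquiv k A W) (zero_smul (Env k A) t)).trans
            ((map_zero _).trans (zero_smul (Env k A) (envEquiv k A W t)).symm)
        | add x y hx hy =>
          exact (congrArg (envEquiv k A W) (add_smul (R := Env k A) x y t)).trans
            ((map_add _ _ _).trans ((congrArg₂ (· + ·) hx hy).trans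
              (add_smul (R := Env k A) x y (envEquiv k A W t)).symm))
        | tmul a b =>
          induction t with
          | zero => rw [smul_zero, map_zero, smul_zero]
          | add x y hx hy => rw [smul_add, map_add, map_add, smul_add, hx, hy]
          | tmul s w =>
            induction s using TensorProduct.induction_on with
            | zero => rw [TensorProduct.zero_tmul, smul_zero, map_zero, smul_zero]
            | add x y hx hy =>
              rw [TensorProduct.add_tmul, smul_add, map_add, map_add, smul_add, hx, hy]
            | tmul c d =>
              rw [TensorProduct.smul_tmul', smul_eq_mul, Algebra.TensorProduct.tmul_mul_tmul,
                envEquiv_tmul, envEquiv_tmul]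
              rfl }
  exact Module.Free.of_basis
    ((Algebra.TensorProduct.basis (Env k A) (Module.Free.chooseBasis k W)).map e)

instance XTerm.free (i j : ℕ) : Module.Free (Env k (SmashAlg k H I)) (XTerm k H I i j) :=
  Module.Free.of_equiv (xTermEquiv k H I i j).symm

theorem XTotal.free (n : ℕ) : Module.Free (Env k (SmashAlg k H I)) (XTotal k H I n) :=
  inferInstance

end FreeTerms

end SmashResolution

end

/-! ### The theorem -/

open SmashResolution in
theorem theorem2p5 {k V H : Type*} [Field k] [AddCommGroup V] [Module k V] [FiniteDimensional k V]
    [Ring H] [HopfAlgebra k H] (hS : Function.Bijective (HopfAlgebra.antipode k : H → H))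
    (I : Submodule k (V ⊗[k] V)) (hB : IsKoszul k I)
    [Module H V] [IsScalarTower k H V]
    [Module H (QuadAlg k I)] [IsScalarTower k H (QuadAlg k I)]
    [IsModuleAlgebra k H (QuadAlg k I)] [IsGradedAction k H I] :
    (∀ i j : ℕ, Nonempty (XTerm k H I i j ≃ₗ[Env k (SmashAlg k H I)]
      FreeBimod k (SmashAlg k H I) ((⨂[k]^i H) ⊗[k] koszulSpace I j))) ∧
    (∀ n : ℕ, Module.Free (Env k (SmashAlg k H I)) (XTotal k H I n)) ∧
    (∀ n : ℕ, Function.Exact (totalD k H I (n + 1)) (totalD k H I n)) ∧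
    Function.Exact (totalD k H I 0) (totalAug k H I) ∧
    Function.Surjective (totalAug k H I) :=
  ⟨fun i j => ⟨xTermEquiv k H I i j⟩, fun n => XTotal.free k H I n, totalD_exact hB,
    totalAug_exact hB, totalAug_surjective hB⟩
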